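/- Let $r\ge 2$ be an even integer, let $Y=\mathbb{P}^1\times\mathbb{P}^1$ over $\mathbb{C}$, and let $\pi\colon X\to Y$ be the blowup of $Y$ at $r$ points $p_1,\dots,p_r$, with exceptional divisors $E_1,\dots,E_r$. Let $F_1,F_2\in H^2(X,\mathbb{R})$ be the pullbacks of the classes of $\mathcal{O}_Y(1,0)$ and $\mathcal{O}_Y(0,1)$, let $E=\sum_i E_i$, and let $V_r\subset H^2(X,\mathbb{R})$ be the three-dimensional subspace spanned by $F_1,F_2,E$. Put $$\alpha_r=\frac{(r-4)+\sqrt{r(r-8)}}{4},\qquad \beta_r=\frac{(r-4)-\sqrt{r(r-8)}}{4}$$ (complex numbers if $r<8$). Let $T_r\colon V_r\to V_r$ be the linear map given in the basis $F_1,F_2,E$ by the matrix $$\begin{pmatrix}0&1&0\\ 1&\frac r2&r\\ 0&-1&-1\end{pmatrix}.$$ (a) $T_r$ is an automorphism of $V_r$ that preserves the intersection form. (b) The eigenvalues of $T_r$ on $V_r\otimes\mathbb{C}$, with multiplicity, are $\alpha_r,\beta_r,1$, with respective eigenvectors, in the basis $F_1,F_2,E$, $$v_{\alpha_r}=\left(\tfrac{1}{\alpha_r+1},\tfrac{\alpha_r}{\alpha_r+1},-\tfrac2r\right),\quad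 v_{\beta_r}=\left(\tfrac{\alpha_r}{\alpha_r+1},\tfrac{1}{\alpha_r+1},-\tfrac2r\right),\quad K_X=(-2,-2,1).$$ Moreover, if $p_1,\dots,p_r$ are very general, that is, if $(p_1,\dots,p_r)\in Y^r$ lies outside of a suitable countable union of proper Zariski closed subsets which depends only on $r$, then: (c) For every class $\xi\in V_r$: $\xi$ is nef if and only if $T_r(\xi)$ is nef; $\xi$ is effective (a nonnegative real combination of classes of irreducible curves) if and only if $T_r(\xi)$ is effective; and, for all $s\ge 0$ and all positive integers $n_1,\dots,n_s$, $\xi$ is the class of a curve $\sum_{j=1}^s n_jD_j$ with $s$ distinct irreducible components $D_1,\dots,D_s$ if and only if $T_r(\xi)$ is the class of such a curve, with the same $s$ and the same multiplicities $n_j$. (d) Consequently $T_r$ restricts to an automorphism of the cone of nef classes in $V_r$, and to an automorphism of the cone of effective classes in $V_r$. Both automorphisms are of infinite order if $r\ge 8$. -/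

import Mathlib

noncomputable section

namespace SymBlowup

open MvPolynomial

/-! Products of complex projective spaces and their Zariski topology -/

/-- The product `∏ i, ℙ^(n i - 1)` of complex projective spaces; the `i`-th factor has `n i`
homogeneous coordinates. -/
def MultiProj {ι : Type} (n : ι → ℕ) : Type :=
  ∀ i, Projectivization ℂ (Fin (n i) → ℂ)

/-- The polynomial ring in all the homogeneous coordinates of `MultiProj n`. -/
abbrev CoordRing {ι : Type} (n : ι → ℕ) : Type :=
  MvPolynomial (Σ i, Fin (n i)) ℂ

/-- `f` is multihomogeneous of multidegree `d`, that is, homogeneous of degree `d i` in the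
coordinates of the `i`-th factor, for every `i`. -/
def IsMultiHom {ι : Type} [DecidableEq ι] {n : ι → ℕ} (f : CoordRing n) (d : ι → ℕ) : Prop :=
  IsWeightedHomogeneous (fun s : Σ i, Fin (n i) => (Pi.single s.1 1 : ι → ℕ)) f d

/-- Homogeneous coordinates of a point, one choice for each factor. -/
def coords {ι : Type} {n : ι → ℕ} (P : MultiProj n) : (Σ i, Fin (n i)) → ℂ :=
  fun s => (P s.1).rep s.2

/-- The zero locus of a (multihomogeneous) polynomial. -/
def zeroLocus {ι : Type} {n : ι → ℕ} (f : CoordRing n) : Set (MultiProj n) :=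
  {P | eval (coords P) f = 0}

/-- The Zariski topology: the complements of the zero loci of the multihomogeneous polynomials
are a basis of open sets. -/
instance {ι : Type} [DecidableEq ι] {n : ι → ℕ} : TopologicalSpace (MultiProj n) :=
  TopologicalSpace.generateFrom
    {U | ∃ (f : CoordRing n) (d : ι → ℕ), IsMultiHom f d ∧ U = (zeroLocus f)ᶜ}

/-- The order of vanishing (multiplicity) of a multihomogeneous `f ≠ 0` at a point `P`: the
lowest degree that occurs in the Taylor expansion of `f` at a vector of homogeneous coordinates
of `P`. It is independent of the choice of the coordinates, and equals the multiplicity at `P` of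
any local equation of the divisor `f = 0`, because rescaling the coordinates in each factor
multiplies `f` by a nonzero scalar. -/
def vanishingOrder {ι : Type} {n : ι → ℕ} (f : CoordRing n) (P : MultiProj n) : ℕ :=
  sInf {k | homogeneousComponent k (aeval (fun s => X s + C (coords P s)) f : CoordRing n) ≠ 0}

/-! The surface `Y = ℙ¹ × ℙ¹` and its blowup -/

/-- The surface `Y = ℙ¹ × ℙ¹`. -/
abbrev Y : Type := MultiProj (fun _ : Fin 2 => 2)

/-- `r` points of `Y`, as one point of the configuration variety `Y^r = (ℙ¹ × ℙ¹)^r`. -/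
def configuration {r : ℕ} (p : Fin r → Y) : MultiProj (fun _ : Fin r × Fin 2 => 2) :=
  fun ij => p ij.1 ij.2

/-- A property holds for `r` very general points of `Y` if it holds for all configurations
outside of a countable union of proper Zariski closed subsets of `Y^r`. -/
def ForVeryGeneral (r : ℕ) (Q : (Fin r → Y) → Prop) : Prop :=
  ∃ Z : ℕ → Set (MultiProj (fun _ : Fin r × Fin 2 => 2)),
    (∀ k, IsClosed (Z k) ∧ Z k ≠ Set.univ) ∧
      ∀ p : Fin r → Y, (∀ k, configuration p ∉ Z k) → Q p

/-- With `p = ([a₀ : a₁], [b₀ : b₁])` and `y = ([x₀ : x₁], [y₀ : y₁])`, the values at `y` of the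
four forms `l·y₀`, `l·y₁`, `m·x₀`, `m·x₁` of bidegree `(1,1)`, where `l = a₀x₁ - a₁x₀` and
`m = b₀y₁ - b₁y₀`. These sections of `𝒪(1,1)` generate `ℐ_p(1,1)`, the twisted ideal sheaf of the
reduced point `p`; in particular they have no common zero but `p`. -/
def centreForms (p y : Y) : Fin 4 → ℂ :=
  let l : ℂ := (p 0).rep 0 * (y 0).rep 1 - (p 0).rep 1 * (y 0).rep 0
  let m : ℂ := (p 1).rep 0 * (y 1).rep 1 - (p 1).rep 1 * (y 1).rep 0
  ![l * (y 1).rep 0, l * (y 1).rep 1, m * (y 0).rep 0, m * (y 0).rep 1]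

/-- The ambient variety `Y × (ℙ³)^r` of the blowup. -/
abbrev Ambient (r : ℕ) : Type :=
  MultiProj (Sum.elim (fun _ : Fin 2 => 2) (fun _ : Fin r => 4))

/-- The blow-down map `π`, defined on all of `Y × (ℙ³)^r` as the projection to `Y`. -/
def toY {r : ℕ} (w : Ambient r) : Y := fun j => w (Sum.inl j)

/-- The graph of the rational map `Y ⇢ (ℙ³)^r` whose `i`-th component is given by the four
sections that generate the ideal of `p i`. It is defined away from the points `p i`. -/
def graph {r : ℕ} (p : Fin r → Y) : Set (Ambient r) :=
  {w | ∀ i : Fin r, ∃ h : centreForms (p i) (toY w) ≠ 0,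
    w (Sum.inr i) = Projectivization.mk ℂ (centreForms (p i) (toY w)) h}

/-- The blowup `X` of `Y` at the (distinct) points `p i`: the Zariski closure of the graph. -/
def Blowup {r : ℕ} (p : Fin r → Y) : Set (Ambient r) := closure (graph p)

/-- The exceptional divisor of `X` over the point `p i`. -/
def exceptional {r : ℕ} (p : Fin r → Y) (i : Fin r) : Set (Ambient r) :=
  {w | w ∈ Blowup p ∧ toY w = p i}

/-- Irreducible curves on `X`: closed irreducible subsets of dimension one. -/
def IsIrreducibleCurve {r : ℕ} (p : Fin r → Y) (D : Set (Ambient r)) : Prop :=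
  D ⊆ Blowup p ∧ IsClosed D ∧ IsIrreducible D ∧ topologicalKrullDim D = 1

/-! The real Néron-Severi group `H²(X, ℝ)` -/

/-- `H²(X, ℝ)`, with its basis given by the two fibre classes (indices `Sum.inl 0` and
`Sum.inl 1`) and by the classes of the `r` exceptional divisors (indices `Sum.inr i`). -/
abbrev NS (r : ℕ) : Type := Fin 2 ⊕ Fin r → ℝ

/-- The pullbacks of the classes of `𝒪(1,0)` (for `j = 0`) and `𝒪(0,1)` (for `j = 1`). -/
def fibreClass (r : ℕ) (j : Fin 2) : NS r := Pi.single (Sum.inl j) 1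

/-- The class of the exceptional divisor over the `i`-th point. -/
def excClass {r : ℕ} (i : Fin r) : NS r := Pi.single (Sum.inr i) 1

/-- The intersection form on `H²(X, ℝ)`: the fibre classes have self-intersection `0` and meet
in one point, the exceptional divisors are disjoint with self-intersection `-1`, and orthogonal
to the fibre classes. -/
def inter {r : ℕ} (v w : NS r) : ℝ :=
  v (Sum.inl 0) * w (Sum.inl 1) + v (Sum.inl 1) * w (Sum.inl 0)
    - ∑ i : Fin r, v (Sum.inr i) * w (Sum.inr i)

/-- `IsCurveClass p D c`: `D` is an irreducible curve on `X` and `c` is its class. Either `D` is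
the exceptional divisor over `p i`, and `c = E_i`; or `D` is the proper transform of an irreducible
curve `{f = 0}` on `Y`, of bidegree `d`, and
`c = d₀ F₁ + d₁ F₂ - ∑ i, mult_{p i}(f) E_i`. -/
def IsCurveClass {r : ℕ} (p : Fin r → Y) (D : Set (Ambient r)) (c : NS r) : Prop :=
  IsIrreducibleCurve p D ∧
    ((∃ i : Fin r, D = exceptional p i ∧ c = excClass i) ∨
      ∃ (f : CoordRing (fun _ : Fin 2 => 2)) (d : Fin 2 → ℕ),
        Irreducible f ∧ IsMultiHom f d ∧ closure (toY '' D) = zeroLocus f ∧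
          c = (d 0 : ℝ) • fibreClass r 0 + (d 1 : ℝ) • fibreClass r 1
            - ∑ i : Fin r, (vanishingOrder f (p i) : ℝ) • excClass i)

/-- The nef cone of `X`: the classes whose intersection with every irreducible curve is
nonnegative. -/
def nefCone {r : ℕ} (p : Fin r → Y) : PointedCone ℝ (NS r) where
  carrier := {ξ | ∀ D c, IsCurveClass p D c → 0 ≤ inter ξ c}
  zero_mem' := by
    intro D c _
    simp [inter]
  add_mem' := by
    intro v w hv hw D c h
    have h1 := hv D c h
    have h2 := hw D c h
    have e : inter (v + w) c = inter v c + inter w c := by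
      simp only [inter, Pi.add_apply, add_mul, Finset.sum_add_distrib]
      ring
    rw [e]
    exact add_nonneg h1 h2
  smul_mem' := by
    intro a v hv D c h
    have h1 := hv D c h
    have e : inter (a • v) c = (a : ℝ) * inter v c := by
      have e1 : ∀ k, (a • v) k = (a : ℝ) * v k := fun k => rfl
      simp only [inter, e1, mul_sub, mul_add, Finset.mul_sum, mul_assoc]
    rw [e]
    exact mul_nonneg a.2 h1

/-- The effective cone of `X`: the nonnegative real combinations of classes of irreducible
curves. -/
def effectiveCone {r : ℕ} (p : Fin r → Y) : PointedCone ℝ (NS r) :=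
  PointedCone.hull ℝ {c | ∃ D, IsCurveClass p D c}

/-- `ξ` represents a curve with `s` irreducible components, of multiplicities `n`: there are `s`
distinct irreducible curves `D j` such that `ξ` is the class of the effective divisor
`∑ j, n j • D j`. -/
def RepresentsCurve {r : ℕ} (p : Fin r → Y) (ξ : NS r) (s : ℕ) (n : Fin s → ℕ) : Prop :=
  (∀ j, 0 < n j) ∧
    ∃ (D : Fin s → Set (Ambient r)) (c : Fin s → NS r),
      Function.Injective D ∧ (∀ j, IsCurveClass p (D j) (c j)) ∧ ξ = ∑ j, (n j : ℝ) • c j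

/-! The subspace `V_r` of symmetric classes and the transformation `T_r` -/

/-- The three classes `F₁`, `F₂` and `E = ∑ i, E_i`. -/
def symClass (r : ℕ) : Fin 3 → NS r :=
  ![fibreClass r 0, fibreClass r 1, ∑ i : Fin r, excClass i]

/-- `V_r`, the span of `F₁`, `F₂` and `E`. -/
def V (r : ℕ) : Submodule ℝ (NS r) := Submodule.span ℝ (Set.range (symClass r))

theorem linearIndependent_symClass (r : ℕ) [NeZero r] : LinearIndependent ℝ (symClass r) := by
  rw [Fintype.linearIndependent_iff]
  intro g hg
  have h0 := congrFun hg (Sum.inl 0)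
  have h1 := congrFun hg (Sum.inl 1)
  have h2 := congrFun hg (Sum.inr (0 : Fin r))
  simp [symClass, fibreClass, excClass, Fin.sum_univ_three, Pi.single_apply,
    Finset.sum_apply] at h0 h1 h2
  intro i
  fin_cases i <;> simp_all

/-- The basis `F₁, F₂, E` of `V_r`. -/
def basisV (r : ℕ) [NeZero r] : Module.Basis (Fin 3) ℝ (V r) :=
  Module.Basis.span (linearIndependent_symClass r)

/-- The matrix of `T_r` in the basis `F₁, F₂, E`. -/
def matT (r : ℕ) : Matrix (Fin 3) (Fin 3) ℝ :=
  !![0, 1, 0;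
     1, (r : ℝ) / 2, (r : ℝ);
     0, -1, -1]

/-- The linear transformation `T_r : V_r → V_r`. -/
def T (r : ℕ) [NeZero r] : V r →ₗ[ℝ] V r :=
  Matrix.toLin (basisV r) (basisV r) (matT r)

/-- The canonical class `K_X = π^*K_Y + E = -2F₁ - 2F₂ + E`. -/
def canonicalClass (r : ℕ) [NeZero r] : V r :=
  (-2 : ℝ) • basisV r 0 + (-2 : ℝ) • basisV r 1 + basisV r 2

/-- `α_r = ((r-4) + √(r(r-8)))/4`, a complex number, with the principal square root. -/
def alpha (r : ℕ) : ℂ := (((r : ℂ) - 4) + ((r : ℂ) * ((r : ℂ) - 8)) ^ (1 / 2 : ℂ)) / 4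

/-- `β_r = ((r-4) - √(r(r-8)))/4`. -/
def beta (r : ℕ) : ℂ := (((r : ℂ) - 4) - ((r : ℂ) * ((r : ℂ) - 8)) ^ (1 / 2 : ℂ)) / 4

open scoped TensorProduct

/-- The complexification of `V_r`, in which the eigenvectors live (for `r < 8` they are not
real). -/
abbrev VC (r : ℕ) : Type := ℂ ⊗[ℝ] V r

/-- The complexification of `T_r`. -/
def TC (r : ℕ) [NeZero r] : VC r →ₗ[ℂ] VC r := (T r).baseChange ℂ

/-- The vector of `V_r ⊗ ℂ` with coordinates `a, b, c` in the basis `F₁, F₂, E`. -/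
def vecC (r : ℕ) [NeZero r] (a b c : ℂ) : VC r :=
  a ⊗ₜ[ℝ] basisV r 0 + b ⊗ₜ[ℝ] basisV r 1 + c ⊗ₜ[ℝ] basisV r 2

/-- `v_{α_r} = (1/(α_r+1), α_r/(α_r+1), -2/r)`. -/
def vAlpha (r : ℕ) [NeZero r] : VC r :=
  vecC r (1 / (alpha r + 1)) (alpha r / (alpha r + 1)) (-2 / (r : ℂ))

/-- `v_{β_r} = (α_r/(α_r+1), 1/(α_r+1), -2/r)`. -/
def vBeta (r : ℕ) [NeZero r] : VC r :=
  vecC r (alpha r / (alpha r + 1)) (1 / (alpha r + 1)) (-2 / (r : ℂ))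

/-- The nef cone restricted to `V_r`. -/
def nefConeV {r : ℕ} (p : Fin r → Y) : PointedCone ℝ (V r) :=
  (nefCone p).comap (V r).subtype

/-- The effective cone restricted to `V_r`. -/
def effectiveConeV {r : ℕ} (p : Fin r → Y) : PointedCone ℝ (V r) :=
  (effectiveCone p).comap (V r).subtype

end SymBlowup

end

/-!
`T_r` is the restriction to `V_r` of an isometry of `H²(X, ℝ)`, the map `symmetryT`, which for very
general points is realized by a bijection of the set of irreducible curves on `X`. The bijection does
not come from an automorphism of the complex surface `X`; it is the composition of an elementary
transformation, the exchange of the two factors, and the conjugation by a wild field automorphism of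
`ℂ`. Each of them preserves irreducible curves, their degrees and their multiplicities in the
appropriate sense, and this is all that nef classes, effective classes and classes of curves with
given multiplicities depend on.

*The elementary transformation.* Write `r = 2e` and `p_i = ([a_i : 1], [b_i : 1])`. Blow up the
points `p_i` and contract the proper transforms of the fibres of the first projection through them.
For general points the result is again `ℙ¹ × ℙ¹`, blown up at points `([a_i : 1], [b'_i : 1])`. In
coordinates, the transformation is a `2 × 2` matrix of forms of degree `e` in the coordinates of the
base with determinant `∏ (x₀ - a_i x₁)`, whose kernel at `a_i` is spanned by `(b_i, 1)`; its adjugate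
describes the inverse transformation, at the points `([a_i : 1], [b'_i : 1])` (`IsElemPair`). Such
matrices with leading coefficient `1` are the solutions of a square linear system, so that a unique
one exists as soon as the homogeneous system has no nontrivial solution (`Unisolvent`). Substituting
the matrix into the equation of a curve and cancelling the factors `x₀ - a_i x₁` gives the equation of
the transformed curve; the elementary transformation acts on classes by `elemT`
(`IsElemPair.transports`).

*The field automorphism.* Configurations outside of the zero loci of the countably many nonzero
polynomials with rational coefficients have affine coordinates that are algebraically independent over
`ℚ` (`forVeryGeneral_of_algebraicIndependent`). For these the linear system is unisolvent, because its
determinant is a nonzero polynomial. Its solution is rational over `ℚ(a, b)`, and the same argument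
applied to the inverse transformation shows that `ℚ(a, b) = ℚ(a, b')`. Hence some automorphism of `ℂ`
carries the family `(b', a)` to the family `(a, b)` (`exists_ringEquiv_of_adjoin_eq`,
`exists_isElemPair_of_algebraicIndependent`). After the exchange of the two factors it takes the blowup
at the points `([a_i : 1], [b'_i : 1])` back to the one at the points `p_i`, and it does not change
degrees and orders of vanishing (`IsElemPair.transports_self`).

*The curves on the blowup.* The transport of curves is first established for their names, which are
the indices of the exceptional curves and the irreducible bihomogeneous forms (up to a constant
factor) on `ℙ¹ × ℙ¹`. The names correspond to the irreducible closed subsets of dimension one of the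
Zariski closure of the graph: the exceptional curves and the proper transforms are irreducible curves
(`isIrreducibleCurve_exceptional`, `isIrreducibleCurve_properTransform`), because their proper closed
subsets are finite, and every curve whose image in `ℙ¹ × ℙ¹` is dense in `f = 0` is the proper
transform of `f = 0` (`eq_properTransform`). The finiteness for a proper transform uses that it
contains no exceptional curve: a form that restricts to the leading form of `f` on an exceptional curve
vanishes on the proper transform of `f = 0` (`exists_form_of_properTransform`).

*The cones.* An isometry realized by a bijection of curves preserves the nef cone, the effective cone
and the representation of classes by curves, and so does its inverse. For `r ≥ 8` the iterates of a
fibre class, which lies in both cones, are different from it (`symmetryT_iterate_fibreClass_ne`), so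
that the automorphisms of the cones have infinite order. The eigenvalues and eigenvectors of `T_r` are
found from its matrix, with `α_r β_r = 1` and `α_r + β_r = (r - 4) / 2`.
-/

noncomputable section

namespace SymBlowup

section

open MvPolynomial

/-! ### Multihomogeneous polynomials -/

section MultiHom

variable {ι : Type} [DecidableEq ι] {n : ι → ℕ}

theorem IsMultiHom.mul {f g : CoordRing n} {d e : ι → ℕ} (hf : IsMultiHom f d)
    (hg : IsMultiHom g e) : IsMultiHom (f * g) (d + e) :=
  IsWeightedHomogeneous.mul hf hg

theorem IsMultiHom.add {f g : CoordRing n} {d : ι → ℕ} (hf : IsMultiHom f d)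
    (hg : IsMultiHom g d) : IsMultiHom (f + g) d :=
  IsWeightedHomogeneous.add hf hg

theorem IsMultiHom.pow {f : CoordRing n} {d : ι → ℕ} (hf : IsMultiHom f d) (k : ℕ) :
    IsMultiHom (f ^ k) (k • d) :=
  IsWeightedHomogeneous.pow hf k

theorem isMultiHom_one : IsMultiHom (1 : CoordRing n) 0 :=
  isWeightedHomogeneous_one _ _

theorem isMultiHom_C (c : ℂ) : IsMultiHom (C c : CoordRing n) 0 :=
  isWeightedHomogeneous_C _ _

theorem isMultiHom_X (s : Σ i, Fin (n i)) : IsMultiHom (X s : CoordRing n) (Pi.single s.1 1) :=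
  isWeightedHomogeneous_X _ _ _

theorem isMultiHom_zero (d : ι → ℕ) : IsMultiHom (0 : CoordRing n) d :=
  isWeightedHomogeneous_zero _ _ _

theorem IsMultiHom.C_mul {f : CoordRing n} {d : ι → ℕ} (hf : IsMultiHom f d) (c : ℂ) :
    IsMultiHom (C c * f) d :=
  IsWeightedHomogeneous.C_mul hf c

theorem IsMultiHom.sub {f g : CoordRing n} {d : ι → ℕ} (hf : IsMultiHom f d)
    (hg : IsMultiHom g d) : IsMultiHom (f - g) d :=
  IsWeightedHomogeneous.sub hf hg

theorem IsMultiHom.sum {κ : Type*} {s : Finset κ} {f : κ → CoordRing n} {d : ι → ℕ}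
    (hf : ∀ k ∈ s, IsMultiHom (f k) d) : IsMultiHom (∑ k ∈ s, f k) d :=
  IsWeightedHomogeneous.sum _ _ _ hf

theorem IsMultiHom.prod {κ : Type*} {s : Finset κ} {f : κ → CoordRing n} {d : κ → ι → ℕ}
    (hf : ∀ k ∈ s, IsMultiHom (f k) (d k)) : IsMultiHom (∏ k ∈ s, f k) (∑ k ∈ s, d k) :=
  IsWeightedHomogeneous.prod _ _ _ hf

/-- The exponents in the coordinates of one factor add up to the degree in that factor. -/
theorem IsMultiHom.sum_exponents {f : CoordRing n} {d : ι → ℕ} (hf : IsMultiHom f d)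
    {m : (Σ i, Fin (n i)) →₀ ℕ} (hm : coeff m f ≠ 0) (i : ι) : ∑ j, m ⟨i, j⟩ = d i := by
  have h := congrFun (hf hm) i
  rw [Finsupp.weight_apply, Finsupp.sum, Finset.sum_apply] at h
  rw [← h]
  have : ∀ s ∈ m.support, (m s • (Pi.single s.1 1 : ι → ℕ)) i = if s.1 = i then m s else 0 := by
    intro s _
    by_cases hs : s.1 = i
    · subst hs; simp
    · simp [hs, Ne.symm hs]
  rw [Finset.sum_congr rfl this]
  rw [← Finset.sum_image (s := Finset.univ) (g := fun j : Fin (n i) => (⟨i, j⟩ : Σ i, Fin (n i)))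
    (f := fun s => m s) (by intro a _ b _ hab; simpa using hab)]
  rw [← Finset.sum_filter]
  symm
  apply Finset.sum_subset
  · intro s hs
    simp only [Finset.mem_filter] at hs
    obtain ⟨_, rfl⟩ := hs
    simp
  · intro s hs hs'
    simp only [Finset.mem_image, Finset.mem_univ, true_and] at hs
    obtain ⟨j, rfl⟩ := hs
    simpa using hs'

theorem IsMultiHom.eval_scale [Fintype ι] {A : Type*} [CommRing A] [Algebra ℂ A]
    {f : CoordRing n} {d : ι → ℕ}
    (hf : IsMultiHom f d) (c : ι → A) (v : (Σ i, Fin (n i)) → A) :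
    aeval (fun s => c s.1 * v s) f = (∏ i, c i ^ d i) * aeval v f := by
  simp only [aeval_def, eval₂_eq']
  rw [Finset.mul_sum]
  refine Finset.sum_congr rfl fun m hm => ?_
  rw [mem_support_iff] at hm
  simp only [mul_pow, Finset.prod_mul_distrib]
  have : ∏ s : (Σ i, Fin (n i)), c s.1 ^ m s = ∏ i, c i ^ d i := by
    rw [Fintype.prod_sigma]
    refine Finset.prod_congr rfl fun i _ => ?_
    rw [← hf.sum_exponents hm i, ← Finset.prod_pow_eq_pow_sum]
  rw [this]; ring

end MultiHom

/-! ### Homogeneous coordinates and the Zariski topology -/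

section Points

variable {ι : Type} {n : ι → ℕ}

/-- The point with given homogeneous coordinates. -/
def mkPt (v : (Σ i, Fin (n i)) → ℂ) (hv : ∀ i, (fun j => v ⟨i, j⟩) ≠ 0) : MultiProj n :=
  fun i => Projectivization.mk ℂ (fun j => v ⟨i, j⟩) (hv i)

theorem coords_ne_zero (P : MultiProj n) (i : ι) : (fun j => coords P ⟨i, j⟩) ≠ 0 :=
  (P i).rep_nonzero

theorem mkPt_coords (P : MultiProj n) : mkPt (coords P) (coords_ne_zero P) = P := by
  funext i
  exact (P i).mk_rep

theorem exists_coords_mkPt (v : (Σ i, Fin (n i)) → ℂ) (hv : ∀ i, (fun j => v ⟨i, j⟩) ≠ 0) :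
    ∃ c : ι → ℂ, (∀ i, c i ≠ 0) ∧ coords (mkPt v hv) = fun s => c s.1 * v s := by
  have h : ∀ i, ∃ c : ℂ, c ≠ 0 ∧ (mkPt v hv i).rep = c • (fun j => v ⟨i, j⟩) := by
    intro i
    obtain ⟨a, ha⟩ := Projectivization.exists_smul_eq_mk_rep ℂ (fun j => v ⟨i, j⟩) (hv i)
    exact ⟨a, a.ne_zero, ha.symm⟩
  choose c hc hcv using h
  refine ⟨c, hc, ?_⟩
  funext s
  exact congrFun (hcv s.1) s.2

theorem mkPt_eq_of_scale {v w : (Σ i, Fin (n i)) → ℂ} (hv : ∀ i, (fun j => v ⟨i, j⟩) ≠ 0)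
    (hw : ∀ i, (fun j => w ⟨i, j⟩) ≠ 0) (c : ι → ℂ) (h : ∀ s, v s = c s.1 * w s) :
    mkPt v hv = mkPt w hw := by
  funext i
  refine (Projectivization.mk_eq_mk_iff' ℂ _ _ _ _).2 ⟨c i, ?_⟩
  funext j
  exact (h ⟨i, j⟩).symm

theorem zeroLocus_mul {f g : CoordRing n} : zeroLocus (f * g) = zeroLocus f ∪ zeroLocus g := by
  ext P; simp [zeroLocus]

/-- The `2 × 2` minor of the coordinates of `P` and of the variables, in the factor `i`. -/
def minor (P : MultiProj n) (i : ι) (j k : Fin (n i)) : CoordRing n :=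
  C (coords P ⟨i, j⟩) * X ⟨i, k⟩ - C (coords P ⟨i, k⟩) * X ⟨i, j⟩

theorem eq_of_minors_eq_zero {m : ℕ} {p q : Projectivization ℂ (Fin m → ℂ)}
    (h : ∀ j k, p.rep j * q.rep k - p.rep k * q.rep j = 0) : p = q := by
  obtain ⟨j, hj⟩ := Function.ne_iff.1 p.rep_nonzero
  rw [← p.mk_rep, ← q.mk_rep]
  symm
  refine (Projectivization.mk_eq_mk_iff' ℂ _ _ _ _).2 ⟨q.rep j / p.rep j, ?_⟩
  funext k
  have := h j k
  have hj' : p.rep j ≠ 0 := hj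
  simp only [Pi.smul_apply, smul_eq_mul]
  field_simp
  linear_combination -this

theorem eq_of_mem_zeroLocus_minor {P Q : MultiProj n}
    (h : ∀ i j k, Q ∈ zeroLocus (minor P i j k)) : P = Q := by
  funext i
  refine eq_of_minors_eq_zero fun j k => ?_
  simpa [zeroLocus, minor, coords] using h i j k

variable [DecidableEq ι]

theorem mkPt_mem_zeroLocus [Fintype ι] {f : CoordRing n} {d : ι → ℕ} (hf : IsMultiHom f d)
    (v : (Σ i, Fin (n i)) → ℂ) (hv : ∀ i, (fun j => v ⟨i, j⟩) ≠ 0) :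
    mkPt v hv ∈ zeroLocus f ↔ eval v f = 0 := by
  obtain ⟨c, hc, h⟩ := exists_coords_mkPt v hv
  have := hf.eval_scale c v
  rw [aeval_eq_eval, aeval_eq_eval] at this
  change eval _ f = 0 ↔ _
  rw [h]
  refine (iff_of_eq (congrArg (· = 0) this)).trans ?_
  simp [Finset.prod_eq_zero_iff, hc]

theorem isTopologicalBasis_multiProj : TopologicalSpace.IsTopologicalBasis
    {U : Set (MultiProj n) | ∃ (f : CoordRing n) (d : ι → ℕ),
      IsMultiHom f d ∧ U = (zeroLocus f)ᶜ} where
  exists_subset_inter := by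
    rintro _ ⟨f, d, hf, rfl⟩ _ ⟨g, e, hg, rfl⟩ x hx
    refine ⟨(zeroLocus (f * g))ᶜ, ⟨f * g, d + e, hf.mul hg, rfl⟩, ?_, ?_⟩
    · rw [zeroLocus_mul, Set.compl_union]; exact hx
    · rw [zeroLocus_mul, Set.compl_union]
  sUnion_eq := by
    refine Set.eq_univ_of_forall fun x => ?_
    refine ⟨(zeroLocus 1)ᶜ, ⟨1, 0, isMultiHom_one, rfl⟩, ?_⟩
    simp [zeroLocus]
  eq_generateFrom := rfl

theorem IsMultiHom.isClosed_zeroLocus {f : CoordRing n} {d : ι → ℕ} (hf : IsMultiHom f d) :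
    IsClosed (zeroLocus f) :=
  ⟨isTopologicalBasis_multiProj.isOpen ⟨f, d, hf, rfl⟩⟩

theorem mem_closure_iff_forall_multiHom {S : Set (MultiProj n)} {P : MultiProj n} :
    P ∈ closure S ↔ ∀ (f : CoordRing n) (d : ι → ℕ), IsMultiHom f d → S ⊆ zeroLocus f →
      P ∈ zeroLocus f := by
  rw [isTopologicalBasis_multiProj.mem_closure_iff]
  constructor
  · intro h f d hf hS
    by_contra hP
    obtain ⟨x, hx, hxS⟩ := h _ ⟨f, d, hf, rfl⟩ hP
    exact hx (hS hxS)
  · rintro h _ ⟨f, d, hf, rfl⟩ hP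
    by_contra hne
    refine hP (h f d hf fun x hx => ?_)
    by_contra hxf
    exact hne ⟨x, hxf, hx⟩

theorem isMultiHom_minor (P : MultiProj n) (i : ι) (j k : Fin (n i)) :
    IsMultiHom (minor P i j k) (Pi.single i 1) :=
  ((isMultiHom_X ⟨i, k⟩).C_mul _).sub ((isMultiHom_X ⟨i, j⟩).C_mul _)

instance : T1Space (MultiProj n) := by
  refine ⟨fun P => ?_⟩
  rw [← closure_subset_iff_isClosed]
  intro Q hQ
  rw [mem_closure_iff_forall_multiHom] at hQ
  refine (eq_of_mem_zeroLocus_minor fun i j k => hQ _ _ (isMultiHom_minor P i j k) ?_).symm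
  rintro _ rfl
  simp [zeroLocus, minor, mul_comm]

end Points

/-! ### The order of vanishing of a polynomial at a point of affine space -/

section Order

variable {σ τ : Type}

/-- The Taylor expansion of `f` at `Q`, as the polynomial `f(X + Q)`. -/
def taylorAt (Q : σ → ℂ) : MvPolynomial σ ℂ →ₐ[ℂ] MvPolynomial σ ℂ :=
  aeval fun s => X s + C (Q s)

/-- The order of vanishing of `f` at the point `Q` of affine space. -/
def ordAt (f : MvPolynomial σ ℂ) (Q : σ → ℂ) : ℕ :=
  sInf {k | homogeneousComponent k (taylorAt Q f) ≠ 0}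

theorem taylorAt_injective (Q : σ → ℂ) : Function.Injective (taylorAt Q) := by
  have h : (taylorAt (-Q)).comp (taylorAt Q) = AlgHom.id ℂ _ := by
    ext s; simp [taylorAt]
  exact Function.LeftInverse.injective (g := taylorAt (-Q)) fun f => DFunLike.congr_fun h f

theorem taylorAt_ne_zero {f : MvPolynomial σ ℂ} (hf : f ≠ 0) (Q : σ → ℂ) : taylorAt Q f ≠ 0 :=
  (map_ne_zero_iff _ (taylorAt_injective Q)).2 hf

theorem le_ordAt_iff {f : MvPolynomial σ ℂ} (hf : f ≠ 0) (Q : σ → ℂ) (k : ℕ) :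
    k ≤ ordAt f Q ↔ taylorAt Q f ∈ idealOfVars σ ℂ ^ k := by
  rw [mem_pow_idealOfVars_iff']
  constructor
  · intro h x hx
    have h1 := Nat.notMem_of_lt_sInf (lt_of_lt_of_le hx h)
    simp only [Set.mem_ofPred_eq, not_not] at h1
    have h2 := congrArg (coeff x) h1
    simpa [coeff_homogeneousComponent] using h2
  · intro h
    refine le_csInf ?_ ?_
    · obtain ⟨x, hx⟩ := ne_zero_iff.1 (taylorAt_ne_zero hf Q)
      refine ⟨x.degree, fun h0 => hx ?_⟩
      have h2 := congrArg (coeff x) h0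
      simpa [coeff_homogeneousComponent] using h2
    · intro j hj
      by_contra hlt
      refine hj ?_
      ext x
      rw [coeff_homogeneousComponent]
      split_ifs with hx
      · rw [h x (by omega), coeff_zero]
      · simp

theorem coe_ordAt {f : MvPolynomial σ ℂ} (hf : f ≠ 0) (Q : σ → ℂ) :
    (ordAt f Q : ℕ∞) = (taylorAt Q f : MvPowerSeries σ ℂ).order := by
  refine le_antisymm ?_ ?_
  · refine MvPowerSeries.nat_le_order fun d hd => ?_
    have := (le_ordAt_iff hf Q _).1 le_rfl
    rw [mem_pow_idealOfVars_iff'] at this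
    simpa using this d hd
  · have hne : (taylorAt Q f : MvPowerSeries σ ℂ) ≠ 0 := by
      simpa using taylorAt_ne_zero hf Q
    rw [← MvPowerSeries.ne_zero_iff_order_finite.1 hne]
    rw [Nat.cast_le, le_ordAt_iff hf, mem_pow_idealOfVars_iff']
    intro d hd
    rw [← MvPolynomial.coeff_coe]
    refine MvPowerSeries.coeff_of_lt_order ?_
    rw [← MvPowerSeries.ne_zero_iff_order_finite.1 hne]
    exact_mod_cast hd

theorem ordAt_mul {f g : MvPolynomial σ ℂ} (hf : f ≠ 0) (hg : g ≠ 0) (Q : σ → ℂ) :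
    ordAt (f * g) Q = ordAt f Q + ordAt g Q := by
  have h : (ordAt (f * g) Q : ℕ∞) = ordAt f Q + ordAt g Q := by
    rw [coe_ordAt (mul_ne_zero hf hg), coe_ordAt hf, coe_ordAt hg, map_mul, MvPolynomial.coe_mul,
      MvPowerSeries.order_mul]
  exact_mod_cast h

theorem ordAt_eq_zero_iff {f : MvPolynomial σ ℂ} (hf : f ≠ 0) (Q : σ → ℂ) :
    ordAt f Q = 0 ↔ eval Q f ≠ 0 := by
  have h0 : coeff 0 (taylorAt Q f) = eval Q f := by
    rw [← constantCoeff_eq]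
    have : (constantCoeff.comp (taylorAt Q).toRingHom : MvPolynomial σ ℂ →+* ℂ) = eval Q := by
      ext s <;> simp [taylorAt]
    exact DFunLike.congr_fun this f
  rw [← not_iff_not, not_not, ← h0, ← Ne, ← Nat.one_le_iff_ne_zero, le_ordAt_iff hf,
    mem_pow_idealOfVars_iff']
  constructor
  · intro h; exact h 0 (by simp)
  · intro h x hx
    have : x = 0 := (Finsupp.degree_eq_zero_iff x).1 (by simpa using hx)
    rw [this, h]

theorem ordAt_pow {f : MvPolynomial σ ℂ} (hf : f ≠ 0) (Q : σ → ℂ) (k : ℕ) :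
    ordAt (f ^ k) Q = k * ordAt f Q := by
  induction k with
  | zero => simpa using (ordAt_eq_zero_iff (one_ne_zero (α := MvPolynomial σ ℂ)) Q).2 (by simp)
  | succ k ih => rw [pow_succ, ordAt_mul (pow_ne_zero k hf) hf, ih]; ring

/-- Substituting polynomials does not lower the order of vanishing. -/
theorem ordAt_le_ordAt_aeval {f : MvPolynomial σ ℂ} (φ : σ → MvPolynomial τ ℂ)
    (hφ : aeval φ f ≠ 0) (Q : τ → ℂ) :
    ordAt f (fun s => eval Q (φ s)) ≤ ordAt (aeval φ f) Q := by
  have hf : f ≠ 0 := by rintro rfl; simp at hφ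
  rw [le_ordAt_iff hφ]
  have h := (le_ordAt_iff hf (fun s => eval Q (φ s)) _).1 le_rfl
  set k := ordAt f (fun s => eval Q (φ s))
  let ψ : MvPolynomial σ ℂ →ₐ[ℂ] MvPolynomial τ ℂ :=
    aeval fun s => taylorAt Q (φ s) - C (eval Q (φ s))
  have e : taylorAt Q (aeval φ f) = ψ (taylorAt (fun s => eval Q (φ s)) f) := by
    have : (taylorAt Q).comp (aeval φ) = ψ.comp (taylorAt (fun s => eval Q (φ s))) := by
      ext s; simp [taylorAt, ψ]
    exact DFunLike.congr_fun this f
  rw [e]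
  have h2 := Ideal.mem_map_of_mem ψ h
  rw [Ideal.map_pow] at h2
  refine Ideal.pow_right_mono ?_ k h2
  rw [Ideal.map_span, Ideal.span_le]
  rintro _ ⟨_, ⟨s, rfl⟩, rfl⟩
  have : ψ (X s) = taylorAt Q (φ s) - C (eval Q (φ s)) := by simp [ψ]
  rw [this]
  change _ ∈ idealOfVars τ ℂ
  rw [← pow_one (idealOfVars τ ℂ), mem_pow_idealOfVars_iff']
  intro x hx
  have : x = 0 := (Finsupp.degree_eq_zero_iff x).1 (by simpa using hx)
  rw [this, coeff_sub, ← constantCoeff_eq]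
  have : (constantCoeff.comp (taylorAt Q).toRingHom : MvPolynomial τ ℂ →+* ℂ) = eval Q := by
    ext s <;> simp [taylorAt]
  have := DFunLike.congr_fun this (φ s)
  simpa [sub_eq_zero] using this

theorem ordAt_C_mul {f : MvPolynomial σ ℂ} (hf : f ≠ 0) {c : ℂ} (hc : c ≠ 0) (Q : σ → ℂ) :
    ordAt (C c * f) Q = ordAt f Q := by
  have hC : (C c : MvPolynomial σ ℂ) ≠ 0 := by simpa using hc
  rw [ordAt_mul hC hf, (ordAt_eq_zero_iff hC Q).2 (by simpa using hc), zero_add]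

theorem ordAt_eq_of_associated {f g : MvPolynomial σ ℂ} (hf : f ≠ 0) (h : Associated f g)
    (Q : σ → ℂ) : ordAt g Q = ordAt f Q := by
  obtain ⟨u, rfl⟩ := h
  rw [ordAt_mul hf u.ne_zero, (ordAt_eq_zero_iff u.ne_zero Q).2 (u.isUnit.map (eval Q)).ne_zero,
    add_zero]

/-- Field automorphisms of `ℂ` preserve orders of vanishing. -/
theorem ordAt_map (θ : ℂ ≃+* ℂ) (f : MvPolynomial σ ℂ) (Q : σ → ℂ) :
    ordAt (map (θ : ℂ →+* ℂ) f) (fun s => θ (Q s)) = ordAt f Q := by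
  have e : taylorAt (fun s => θ (Q s)) (map (θ : ℂ →+* ℂ) f) =
      map (θ : ℂ →+* ℂ) (taylorAt Q f) := by
    have : (taylorAt (fun s => θ (Q s))).toRingHom.comp (map (θ : ℂ →+* ℂ)) =
        (map (θ : ℂ →+* ℂ)).comp (taylorAt Q).toRingHom := by
      ext s <;> simp [taylorAt]
    exact DFunLike.congr_fun this f
  unfold ordAt
  congr 1
  ext k
  rw [Set.mem_ofPred_eq, Set.mem_ofPred_eq, e, not_iff_not, MvPolynomial.ext_iff,
    MvPolynomial.ext_iff]
  refine forall_congr' fun m => ?_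
  simp only [coeff_homogeneousComponent, coeff_map, coeff_zero]
  split_ifs <;> simp

end Order

section

variable {ι : Type} {n : ι → ℕ}

theorem vanishingOrder_eq_ordAt (f : CoordRing n) (P : MultiProj n) :
    vanishingOrder f P = ordAt f (coords P) := rfl

variable [DecidableEq ι] [Fintype ι]

/-- For multihomogeneous polynomials, the order of vanishing does not depend on the choice of the
homogeneous coordinates. -/
theorem IsMultiHom.ordAt_scale {f : CoordRing n} {d : ι → ℕ} (hf : IsMultiHom f d) (hf0 : f ≠ 0)
    (c : ι → ℂ) (hc : ∀ i, c i ≠ 0) (v : (Σ i, Fin (n i)) → ℂ) :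
    ordAt f (fun s => c s.1 * v s) = ordAt f v := by
  have key : ∀ (c : ι → ℂ) (hc : ∀ i, c i ≠ 0) (v : (Σ i, Fin (n i)) → ℂ),
      ordAt f (fun s => c s.1 * v s) ≤ ordAt f v := by
    intro c hc v
    have h := hf.eval_scale (A := CoordRing n) (fun i => C (c i)) X
    rw [aeval_X_left_apply] at h
    have hC : (∏ i, (C (c i) : CoordRing n) ^ d i) = C (∏ i, c i ^ d i) := by simp
    have hne : ∏ i, c i ^ d i ≠ 0 := Finset.prod_ne_zero_iff.2 fun i _ => pow_ne_zero _ (hc i)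
    rw [hC] at h
    have h0 : aeval (fun s => C (c s.1) * X s : _ → CoordRing n) f ≠ 0 := by
      rw [h]; exact mul_ne_zero (C_ne_zero.2 hne) hf0
    have := ordAt_le_ordAt_aeval _ h0 v
    rw [h, ordAt_C_mul hf0 hne] at this
    simpa using this
  refine le_antisymm (key c hc v) ?_
  have := key (fun i => (c i)⁻¹) (fun i => inv_ne_zero (hc i)) (fun s => c s.1 * v s)
  simpa [hc] using this

theorem IsMultiHom.vanishingOrder_mkPt {f : CoordRing n} {d : ι → ℕ} (hf : IsMultiHom f d)
    (hf0 : f ≠ 0) (v : (Σ i, Fin (n i)) → ℂ) (hv : ∀ i, (fun j => v ⟨i, j⟩) ≠ 0) :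
    vanishingOrder f (mkPt v hv) = ordAt f v := by
  obtain ⟨c, hc, h⟩ := exists_coords_mkPt v hv
  rw [vanishingOrder_eq_ordAt, h, hf.ordAt_scale hf0 c hc]

end

/-! ### Plane curves on `ℙ¹ × ℙ¹` and the Nullstellensatz -/

/-- The bihomogeneous coordinate ring of `ℙ¹ × ℙ¹`. -/
abbrev YRing : Type := CoordRing (fun _ : Fin 2 => 2)

/-- The affine space with the homogeneous coordinates of `ℙ¹ × ℙ¹`. -/
abbrev YVec : Type := (Σ _ : Fin 2, Fin 2) → ℂ

theorem not_dvd_both {σ : Type} {f g h : MvPolynomial σ ℂ} (hf : Irreducible f)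
    (hg : g ≠ 0) (hh : h ≠ 0) (hd : ∀ s, degreeOf s g = 0 ∨ degreeOf s h = 0)
    (hfg : f ∣ g) (hfh : f ∣ h) : False := by
  have h0 : ∀ s, degreeOf s f = 0 := by
    intro s
    rcases hd s with h1 | h1
    · obtain ⟨k, rfl⟩ := hfg
      rw [degreeOf_mul_eq (left_ne_zero_of_mul hg) (right_ne_zero_of_mul hg)] at h1
      omega
    · obtain ⟨k, rfl⟩ := hfh
      rw [degreeOf_mul_eq (left_ne_zero_of_mul hh) (right_ne_zero_of_mul hh)] at h1
      omega
  have hc : f = C (coeff 0 f) := by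
    refine (totalDegree_eq_zero_iff_eq_C).1 ?_
    refine (totalDegree_eq_zero_iff σ f).2 fun m hm s => ?_
    have := degreeOf_eq_sup s f
    rw [h0] at this
    exact Nat.le_zero.1 (this ▸ Finset.le_sup (f := fun m : σ →₀ ℕ => m s) hm)
  refine hf.not_isUnit ?_
  rw [hc]
  refine (isUnit_iff_ne_zero.2 ?_).map C
  intro h
  rw [h, C_0] at hc
  exact hf.ne_zero hc

theorem IsMultiHom.degreeOf_eq_zero {ι : Type} [DecidableEq ι] {n : ι → ℕ} {f : CoordRing n}
    {d : ι → ℕ} (hf : IsMultiHom f d) {i : ι} (hi : d i = 0) (j : Fin (n i)) :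
    degreeOf ⟨i, j⟩ f = 0 := by
  rw [degreeOf_eq_sup, ← Nat.bot_eq_zero, Finset.sup_eq_bot_iff]
  intro m hm
  have := hf.sum_exponents (mem_support_iff.1 hm) i
  rw [hi, Finset.sum_eq_zero_iff] at this
  exact this j (Finset.mem_univ _)

theorem eval_minor (P : Y) (i : Fin 2) (v : YVec) :
    eval v (minor P i 0 1) = coords P ⟨i, 0⟩ * v ⟨i, 1⟩ - coords P ⟨i, 1⟩ * v ⟨i, 0⟩ := by
  simp [minor]

theorem minor_ne_zero (P : Y) (i : Fin 2) : minor P i 0 1 ≠ 0 := by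
  intro h
  have h1 := eval_minor P i (fun s => if s.2 = 0 then 1 else 0)
  have h2 := eval_minor P i (fun s => if s.2 = 0 then 0 else 1)
  rw [h] at h1 h2
  apply coords_ne_zero P i
  funext j
  fin_cases j
  · simpa using h2.symm
  · simpa using h1.symm

theorem eval_minor_eq_zero_of_mkPt_eq {P : Y} {v : YVec} {hv : ∀ i, (fun j => v ⟨i, j⟩) ≠ 0}
    (h : mkPt v hv = P) (i : Fin 2) : eval v (minor P i 0 1) = 0 := by
  rw [← mkPt_mem_zeroLocus (isMultiHom_minor P i 0 1) v hv, h]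
  simp [zeroLocus, minor, mul_comm]

theorem exists_minor_not_dvd {f : YRing} (hf : Irreducible f) (P : Y) :
    ∃ i : Fin 2, ¬ f ∣ minor P i 0 1 := by
  by_contra! h
  refine not_dvd_both hf (minor_ne_zero P 0) (minor_ne_zero P 1) ?_ (h 0) (h 1)
  rintro ⟨i, j⟩
  fin_cases i
  · right; exact (isMultiHom_minor P 1 0 1).degreeOf_eq_zero (by simp) j
  · left; exact (isMultiHom_minor P 0 0 1).degreeOf_eq_zero (by simp) j

theorem exists_X_not_dvd {f : YRing} (hf : Irreducible f) (i : Fin 2) :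
    ∃ j : Fin 2, ¬ f ∣ X ⟨i, j⟩ := by
  by_contra! h
  refine not_dvd_both hf (X_ne_zero _) (X_ne_zero _) ?_ (h 0) (h 1)
  intro s
  by_cases hs : s = ⟨i, 0⟩
  · right; subst hs; exact degreeOf_X_of_ne (by simp)
  · left; exact degreeOf_X_of_ne hs

theorem dvd_of_forall_eval_eq_zero {σ : Type} [Finite σ] {f g : MvPolynomial σ ℂ}
    (hf : Irreducible f) (h : ∀ v, eval v f = 0 → eval v g = 0) : f ∣ g := by
  have hp : (Ideal.span {f}).IsPrime := (Ideal.span_singleton_prime hf.ne_zero).2 hf.prime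
  rw [← Ideal.mem_span_singleton,
    ← MvPolynomial.IsPrime.vanishingIdeal_zeroLocus (K := ℂ) (Ideal.span {f})]
  intro v hv
  exact h v (hv f (Ideal.mem_span_singleton_self f))

/-- The Nullstellensatz for an irreducible curve on `ℙ¹ × ℙ¹` from which finitely many points
have been removed. -/
theorem dvd_of_vanishes_off_finite {f g : YRing} (hf : Irreducible f) {S : Set Y}
    (hS : S.Finite) (h : ∀ (v : YVec) (hv : ∀ i, (fun j => v ⟨i, j⟩) ≠ 0), mkPt v hv ∉ S →
      eval v f = 0 → eval v g = 0) : f ∣ g := by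
  classical
  choose i hi using exists_minor_not_dvd hf
  choose j hj using exists_X_not_dvd hf
  have key : f ∣ g * ((∏ k, X ⟨k, j k⟩) * ∏ P ∈ hS.toFinset, minor P (i P) 0 1) := by
    refine dvd_of_forall_eval_eq_zero hf fun v hvf => ?_
    simp only [map_mul, map_prod, eval_X]
    by_cases hv : ∀ i, (fun j => v ⟨i, j⟩) ≠ 0
    · by_cases hm : mkPt v hv ∈ S
      · have : ∏ P ∈ hS.toFinset, eval v (minor P (i P) 0 1) = 0 :=
          Finset.prod_eq_zero (hS.mem_toFinset.2 hm) (eval_minor_eq_zero_of_mkPt_eq rfl _)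
        rw [this]; ring
      · rw [h v hv hm hvf]; ring
    · push Not at hv
      obtain ⟨k, hk⟩ := hv
      have : ∏ k, v ⟨k, j k⟩ = 0 := Finset.prod_eq_zero (Finset.mem_univ k) (congrFun hk (j k))
      rw [this]; ring
  rcases hf.prime.dvd_or_dvd key with h1 | h1
  · exact h1
  · exfalso
    rcases hf.prime.dvd_or_dvd h1 with h2 | h2
    · obtain ⟨k, _, hk⟩ := (hf.prime.dvd_finsetProd_iff _).1 h2
      exact hj k hk
    · obtain ⟨P, _, hP⟩ := (hf.prime.dvd_finsetProd_iff _).1 h2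
      exact hi P hP

theorem dvd_of_diff_subset_zeroLocus {f g : YRing} (hf : Irreducible f) {d e : Fin 2 → ℕ}
    (hfd : IsMultiHom f d) (hge : IsMultiHom g e) {S : Set Y} (hS : S.Finite)
    (h : zeroLocus f \ S ⊆ zeroLocus g) : f ∣ g :=
  dvd_of_vanishes_off_finite hf hS fun v hv hvS hvf =>
    (mkPt_mem_zeroLocus hge v hv).1 (h ⟨(mkPt_mem_zeroLocus hfd v hv).2 hvf, hvS⟩)

theorem zeroLocus_subset_of_dvd {ι : Type} {n : ι → ℕ} {f g : CoordRing n} (h : f ∣ g) :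
    zeroLocus f ⊆ zeroLocus g := by
  obtain ⟨k, rfl⟩ := h
  rw [zeroLocus_mul]
  exact Set.subset_union_left

theorem infinite_zeroLocus {f : YRing} (hf : Irreducible f) {d : Fin 2 → ℕ}
    (hfd : IsMultiHom f d) : (zeroLocus f).Infinite := by
  intro h
  have := dvd_of_diff_subset_zeroLocus (g := 1) hf hfd isMultiHom_one h (by simp)
  exact hf.not_isUnit (isUnit_of_dvd_one this)

theorem associated_of_zeroLocus_eq {f g : YRing} (hf : Irreducible f) (hg : Irreducible g)
    {d e : Fin 2 → ℕ} (hfd : IsMultiHom f d) (hge : IsMultiHom g e)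
    (h : zeroLocus f = zeroLocus g) : Associated f g :=
  hf.associated_of_dvd hg (dvd_of_diff_subset_zeroLocus hf hfd hge Set.finite_empty (by simp [h]))

theorem zeroLocus_eq_of_associated {ι : Type} {n : ι → ℕ} {f g : CoordRing n}
    (h : Associated f g) : zeroLocus f = zeroLocus g :=
  (zeroLocus_subset_of_dvd h.dvd).antisymm (zeroLocus_subset_of_dvd h.symm.dvd)

/-! ### Finiteness of the intersection of two curves without common components -/

/-- The homomorphism whose kernel is the homogeneous ideal of the point `P`. -/
def pointHom (P : Y) : YRing →ₐ[ℂ] MvPolynomial (Fin 2) ℂ :=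
  aeval fun s => X s.1 * C (coords P s)

theorem mem_ker_pointHom {P : Y} {f : YRing} {d : Fin 2 → ℕ} (hf : IsMultiHom f d)
    (hP : P ∈ zeroLocus f) : f ∈ RingHom.ker (pointHom P) := by
  rw [RingHom.mem_ker]
  have h1 := hf.eval_scale (A := MvPolynomial (Fin 2) ℂ) X (fun s => C (coords P s))
  have h2 : aeval (fun s => (C (coords P s) : MvPolynomial (Fin 2) ℂ)) f =
      C (eval (coords P) f) := by
    have : (aeval (fun s => (C (coords P s) : MvPolynomial (Fin 2) ℂ)) :
        YRing →ₐ[ℂ] _).toRingHom = C.comp (eval (coords P)) := by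
      ext <;> simp
    exact DFunLike.congr_fun this f
  rw [h2, show eval (coords P) f = 0 from hP, C_0, mul_zero] at h1
  exact h1

theorem eq_of_ker_pointHom_eq {P Q : Y}
    (h : RingHom.ker (pointHom P) = RingHom.ker (pointHom Q)) : P = Q := by
  refine eq_of_mem_zeroLocus_minor fun i j k => ?_
  have h1 : minor P i j k ∈ RingHom.ker (pointHom P) :=
    mem_ker_pointHom (isMultiHom_minor P i j k) (by simp [zeroLocus, minor, mul_comm])
  rw [h, RingHom.mem_ker] at h1
  have h2 := congrArg (eval fun _ => (1 : ℂ)) h1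
  simpa [pointHom, minor, zeroLocus] using h2

theorem ker_pointHom_eq_span (P : Y) :
    RingHom.ker (pointHom P) = Ideal.span {minor P 0 0 1, minor P 1 0 1} := by
  apply le_antisymm
  · set I : Ideal YRing := Ideal.span {minor P 0 0 1, minor P 1 0 1}
    have hI : ∀ i, minor P i 0 1 ∈ I := by
      intro i
      fin_cases i <;> exact Ideal.subset_span (by simp)
    have hs : ∀ i, ∃ j, coords P ⟨i, j⟩ ≠ 0 := fun i => Function.ne_iff.1 (coords_ne_zero P i)
    choose j hj using hs
    let ρ : MvPolynomial (Fin 2) ℂ →ₐ[ℂ] YRing :=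
      aeval fun i => C (coords P ⟨i, j i⟩)⁻¹ * X ⟨i, j i⟩
    have hρ : (Ideal.Quotient.mkₐ ℂ I).comp (ρ.comp (pointHom P)) = Ideal.Quotient.mkₐ ℂ I := by
      ext ⟨i, k⟩
      simp only [AlgHom.comp_apply, pointHom, aeval_X, map_mul, ρ, Ideal.Quotient.mkₐ_eq_mk]
      rw [← map_mul, ← map_mul, ← sub_eq_zero, ← map_sub, Ideal.Quotient.eq_zero_iff_mem]
      have e1 : C (coords P ⟨i, j i⟩)⁻¹ * C (coords P ⟨i, j i⟩) = (1 : YRing) := by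
        rw [← C_mul, inv_mul_cancel₀ (hj i), C_1]
      have e2 : ∃ c : YRing, C (coords P ⟨i, k⟩) * X ⟨i, j i⟩ - C (coords P ⟨i, j i⟩) * X ⟨i, k⟩
          = c * minor P i 0 1 := by
        generalize j i = m
        fin_cases k <;> fin_cases m
        · exact ⟨0, by simp⟩
        · exact ⟨1, by simp [minor]⟩
        · exact ⟨-1, by simp [minor]⟩
        · exact ⟨0, by simp⟩
      obtain ⟨c, hc⟩ := e2
      have : C (coords P ⟨i, j i⟩)⁻¹ * X ⟨i, j i⟩ * aeval (fun i => C (coords P ⟨i, j i⟩)⁻¹ *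
          X ⟨i, j i⟩ : Fin 2 → YRing) (C (coords P ⟨i, k⟩) : MvPolynomial (Fin 2) ℂ) - X ⟨i, k⟩
          = (C (coords P ⟨i, j i⟩)⁻¹ * c) * minor P i 0 1 := by
        rw [aeval_C, mul_assoc _ c, ← hc]
        simp only [algebraMap_eq]
        linear_combination X ⟨i, k⟩ * e1
      rw [this]
      exact I.mul_mem_left _ (hI i)
    intro h hh
    rw [RingHom.mem_ker] at hh
    have := DFunLike.congr_fun hρ h
    simp only [AlgHom.comp_apply] at this
    rw [show pointHom P h = 0 from hh, map_zero, map_zero] at this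
    exact Ideal.Quotient.eq_zero_iff_mem.1 this.symm
  · rw [Ideal.span_le]
    have : ∀ i, minor P i 0 1 ∈ RingHom.ker (pointHom P) := fun i =>
      mem_ker_pointHom (isMultiHom_minor P i 0 1) (by simp [zeroLocus, minor, mul_comm])
    rintro _ (rfl | rfl)
    · exact this 0
    · exact this 1

theorem height_ker_pointHom_le (P : Y) : (RingHom.ker (pointHom P)).height ≤ 2 := by
  have hp : (RingHom.ker (pointHom P)).IsPrime := RingHom.ker_isPrime _
  have h := Ideal.height_le_card_of_mem_minimalPrimes_span
    (p := RingHom.ker (pointHom P)) (s := {minor P 0 0 1, minor P 1 0 1}) (Set.toFinite _)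
    (by rw [← ker_pointHom_eq_span, Ideal.minimalPrimes_eq_subsingleton_self]; rfl)
  refine h.trans ?_
  exact_mod_cast Set.ncard_insert_le _ _ |>.trans (by simp)

/-- An irreducible curve meets a curve that does not contain it in finitely many points: by
Krull's height theorem the ideals of these points are minimal over the ideal of the
intersection. -/
theorem finite_zeroLocus_inter {f g : YRing} (hf : Irreducible f) (hfg : ¬ f ∣ g)
    {d e : Fin 2 → ℕ} (hfd : IsMultiHom f d) (hge : IsMultiHom g e) :
    (zeroLocus f ∩ zeroLocus g).Finite := by
  have hfin := Ideal.finite_minimalPrimes_of_isNoetherianRing YRing (Ideal.span {f, g})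
  refine Set.Finite.of_finite_image (f := fun P => RingHom.ker (pointHom P)) (hfin.subset ?_)
    fun P _ Q _ h => eq_of_ker_pointHom_eq h
  rintro _ ⟨P, ⟨hPf, hPg⟩, rfl⟩
  have hp : (RingHom.ker (pointHom P)).IsPrime := RingHom.ker_isPrime _
  have hle : Ideal.span {f, g} ≤ RingHom.ker (pointHom P) := by
    rw [Ideal.span_le]
    rintro _ (rfl | rfl)
    · exact mem_ker_pointHom hfd hPf
    · exact mem_ker_pointHom hge hPg
  obtain ⟨q, hq, hqP⟩ := Ideal.exists_minimalPrimes_le hle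
  have hq' := hq.isPrime
  have hfp : (Ideal.span {f}).IsPrime := (Ideal.span_singleton_prime hf.ne_zero).2 hf.prime
  have h0 : (⊥ : Ideal YRing) < Ideal.span {f} := by
    rw [bot_lt_iff_ne_bot, Ne, Ideal.span_singleton_eq_bot]
    exact hf.ne_zero
  have h1 : Ideal.span {f} < q := by
    refine lt_of_le_of_ne ?_ ?_
    · rw [Ideal.span_singleton_le_iff_mem]
      exact hq.le (Ideal.subset_span (by simp))
    · intro h
      apply hfg
      rw [← Ideal.mem_span_singleton, h]
      exact hq.le (Ideal.subset_span (by simp))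
  have hb : (⊥ : Ideal YRing).IsPrime := Ideal.isPrime_bot
  have i1 := Ideal.height_add_one_le_of_lt_of_isPrime h0
  have i2 := Ideal.height_add_one_le_of_lt_of_isPrime h1
  have i3 : 2 ≤ q.height := by
    refine le_trans ?_ i2
    refine le_trans ?_ (add_le_add_left i1 1)
    rw [show (2 : ℕ∞) = 0 + 1 + 1 by norm_num]
    gcongr
    exact zero_le
  have : q = RingHom.ker (pointHom P) :=
    Ideal.eq_of_le_of_height_le q hqP ((height_ker_pointHom_le P).trans i3)
  simpa only [← this] using hq

/-! ### Elementary transformations -/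

/-- A divisor of a multihomogeneous polynomial by a multihomogeneous one is multihomogeneous. -/
theorem IsMultiHom.of_mul {ι : Type} [DecidableEq ι] {n : ι → ℕ} {f g : CoordRing n}
    {d e : ι → ℕ} (hg : IsMultiHom g e) (hf0 : f ≠ 0) (hg0 : g ≠ 0)
    (h : IsMultiHom (f * g) d) : ∃ d', IsMultiHom f d' ∧ d' + e = d := by
  classical
  let w : (Σ i, Fin (n i)) → (ι → ℕ) := fun s => Pi.single s.1 1
  have key : ∀ k, weightedHomogeneousComponent w (k + e) (f * g) =
      weightedHomogeneousComponent w k f * g := by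
    intro k
    let _ := weightedGradedAlgebra ℂ w
    have := DirectSum.coe_decompose_mul_add_of_right_mem (weightedHomogeneousSubmodule ℂ w)
      (i := k) (j := e) (a := f) (b := g) hg
    rw [← weightedDecomposition.decompose'_apply, ← weightedDecomposition.decompose'_apply]
    exact this
  have hk : ∀ k, k + e ≠ d → weightedHomogeneousComponent w k f = 0 := by
    intro k hk
    have h1 := key k
    rw [IsWeightedHomogeneous.weightedHomogeneousComponent_ne _ h hk] at h1
    exact (mul_eq_zero.1 h1.symm).resolve_right hg0
  have hsup : ∀ m, coeff m f ≠ 0 → Finsupp.weight w m + e = d := by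
    intro m hm
    by_contra hne
    have := congrArg (coeff m) (hk _ hne)
    rw [coeff_weightedHomogeneousComponent, if_pos rfl, coeff_zero] at this
    exact hm this
  obtain ⟨m, hm⟩ := ne_zero_iff.1 hf0
  refine ⟨Finsupp.weight w m, fun m' hm' => ?_, hsup m hm⟩
  exact add_right_cancel ((hsup m' hm').trans (hsup m hm).symm)

/-- The form on `ℙ¹ × ℙ¹` defining the fibre over `[a : 1]`. -/
def fibForm (a : ℂ) : YRing := X ⟨0, 0⟩ - C a * X ⟨0, 1⟩

theorem isMultiHom_fibForm (a : ℂ) : IsMultiHom (fibForm a) (Pi.single 0 1) :=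
  (isMultiHom_X _).sub ((isMultiHom_X _).C_mul a)

theorem eval_fibForm (a : ℂ) (v : YVec) : eval v (fibForm a) = v ⟨0, 0⟩ - a * v ⟨0, 1⟩ := by
  simp [fibForm]

theorem fibForm_irreducible (a : ℂ) : Irreducible (fibForm a) := by
  have h := irreducible_mul_X_add (1 : YRing) (-(C a * X ⟨0, 1⟩)) ⟨0, 0⟩ one_ne_zero (by simp)
    (by
      rw [vars_neg]
      intro h
      have := vars_mul _ _ h
      simp at this) isRelPrime_one_left
  rwa [one_mul, ← sub_eq_add_neg] at h

theorem ordAt_fibForm (a : ℂ) (v : YVec) (hv : v ⟨0, 0⟩ = a * v ⟨0, 1⟩) :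
    ordAt (fibForm a) v = 1 := by
  have h0 := (fibForm_irreducible a).ne_zero
  apply le_antisymm
  · by_contra hlt
    have h2 : 2 ≤ ordAt (fibForm a) v := by omega
    rw [le_ordAt_iff h0, mem_pow_idealOfVars_iff'] at h2
    have h3 := h2 (Finsupp.single ⟨0, 0⟩ 1) (by simp)
    have e : taylorAt v (fibForm a) = fibForm a := by
      simp only [taylorAt, fibForm, map_sub, map_mul, aeval_X, algHom_C, hv]
      simp only [algebraMap_eq]
      ring
    rw [e, fibForm, coeff_sub, coeff_X, coeff_C_mul, coeff_X] at h3
    simp [Finsupp.single_eq_single_iff] at h3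
  · rw [Nat.one_le_iff_ne_zero, Ne, ordAt_eq_zero_iff h0, not_not, eval_fibForm, hv, sub_self]

theorem ordAt_fibForm_of_ne (a : ℂ) (v : YVec) (hv : v ⟨0, 0⟩ ≠ a * v ⟨0, 1⟩) :
    ordAt (fibForm a) v = 0 := by
  rw [ordAt_eq_zero_iff (fibForm_irreducible a).ne_zero, eval_fibForm]
  exact sub_ne_zero.2 hv

/-- Homogeneous coordinates of the point `([a : 1], β)`. -/
def affVec (a : ℂ) (β : Fin 2 → ℂ) : YVec := fun s => if s.1 = 0 then ![a, 1] s.2 else β s.2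

/-- Forms in the coordinates of the first factor, as bihomogeneous forms. -/
def ofBase : MvPolynomial (Fin 2) ℂ →ₐ[ℂ] YRing := rename fun j => ⟨0, j⟩

theorem eval_ofBase (v : YVec) (q : MvPolynomial (Fin 2) ℂ) :
    eval v (ofBase q) = eval (fun j => v ⟨0, j⟩) q := by
  rw [ofBase, eval_rename]; rfl

theorem isMultiHom_ofBase {q : MvPolynomial (Fin 2) ℂ} {e : ℕ} (hq : q.IsHomogeneous e) :
    IsMultiHom (ofBase q) (Pi.single 0 e) := by
  have hq' : ofBase q = aeval (fun j => (X ⟨0, j⟩ : YRing)) q :=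
    DFunLike.congr_fun (MvPolynomial.algHom_ext fun j => by simp [ofBase]) q
  rw [hq', aeval_def, eval₂_eq', algebraMap_eq]
  refine IsMultiHom.sum fun m hm => ?_
  have h1 : m 0 + m 1 = e := by
    have := hq (mem_support_iff.1 hm)
    rw [Finsupp.weight_apply, Finsupp.sum_fintype _ _ (by simp)] at this
    simpa [Fin.sum_univ_two] using this
  have h2 : IsMultiHom (∏ i : Fin 2, (X ⟨0, i⟩ : YRing) ^ m i)
      (∑ i, m i • (Pi.single 0 1 : Fin 2 → ℕ)) :=
    IsMultiHom.prod fun k _ => (isMultiHom_X _).pow _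
  have h3 : ∑ i, m i • (Pi.single 0 1 : Fin 2 → ℕ) = Pi.single 0 e := by
    rw [← Finset.sum_smul, Fin.sum_univ_two, h1]
    ext i; fin_cases i <;> simp
  rw [h3] at h2
  exact h2.C_mul _

/-- The substitution `y ↦ N y` in the coordinates of the second factor, where the entries of `N`
are forms in the coordinates of the first factor. -/
def fibSub (N : Fin 2 → Fin 2 → MvPolynomial (Fin 2) ℂ) : YRing →ₐ[ℂ] YRing :=
  aeval fun s => if s.1 = 0 then X s else ∑ k, ofBase (N s.2 k) * X ⟨1, k⟩

theorem fibSub_X0 (N : Fin 2 → Fin 2 → MvPolynomial (Fin 2) ℂ) (j : Fin 2) :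
    fibSub N (X ⟨0, j⟩) = X ⟨0, j⟩ := by simp [fibSub]

theorem fibSub_X1 (N : Fin 2 → Fin 2 → MvPolynomial (Fin 2) ℂ) (j : Fin 2) :
    fibSub N (X ⟨1, j⟩) = ∑ k, ofBase (N j k) * X ⟨1, k⟩ := by simp [fibSub]

theorem fibSub_ofBase (N : Fin 2 → Fin 2 → MvPolynomial (Fin 2) ℂ)
    (q : MvPolynomial (Fin 2) ℂ) : fibSub N (ofBase q) = ofBase q := by
  have : (fibSub N).comp ofBase = ofBase := by
    ext j; simp [ofBase, fibSub_X0]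
  exact DFunLike.congr_fun this q

theorem fibSub_fibForm (N : Fin 2 → Fin 2 → MvPolynomial (Fin 2) ℂ) (a : ℂ) :
    fibSub N (fibForm a) = fibForm a := by
  simp [fibForm, fibSub_X0, algHom_C]

theorem isMultiHom_fibSub {N : Fin 2 → Fin 2 → MvPolynomial (Fin 2) ℂ} {e : ℕ}
    (hN : ∀ j k, (N j k).IsHomogeneous e) {f : YRing} {d : Fin 2 → ℕ} (hf : IsMultiHom f d) :
    IsMultiHom (fibSub N f) ![d 0 + e * d 1, d 1] := by
  rw [fibSub, aeval_def, eval₂_eq', algebraMap_eq]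
  refine IsMultiHom.sum fun m hm => ?_
  have hm0 := hf.sum_exponents (mem_support_iff.1 hm)
  refine IsMultiHom.C_mul ?_ _
  have h0 : IsMultiHom (∏ s : (Σ _ : Fin 2, Fin 2), (if s.1 = 0 then X s else
      ∑ k, ofBase (N s.2 k) * X ⟨1, k⟩ : YRing) ^ m s)
      (∑ s : (Σ _ : Fin 2, Fin 2), m s • (if s.1 = 0 then Pi.single 0 1 else
        Pi.single 0 e + Pi.single 1 1 : Fin 2 → ℕ)) := by
    refine IsMultiHom.prod fun s _ => IsMultiHom.pow ?_ _
    split_ifs with hs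
    · have := isMultiHom_X (n := fun _ : Fin 2 => 2) s
      rwa [hs] at this
    · exact IsMultiHom.sum fun k' _ => (isMultiHom_ofBase (hN _ k')).mul (isMultiHom_X _)
  have h3 : ∑ s : (Σ _ : Fin 2, Fin 2), m s • (if s.1 = 0 then Pi.single 0 1 else
        Pi.single 0 e + Pi.single 1 1 : Fin 2 → ℕ) = ![d 0 + e * d 1, d 1] := by
    rw [Fintype.sum_sigma, Fin.sum_univ_two]
    simp only [if_true, one_ne_zero, if_false]
    rw [← Finset.sum_smul, ← Finset.sum_smul, hm0 0, hm0 1]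
    ext i
    fin_cases i
    · simp [mul_comm]
    · simp
  rw [h3] at h0
  exact h0

/-- A pair of mutually inverse (up to the factor `∏ i, (x₀ - aᵢ x₁)`) matrices of forms of degree
`e` on `ℙ¹`. It describes the elementary transformation of the ruled surface `ℙ¹ × ℙ¹` at the
points `([aᵢ : 1], βᵢ)`, the inverse of which is the elementary transformation at the points
`([aᵢ : 1], β'ᵢ)`. -/
structure IsElemPair {r : ℕ} (e : ℕ) (a : Fin r → ℂ) (β β' : Fin r → Fin 2 → ℂ)
    (M N : Fin 2 → Fin 2 → MvPolynomial (Fin 2) ℂ) : Prop where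
  homM : ∀ j k, (M j k).IsHomogeneous e
  homN : ∀ j k, (N j k).IsHomogeneous e
  mulMN : ∀ j l, ∑ k, M j k * N k l = if j = l then ∏ i, (X 0 - C (a i) * X 1) else 0
  mulNM : ∀ j l, ∑ k, N j k * M k l = if j = l then ∏ i, (X 0 - C (a i) * X 1) else 0
  kerM : ∀ i j, ∑ k, eval ![a i, 1] (M j k) * β i k = 0
  kerN : ∀ i j, ∑ k, eval ![a i, 1] (N j k) * β' i k = 0
  imM : ∀ i, ∃ w : Fin 2 → ℂ, w ≠ 0 ∧ ∀ j k, eval ![a i, 1] (M j k) = w k * β' i j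
  imN : ∀ i, ∃ w : Fin 2 → ℂ, w ≠ 0 ∧ ∀ j k, eval ![a i, 1] (N j k) = w k * β i j

theorem IsElemPair.symm {r e : ℕ} {a : Fin r → ℂ} {β β' : Fin r → Fin 2 → ℂ}
    {M N : Fin 2 → Fin 2 → MvPolynomial (Fin 2) ℂ} (h : IsElemPair e a β β' M N) :
    IsElemPair e a β' β N M :=
  ⟨h.homN, h.homM, h.mulNM, h.mulMN, h.kerN, h.kerM, h.imN, h.imM⟩

section

variable {r e : ℕ} {a : Fin r → ℂ} {β β' : Fin r → Fin 2 → ℂ}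
  {M N : Fin 2 → Fin 2 → MvPolynomial (Fin 2) ℂ}

theorem ofBase_prod (a : Fin r → ℂ) :
    ofBase (∏ i, (X 0 - C (a i) * X 1)) = ∏ i, fibForm (a i) := by
  simp [ofBase, fibForm, map_prod]

/-- Both compositions of the two substitutions multiply the second coordinates by the
determinant. -/
theorem IsElemPair.fibSub_fibSub_eq_aeval (h : IsElemPair e a β β' M N) (f : YRing) :
    fibSub M (fibSub N f) =
      aeval (fun s => (![1, ∏ i, fibForm (a i)] s.1 : YRing) * X s) f := by
  rw [← AlgHom.comp_apply]
  refine DFunLike.congr_fun (MvPolynomial.algHom_ext ?_) f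
  rintro ⟨i, j⟩
  fin_cases i
  · simp [fibSub_X0]
  · simp only [Fin.mk_one, AlgHom.comp_apply, fibSub_X1, map_sum, map_mul, fibSub_ofBase, aeval_X,
      Matrix.cons_val_one, Matrix.cons_val_fin_one]
    simp only [Finset.mul_sum]
    rw [Finset.sum_comm]
    have : ∀ l, ∑ k, ofBase (N j k) * (ofBase (M k l) * X ⟨1, l⟩) =
        ofBase (∑ k, N j k * M k l) * X ⟨1, l⟩ := by
      intro l
      rw [map_sum, Finset.sum_mul]
      exact Finset.sum_congr rfl fun k _ => by rw [map_mul]; ring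
    simp only [this, h.mulNM]
    rw [Finset.sum_eq_single j]
    · rw [if_pos rfl, ofBase_prod]
    · intro l _ hl
      rw [if_neg (Ne.symm hl), map_zero, zero_mul]
    · simp

theorem IsElemPair.fibSub_fibSub (h : IsElemPair e a β β' M N) {f : YRing} {d : Fin 2 → ℕ}
    (hf : IsMultiHom f d) : fibSub M (fibSub N f) = (∏ i, fibForm (a i) ^ d 1) * f := by
  rw [h.fibSub_fibSub_eq_aeval, hf.eval_scale (A := YRing), aeval_X_left_apply,
    Fin.prod_univ_two]
  simp [Finset.prod_pow]

theorem prod_fibForm_pow_ne_zero (a : Fin r → ℂ) (k : Fin r → ℕ) :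
    ∏ i, fibForm (a i) ^ k i ≠ 0 :=
  Finset.prod_ne_zero_iff.2 fun i _ => pow_ne_zero _ (fibForm_irreducible (a i)).ne_zero

theorem IsElemPair.fibSub_ne_zero (h : IsElemPair e a β β' M N) {f : YRing} {d : Fin 2 → ℕ}
    (hf : IsMultiHom f d) (hf0 : f ≠ 0) : fibSub N f ≠ 0 := by
  intro h0
  have := h.fibSub_fibSub hf
  rw [h0, map_zero] at this
  exact mul_ne_zero (prod_fibForm_pow_ne_zero a _) hf0 this.symm

theorem fibSub_eval (N : Fin 2 → Fin 2 → MvPolynomial (Fin 2) ℂ) (Q : YVec) :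
    (fun s => eval Q ((if s.1 = 0 then X s else ∑ k, ofBase (N s.2 k) * X ⟨1, k⟩ : YRing))) =
      fun s => if s.1 = 0 then Q s else
        ∑ k, eval (fun j => Q ⟨0, j⟩) (N s.2 k) * Q ⟨1, k⟩ := by
  funext s
  split_ifs with hs
  · simp
  · simp [eval_ofBase]

theorem eval_homogeneous_scale {q : MvPolynomial (Fin 2) ℂ} (hq : q.IsHomogeneous e) (t : ℂ)
    (v : Fin 2 → ℂ) : eval (fun j => t * v j) q = t ^ e * eval v q := by
  simp only [eval_eq', Finset.mul_sum]
  refine Finset.sum_congr rfl fun m hm => ?_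
  have h1 : m 0 + m 1 = e := by
    have := hq (mem_support_iff.1 hm)
    rw [Finsupp.weight_apply, Finsupp.sum_fintype _ _ (by simp)] at this
    simpa [Fin.sum_univ_two] using this
  rw [← h1, Fin.prod_univ_two, Fin.prod_univ_two]
  ring

/-- The elementary transformation replaces the exceptional curve over a centre by the fibre
through its inverse's centre: a curve with multiplicity `k` at the centre acquires that fibre with
multiplicity at least `k`. -/
theorem IsElemPair.fibForm_pow_dvd (h : IsElemPair e a β β' M N) {f : YRing} {d : Fin 2 → ℕ}
    (hf : IsMultiHom f d) (hf0 : f ≠ 0) (i : Fin r) :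
    fibForm (a i) ^ ordAt f (affVec (a i) (β i)) ∣ fibSub N f := by
  have hu := fibForm_irreducible (a i)
  have hg0 := h.fibSub_ne_zero hf hf0
  obtain ⟨k, g, hng, hk⟩ := WfDvdMonoid.max_power_factor hg0 hu
  suffices hle : ordAt f (affVec (a i) (β i)) ≤ k by
    rw [hk]; exact (pow_dvd_pow _ hle).trans (dvd_mul_right _ _)
  obtain ⟨w, hw0, hw⟩ := h.imN i
  obtain ⟨k0, hk0⟩ := Function.ne_iff.1 hw0
  let lam : YRing := ∑ k, C (w k) * X ⟨1, k⟩
  have h1 : ¬ fibForm (a i) ∣ X ⟨0, 1⟩ := by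
    rintro ⟨c, hc⟩
    have := congrArg (eval (affVec (a i) 0)) hc
    rw [map_mul, eval_fibForm] at this
    simp [affVec] at this
  have h2 : ¬ fibForm (a i) ∣ lam := by
    rintro ⟨c, hc⟩
    have := congrArg (eval (affVec (a i) (Pi.single k0 1))) hc
    rw [map_mul, eval_fibForm] at this
    fin_cases k0 <;> simp [affVec, lam] at this <;> exact hk0 this
  -- a general point of the fibre, away from the residual curve
  have h3 : ¬ fibForm (a i) ∣ g * (X ⟨0, 1⟩ * lam) := fun hd =>
    (hu.prime.dvd_or_dvd hd).elim hng fun hd => (hu.prime.dvd_or_dvd hd).elim h1 h2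
  have h4 : ∃ Q : YVec, eval Q (fibForm (a i)) = 0 ∧ eval Q (g * (X ⟨0, 1⟩ * lam)) ≠ 0 := by
    by_contra! hc
    exact h3 (dvd_of_forall_eval_eq_zero hu hc)
  obtain ⟨Q, hQ0, hQ⟩ := h4
  rw [map_mul, map_mul, eval_X] at hQ
  have hgQ := left_ne_zero_of_mul hQ
  have htQ := left_ne_zero_of_mul (right_ne_zero_of_mul hQ)
  have hlQ := right_ne_zero_of_mul (right_ne_zero_of_mul hQ)
  have hQ1 : Q ⟨0, 0⟩ = a i * Q ⟨0, 1⟩ := by rw [eval_fibForm] at hQ0; exact sub_eq_zero.1 hQ0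
  have hord : ordAt (fibSub N f) Q = k := by
    rw [hk, ordAt_mul (pow_ne_zero _ hu.ne_zero) (right_ne_zero_of_mul (hk ▸ hg0)),
      ordAt_pow hu.ne_zero, ordAt_fibForm _ _ hQ1,
      (ordAt_eq_zero_iff (right_ne_zero_of_mul (hk ▸ hg0)) _).2 hgQ]
    simp
  rw [← hord]
  refine le_trans (le_of_eq ?_) (ordAt_le_ordAt_aeval _ hg0 Q)
  rw [fibSub_eval]
  rw [← hf.ordAt_scale hf0 ![Q ⟨0, 1⟩, Q ⟨0, 1⟩ ^ e * eval Q lam] ?_ (affVec (a i) (β i))]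
  · congr 1
    funext ⟨s, j⟩
    have hQx : (fun j => Q ⟨0, j⟩) = fun j => Q ⟨0, 1⟩ * (![a i, 1] : Fin 2 → ℂ) j := by
      funext j; fin_cases j
      · simp [hQ1, mul_comm]
      · simp
    fin_cases s
    · simpa [affVec] using (congrFun hQx j).symm
    · simp only [Fin.mk_one, Matrix.cons_val_one, Matrix.cons_val_fin_one, affVec, one_ne_zero,
        if_false]
      rw [hQx]
      simp only [eval_homogeneous_scale (h.homN _ _), hw, lam, map_sum, map_mul, eval_C, eval_X]
      rw [Finset.mul_sum, Finset.sum_mul]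
      exact Finset.sum_congr rfl fun k _ => by ring
  · intro s
    fin_cases s
    · exact htQ
    · exact mul_ne_zero (pow_ne_zero _ htQ) hlQ

theorem IsMultiHom.le_ordAt_of_eq_zero {f : YRing} {d : Fin 2 → ℕ} (hf : IsMultiHom f d)
    (hf0 : f ≠ 0) (Q : YVec) (hQ : ∀ j, Q ⟨1, j⟩ = 0) : d 1 ≤ ordAt f Q := by
  rw [le_ordAt_iff hf0, taylorAt, aeval_def, eval₂_eq']
  refine Ideal.sum_mem _ fun m hm => Ideal.mul_mem_left _ _ ?_
  rw [Fintype.prod_sigma, Fin.prod_univ_two]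
  refine Ideal.mul_mem_left _ _ ?_
  rw [← hf.sum_exponents (mem_support_iff.1 hm) 1, ← Finset.prod_pow_eq_pow_sum]
  refine Ideal.prod_mem_prod fun j _ => ?_
  rw [hQ, C_0, add_zero]
  exact Ideal.pow_mem_pow (Ideal.subset_span (Set.mem_range_self _)) _

/-- The points of the contracted fibre impose multiplicity: after the elementary transformation a
form of degree `d 1` along the fibres vanishes to order at least `d 1` at the new centre. -/
theorem IsElemPair.le_ordAt_fibSub (h : IsElemPair e a β β' M N) {f : YRing} {d : Fin 2 → ℕ}
    (hf : IsMultiHom f d) (hf0 : f ≠ 0) (i : Fin r) :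
    d 1 ≤ ordAt (fibSub N f) (affVec (a i) (β' i)) := by
  refine le_trans ?_ (ordAt_le_ordAt_aeval _ (h.fibSub_ne_zero hf hf0) _)
  refine hf.le_ordAt_of_eq_zero hf0 _ fun j => ?_
  refine (congrFun (fibSub_eval N _) ⟨1, j⟩).trans ?_
  simpa [affVec] using h.kerN i j

end

theorem le_of_pow_dvd_pow_mul {R : Type*} [CommRing R] [IsDomain R] {p h : R} (hp : p ≠ 0)
    (hh : ¬ p ∣ h) {m n : ℕ} (hd : p ^ m ∣ p ^ n * h) : m ≤ n := by
  by_contra hlt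
  have h1 : p ^ n * p ∣ p ^ n * h := by
    rw [← pow_succ]
    exact (pow_dvd_pow p (by omega)).trans hd
  exact hh ((mul_dvd_mul_iff_left (pow_ne_zero n hp)).1 h1)

/-- Splitting off the largest powers of finitely many primes. -/
theorem exists_eq_mul_prod_pow {R κ : Type*} [CommRing R] [IsDomain R] [WfDvdMonoid R]
    {u : κ → R} (hu : ∀ i, Irreducible (u i)) (s : Finset κ) {g : R} (hg : g ≠ 0) :
    ∃ (f : R) (k : κ → ℕ), g = f * ∏ i ∈ s, u i ^ k i ∧ ∀ i ∈ s, ¬ u i ∣ f := by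
  classical
  induction s using Finset.induction_on with
  | empty => exact ⟨g, 0, by simp, by simp⟩
  | insert i s his ih =>
    obtain ⟨f, k, hfk, hf⟩ := ih
    have hf0 : f ≠ 0 := left_ne_zero_of_mul (hfk ▸ hg)
    obtain ⟨n, f', hn, hf'⟩ := WfDvdMonoid.max_power_factor hf0 (hu i)
    refine ⟨f', Function.update k i n, ?_, ?_⟩
    · rw [Finset.prod_insert his, Function.update_self]
      have : ∏ j ∈ s, u j ^ Function.update k i n j = ∏ j ∈ s, u j ^ k j :=
        Finset.prod_congr rfl fun j hj => by
          rw [Function.update_of_ne (by rintro rfl; exact his hj)]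
      rw [this, hfk, hf']; ring
    · intro j hj hd
      rcases Finset.mem_insert.1 hj with rfl | hj
      · exact hn hd
      · exact hf j hj (hd.trans ⟨_, by rw [hf', mul_comm]⟩)

section

variable {r e : ℕ} {a : Fin r → ℂ} {β β' : Fin r → Fin 2 → ℂ}
  {M N : Fin 2 → Fin 2 → MvPolynomial (Fin 2) ℂ}

theorem fibForm_dvd_fibForm {c c' : ℂ} (h : fibForm c ∣ fibForm c') : c = c' := by
  obtain ⟨k, hk⟩ := h
  have := congrArg (eval (affVec c 0)) hk
  rw [map_mul, eval_fibForm, eval_fibForm] at this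
  simp only [affVec, if_true, Matrix.cons_val_zero, Matrix.cons_val_one, mul_one,
    Matrix.cons_val_fin_one, sub_self, zero_mul] at this
  exact sub_eq_zero.1 this

theorem ordAt_prod_fibForm (ha : Function.Injective a) (k : Fin r → ℕ) (i : Fin r)
    (β : Fin 2 → ℂ) : ordAt (∏ j, fibForm (a j) ^ k j) (affVec (a i) β) = k i := by
  rw [← Finset.mul_prod_erase _ _ (Finset.mem_univ i), ordAt_mul
    (pow_ne_zero _ (fibForm_irreducible _).ne_zero)
    (Finset.prod_ne_zero_iff.2 fun j _ => pow_ne_zero _ (fibForm_irreducible _).ne_zero),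
    ordAt_pow (fibForm_irreducible _).ne_zero, ordAt_fibForm _ _ (by simp [affVec]), mul_one]
  rw [(ordAt_eq_zero_iff
    (Finset.prod_ne_zero_iff.2 fun j _ => pow_ne_zero _ (fibForm_irreducible _).ne_zero) _).2,
    add_zero]
  rw [map_prod]
  refine Finset.prod_ne_zero_iff.2 fun j hj => ?_
  rw [map_pow]
  refine pow_ne_zero _ ?_
  rw [eval_fibForm]
  simpa [affVec, sub_eq_zero] using fun h => (Finset.ne_of_mem_erase hj) (ha h).symm

theorem le_of_fibForm_pow_dvd (ha : Function.Injective a) {f : YRing} (i : Fin r)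
    (hf : ¬ fibForm (a i) ∣ f) {m : ℕ} {k : Fin r → ℕ}
    (hd : fibForm (a i) ^ m ∣ f * ∏ j, fibForm (a j) ^ k j) : m ≤ k i := by
  rw [← Finset.mul_prod_erase _ _ (Finset.mem_univ i), mul_left_comm] at hd
  have hp := (fibForm_irreducible (a i)).prime
  refine le_of_pow_dvd_pow_mul hp.ne_zero (fun h => ?_) hd
  rcases hp.dvd_or_dvd h with h | h
  · exact hf h
  · obtain ⟨j, hj, hd⟩ := (hp.dvd_finsetProd_iff _).1 h
    exact Finset.ne_of_mem_erase hj (ha (fibForm_dvd_fibForm (hp.dvd_of_dvd_pow hd))).symm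

theorem exists_fibForm_dvd {f : YRing} (hf : Irreducible f) {k : Fin r → ℕ}
    (hd : f ∣ ∏ j, fibForm (a j) ^ k j) : ∃ i, fibForm (a i) ∣ f := by
  obtain ⟨j, _, hd⟩ := (hf.prime.dvd_finsetProd_iff _).1 hd
  exact ⟨j, (hf.associated_of_dvd (fibForm_irreducible _) (hf.prime.dvd_of_dvd_pow hd)).symm.dvd⟩

/-- A form that becomes a divisor of a form in the base coordinates after the substitution
already was one. -/
theorem IsElemPair.fibSub_eq_self_of_dvd (hMN : IsElemPair e a β β' M N) {h : YRing}
    {k : Fin r → ℕ} (hd : fibSub M h ∣ ∏ j, fibForm (a j) ^ k j) : fibSub M h = h := by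
  have hq : (∏ j, fibForm (a j) ^ k j : YRing) = ofBase (∏ j, (X 0 - C (a j) * X 1) ^ k j) := by
    simp [ofBase, fibForm, map_prod]
  have hdeg : ∀ j, degreeOf (⟨1, j⟩ : (Σ _ : Fin 2, Fin 2)) (fibSub M h) = 0 := by
    intro j
    have h0 : degreeOf (⟨1, j⟩ : (Σ _ : Fin 2, Fin 2)) (∏ j, fibForm (a j) ^ k j) = 0 := by
      have : IsMultiHom (∏ j, fibForm (a j) ^ k j) (∑ j, k j • Pi.single 0 1) :=
        IsMultiHom.prod fun j _ => (isMultiHom_fibForm (a j)).pow _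
      refine this.degreeOf_eq_zero ?_ j
      simp
    obtain ⟨c, hc⟩ := hd
    have hne := prod_fibForm_pow_ne_zero a k
    rw [hc] at h0 hne
    rw [degreeOf_mul_eq (left_ne_zero_of_mul hne) (right_ne_zero_of_mul hne)] at h0
    omega
  -- the values of `fibSub M h` depend only on the base coordinates
  have hval : ∀ v w : YVec, (∀ j, v ⟨0, j⟩ = w ⟨0, j⟩) →
      eval v (fibSub M h) = eval w (fibSub M h) := by
    intro v w hvw
    rw [eval_eq', eval_eq']
    refine Finset.sum_congr rfl fun m hm => ?_
    congr 1
    refine Finset.prod_congr rfl ?_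
    rintro ⟨i, j⟩ _
    fin_cases i
    · change v ⟨0, j⟩ ^ _ = w ⟨0, j⟩ ^ _
      rw [hvw j]
    · have h1 := degreeOf_eq_sup (⟨1, j⟩ : (Σ _ : Fin 2, Fin 2)) (fibSub M h)
      rw [hdeg] at h1
      have h2 : m ⟨1, j⟩ = 0 := Nat.le_zero.1 (h1 ▸ Finset.le_sup
        (f := fun m : (Σ _ : Fin 2, Fin 2) →₀ ℕ => m ⟨1, j⟩) hm)
      change v ⟨1, j⟩ ^ m ⟨1, j⟩ = w ⟨1, j⟩ ^ m ⟨1, j⟩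
      rw [h2, pow_zero, pow_zero]
  have hsub : ∀ (v : YVec), eval v (fibSub M h) = eval (fun s => if s.1 = 0 then v s else
        ∑ k, eval (fun j => v ⟨0, j⟩) (M s.2 k) * v ⟨1, k⟩) h := by
    intro v
    rw [← fibSub_eval, fibSub]
    have : (eval v).comp (aeval (fun s : (Σ _ : Fin 2, Fin 2) => if s.1 = 0 then X s else
        ∑ k, ofBase (M s.2 k) * X ⟨1, k⟩ : _ → YRing)).toRingHom =
        eval fun s => eval v (if s.1 = 0 then X s else
          ∑ k, ofBase (M s.2 k) * X ⟨1, k⟩ : YRing) := by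
      ext s <;> simp
    exact DFunLike.congr_fun this h
  have hmul : (∏ i, fibForm (a i)) * (fibSub M h - h) = 0 := by
    refine MvPolynomial.funext fun v => ?_
    rw [map_mul, map_sub, map_zero, mul_eq_zero]
    by_cases hdet : eval v (∏ i, fibForm (a i)) = 0
    · exact Or.inl hdet
    · right
      set Δ := eval v (∏ i, fibForm (a i))
      -- over this base point the matrix `M` is invertible
      let w : YVec := fun s => if s.1 = 0 then v s else
        Δ⁻¹ * ∑ k, eval (fun j => v ⟨0, j⟩) (N s.2 k) * v ⟨1, k⟩
      rw [hval v w fun j => by simp [w], hsub w, sub_eq_zero]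
      congr 2
      funext ⟨i, j⟩
      fin_cases i
      · simp [w]
      · simp only [Fin.mk_one, one_ne_zero, if_false, w, if_true]
        have hmat : ∀ l, ∑ k, eval (fun j => v ⟨0, j⟩) (M j k) *
            eval (fun j => v ⟨0, j⟩) (N k l) = if j = l then Δ else 0 := by
          intro l
          have := congrArg (eval fun j => v ⟨0, j⟩) (hMN.mulMN j l)
          rw [map_sum] at this
          simp only [map_mul] at this
          rw [this]
          split_ifs
          · rw [← eval_ofBase, ofBase_prod]
          · simp
        have : ∑ k, eval (fun j => v ⟨0, j⟩) (M j k) * (Δ⁻¹ * ∑ l,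
            eval (fun j => v ⟨0, j⟩) (N k l) * v ⟨1, l⟩) =
            Δ⁻¹ * ∑ l, (∑ k, eval (fun j => v ⟨0, j⟩) (M j k) *
              eval (fun j => v ⟨0, j⟩) (N k l)) * v ⟨1, l⟩ := by
          simp only [Fin.sum_univ_two]; ring
        rw [this]
        simp only [hmat, ite_mul, zero_mul, Finset.sum_ite_eq, Finset.mem_univ, if_true]
        rw [← mul_assoc, inv_mul_cancel₀ hdet, one_mul]
  have hΔ : (∏ i, fibForm (a i)) ≠ 0 :=
    Finset.prod_ne_zero_iff.2 fun i _ => (fibForm_irreducible (a i)).ne_zero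
  exact sub_eq_zero.1 ((mul_eq_zero.1 hmul).resolve_left hΔ)

/-- The proper transform of a curve, other than the fibres through the centres, under an
elementary transformation. -/
theorem IsElemPair.exists_transform (h : IsElemPair e a β β' M N) (ha : Function.Injective a)
    {f : YRing} {d : Fin 2 → ℕ} (hf : Irreducible f) (hd : IsMultiHom f d)
    (hfa : ∀ i, ¬ fibForm (a i) ∣ f) :
    ∃ (f' : YRing) (d' : Fin 2 → ℕ), Irreducible f' ∧ IsMultiHom f' d' ∧
      (∀ i, ¬ fibForm (a i) ∣ f') ∧ f ∣ fibSub M f' ∧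
      fibSub M f' ∣ f * ∏ i, fibForm (a i) ^ d 1 ∧
      d' 0 + ∑ i, ordAt f (affVec (a i) (β i)) = d 0 + e * d 1 ∧ d' 1 = d 1 ∧
      ∀ i, ordAt f' (affVec (a i) (β' i)) + ordAt f (affVec (a i) (β i)) = d 1 := by
  have hf0 := hf.ne_zero
  have hg0 := h.fibSub_ne_zero hd hf0
  obtain ⟨f', k, hg, hk⟩ := exists_eq_mul_prod_pow
    (fun i => fibForm_irreducible (a i)) Finset.univ hg0
  have hf'0 : f' ≠ 0 := left_ne_zero_of_mul (hg ▸ hg0)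
  have hk' : ∀ i, ¬ fibForm (a i) ∣ f' := fun i => hk i (Finset.mem_univ i)
  have hprod : IsMultiHom (∏ j, fibForm (a j) ^ k j) (∑ j, k j • Pi.single 0 1) :=
    IsMultiHom.prod fun j _ => (isMultiHom_fibForm (a j)).pow _
  obtain ⟨d', hd', hdd⟩ := IsMultiHom.of_mul hprod hf'0 (prod_fibForm_pow_ne_zero a k)
    (hg ▸ isMultiHom_fibSub h.homN hd)
  have hd0 : d' 0 + ∑ i, k i = d 0 + e * d 1 := by
    have := congrFun hdd 0
    simpa using this
  have hd1 : d' 1 = d 1 := by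
    have := congrFun hdd 1
    simpa using this
  -- transforming back
  have hback : fibSub M f' * ∏ i, fibForm (a i) ^ k i = f * ∏ i, fibForm (a i) ^ d 1 := by
    have h1 := h.fibSub_fibSub hd
    rw [hg, map_mul, map_prod] at h1
    simp only [map_pow, fibSub_fibForm] at h1
    rw [h1, mul_comm]
  have hM0 := h.symm.fibSub_ne_zero hd' hf'0
  have hfM : f ∣ fibSub M f' := by
    have : f ∣ fibSub M f' * ∏ i, fibForm (a i) ^ k i := ⟨_, hback⟩
    rcases hf.prime.dvd_or_dvd this with h1 | h1
    · exact h1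
    · obtain ⟨i, hi⟩ := exists_fibForm_dvd hf h1
      exact absurd hi (hfa i)
  -- the four inequalities between multiplicities
  have i1 : ∀ i, ordAt f (affVec (a i) (β i)) ≤ k i := fun i =>
    le_of_fibForm_pow_dvd ha i (hk' i) (hg ▸ h.fibForm_pow_dvd hd hf0 i)
  have i2 : ∀ i, d 1 ≤ ordAt f' (affVec (a i) (β' i)) + k i := by
    intro i
    have := h.le_ordAt_fibSub hd hf0 i
    rwa [hg, ordAt_mul hf'0 (prod_fibForm_pow_ne_zero a k), ordAt_prod_fibForm ha] at this
  have i3 : ∀ i, ordAt f' (affVec (a i) (β' i)) + k i ≤ d 1 := by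
    intro i
    refine le_of_fibForm_pow_dvd (k := fun _ => d 1) ha i (hfa i) ?_
    rw [← hback, pow_add]
    exact mul_dvd_mul (h.symm.fibForm_pow_dvd hd' hf'0 i)
      (Finset.dvd_prod_of_mem (fun i => fibForm (a i) ^ k i) (Finset.mem_univ i))
  have i4 : ∀ i, k i ≤ ordAt f (affVec (a i) (β i)) := by
    intro i
    have h1 := h.symm.le_ordAt_fibSub hd' hf'0 i
    have h2 := congrArg (fun g => ordAt g (affVec (a i) (β i))) hback
    simp only [ordAt_mul hM0 (prod_fibForm_pow_ne_zero a k),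
      ordAt_mul hf0 (prod_fibForm_pow_ne_zero a fun _ => d 1)] at h2
    rw [ordAt_prod_fibForm ha, ordAt_prod_fibForm ha] at h2
    omega
  have hke : ∀ i, ordAt f (affVec (a i) (β i)) = k i := fun i => le_antisymm (i1 i) (i4 i)
  refine ⟨f', d', ⟨?_, ?_⟩, hd', hk', hfM, ⟨_, hback.symm⟩, ?_, hd1, ?_⟩
  · intro hu
    exact hf.not_isUnit (isUnit_of_dvd_unit hfM (hu.map (fibSub M)))
  · -- a factor that does not carry `f` is a product of fibres, hence constant
    have key : ∀ g₁ g₂ : YRing, f' = g₁ * g₂ → f ∣ fibSub M g₁ → IsUnit g₂ := by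
      intro g₁ g₂ hgg ⟨q, hq⟩
      have h1 : fibSub M g₂ ∣ ∏ i, fibForm (a i) ^ d 1 := by
        refine ⟨q * ∏ i, fibForm (a i) ^ k i, mul_left_cancel₀ hf0 ?_⟩
        rw [← hback, hgg, map_mul, hq]; ring
      have h2 := h.fibSub_eq_self_of_dvd h1
      rw [h2] at h1
      by_contra hu
      obtain ⟨p, hp, hpg⟩ := WfDvdMonoid.exists_irreducible_factor hu
        (right_ne_zero_of_mul (hgg ▸ hf'0))
      obtain ⟨i, hi⟩ := exists_fibForm_dvd hp (hpg.trans h1)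
      exact hk' i (hi.trans (hpg.trans ⟨g₁, by rw [hgg, mul_comm]⟩))
    intro g₁ g₂ hgg
    rw [hgg, map_mul] at hfM
    rcases hf.prime.dvd_or_dvd hfM with h1 | h1
    · exact Or.inr (key g₁ g₂ hgg h1)
    · exact Or.inl (key g₂ g₁ (hgg.trans (mul_comm _ _)) h1)
  · simp only [hke, hd0]
  · intro i
    have := i2 i; have := i3 i
    rw [hke]; omega

end

/-! ### Transport of curve classes between configurations -/

/-- Names of the irreducible curves on the blowup: an exceptional curve is named by its index, the
proper transform of a curve on `ℙ¹ × ℙ¹` by an irreducible bihomogeneous equation. -/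
abbrev CurveName (r : ℕ) : Type :=
  Fin r ⊕ {f : YRing // Irreducible f ∧ ∃ d, IsMultiHom f d}

/-- Two names denote the same curve: the indices agree, or the equations are associated. -/
def SameCurve {r : ℕ} : CurveName r → CurveName r → Prop
  | Sum.inl i, Sum.inl j => i = j
  | Sum.inr f, Sum.inr g => Associated f.1 g.1
  | _, _ => False

/-- `HasClass P k c`: the curve named `k` on the blowup at the points with homogeneous
coordinates `P i` has class `c`. -/
def HasClass {r : ℕ} (P : Fin r → YVec) : CurveName r → NS r → Prop
  | Sum.inl i, c => c = Sum.elim (fun _ => 0) (Pi.single i 1)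
  | Sum.inr f, c => ∃ d : Fin 2 → ℕ, IsMultiHom f.1 d ∧
      c = Sum.elim (fun j => (d j : ℝ)) (fun i => -(ordAt f.1 (P i) : ℝ))

/-- There is a map from the names of irreducible curves on the blowup at `P` to those on the
blowup at `P'` that acts on classes by `τ` and sends names of different curves to names of different
curves. It need not send different names of one curve to names of one curve: one name is chosen for
each curve where a map of curves is needed. -/
def Transports {r : ℕ} (P P' : Fin r → YVec) (τ : NS r → NS r) : Prop :=
  ∃ Θ : CurveName r → CurveName r, (∀ k c, HasClass P k c → HasClass P' (Θ k) (τ c)) ∧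
    ∀ k k', SameCurve (Θ k) (Θ k') → SameCurve k k'

theorem Transports.trans {r : ℕ} {P P' P'' : Fin r → YVec} {τ τ' : NS r → NS r}
    (h : Transports P P' τ) (h' : Transports P' P'' τ') : Transports P P'' (τ' ∘ τ) := by
  obtain ⟨Θ, h1, h2⟩ := h
  obtain ⟨Θ', h1', h2'⟩ := h'
  exact ⟨Θ' ∘ Θ, fun k c hc => h1' _ _ (h1 k c hc), fun k k' hk => h2 _ _ (h2' _ _ hk)⟩

/-- The action of the elementary transformation at all centres on `H²`. -/
def elemT {r : ℕ} (e : ℕ) (v : NS r) : NS r :=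
  Sum.elim ![v (Sum.inl 0) + e * v (Sum.inl 1) + ∑ i, v (Sum.inr i), v (Sum.inl 1)]
    fun i => -v (Sum.inl 1) - v (Sum.inr i)

/-- The action on `H²` of the exchange of the two factors of `ℙ¹ × ℙ¹`. -/
def swapT {r : ℕ} (v : NS r) : NS r :=
  Sum.elim ![v (Sum.inl 1), v (Sum.inl 0)] fun i => v (Sum.inr i)

/-- An elementary transformation exchanges the exceptional curve over each centre with the fibre
through the corresponding centre of the inverse transformation, and carries every other curve to its
proper transform. -/
theorem IsElemPair.transports {r e : ℕ} {a : Fin r → ℂ} {β β' : Fin r → Fin 2 → ℂ}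
    {M N : Fin 2 → Fin 2 → MvPolynomial (Fin 2) ℂ} (h : IsElemPair e a β β' M N)
    (ha : Function.Injective a) :
    Transports (fun i => affVec (a i) (β i)) (fun i => affVec (a i) (β' i)) (elemT e) := by
  classical
  -- the fibre through a centre and the exceptional curve over it are exchanged
  let Rel : CurveName r → CurveName r → Prop := fun k k' =>
    match k, k' with
    | Sum.inl i, Sum.inr g => g.1 = fibForm (a i)
    | Sum.inr f, Sum.inl i => fibForm (a i) ∣ f.1
    | Sum.inr f, Sum.inr g => (∀ i, ¬ fibForm (a i) ∣ f.1) ∧ (∀ i, ¬ fibForm (a i) ∣ g.1) ∧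
        f.1 ∣ fibSub M g.1 ∧ ∃ n : ℕ, fibSub M g.1 ∣ f.1 * ∏ i, fibForm (a i) ^ n
    | Sum.inl _, Sum.inl _ => False
  have hordfib : ∀ (i j : Fin r) (γ : Fin 2 → ℂ),
      ordAt (fibForm (a i)) (affVec (a j) γ) = if j = i then 1 else 0 := by
    intro i j γ
    split_ifs with hij
    · subst hij
      exact ordAt_fibForm _ _ (by simp [affVec])
    · exact ordAt_fibForm_of_ne _ _ (by simpa [affVec] using fun h => hij (ha h))
  have ex : ∀ k, ∃ k', Rel k k' ∧ ∀ c, HasClass (fun i => affVec (a i) (β i)) k c →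
      HasClass (fun i => affVec (a i) (β' i)) k' (elemT e c) := by
    rintro (i | ⟨f, hf, d, hd⟩)
    · refine ⟨Sum.inr ⟨fibForm (a i), fibForm_irreducible _, _, isMultiHom_fibForm _⟩, rfl, ?_⟩
      rintro c rfl
      refine ⟨_, isMultiHom_fibForm _, ?_⟩
      funext s
      rcases s with j | j
      · fin_cases j <;> simp [elemT]
      · simp [elemT, hordfib, Pi.single_apply]
    · by_cases hfa : ∃ i, fibForm (a i) ∣ f
      · obtain ⟨i, hi⟩ := hfa
        refine ⟨Sum.inl i, hi, ?_⟩
        rintro c ⟨d', hd', rfl⟩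
        have hass : Associated (fibForm (a i)) f := (fibForm_irreducible _).associated_of_dvd hf hi
        obtain ⟨u, hu⟩ := hass
        have hu' : IsMultiHom (u : YRing) 0 := by
          obtain ⟨c, -, hc⟩ := MvPolynomial.isUnit_iff_eq_C_of_isReduced.1 u.isUnit
          rw [hc]; exact isMultiHom_C c
        have hdd : d' = Pi.single 0 1 := by
          have h1 := (isMultiHom_fibForm (a i)).mul hu'
          rw [hu, add_zero] at h1
          exact hd'.inj_right hf.ne_zero h1
        have hord : ∀ Q, ordAt f Q = ordAt (fibForm (a i)) Q := fun Q =>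
          ordAt_eq_of_associated (fibForm_irreducible _).ne_zero ⟨u, hu⟩ Q
        subst hdd
        change elemT e _ = _
        funext s
        rcases s with j | j
        · fin_cases j
          · simp [elemT, hord, hordfib]
          · simp [elemT]
        · simp [elemT, hord, hordfib, Pi.single_apply]
      · push Not at hfa
        obtain ⟨f', d', hf', hd', hfa', hM, hM', hd0, hd1, hord⟩ := h.exists_transform ha hf hd hfa
        refine ⟨Sum.inr ⟨f', hf', d', hd'⟩, ⟨hfa, hfa', hM, _, hM'⟩, ?_⟩
        rintro c ⟨d'', hd'', rfl⟩
        obtain rfl : d'' = d := hd''.inj_right hf.ne_zero hd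
        refine ⟨d', hd', ?_⟩
        have hd0' : (d' 0 : ℝ) + ∑ i, (ordAt f (affVec (a i) (β i)) : ℝ) = d'' 0 + e * d'' 1 := by
          exact_mod_cast hd0
        have hord' : ∀ i, (ordAt f' (affVec (a i) (β' i)) : ℝ) +
            ordAt f (affVec (a i) (β i)) = d'' 1 := by
          intro i; exact_mod_cast hord i
        funext s
        rcases s with j | j
        · fin_cases j
          · simp only [elemT, Sum.elim_inl, Sum.elim_inr, Fin.zero_eta, Matrix.cons_val_zero,
              Finset.sum_neg_distrib]
            linarith
          · simp [elemT, hd1]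
        · simp only [elemT, Sum.elim_inl, Sum.elim_inr]
          linarith [hord' j]
  choose Θ hΘ hc using ex
  refine ⟨Θ, hc, ?_⟩
  intro k k' hs
  have h1 := hΘ k
  have h2 := hΘ k'
  rcases hk : Θ k with i | g <;> rcases hk' : Θ k' with i' | g' <;>
    rw [hk, hk'] at hs <;> rw [hk] at h1 <;> rw [hk'] at h2 <;>
    rcases k with j | f <;> rcases k' with j' | f' <;>
    simp only [Rel, SameCurve] at h1 h2 hs ⊢
  · subst hs
    exact ((fibForm_irreducible _).associated_of_dvd f.2.1 h1).symm.trans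
      ((fibForm_irreducible _).associated_of_dvd f'.2.1 h2)
  · rw [h1, h2] at hs
    exact ha (fibForm_dvd_fibForm hs.dvd)
  · rw [h1] at hs
    exact h2.2.1 _ hs.dvd
  · rw [h2] at hs
    exact h1.2.1 _ hs.symm.dvd
  · obtain ⟨n, hn⟩ := h2.2.2.2
    have hd : f.1 ∣ f'.1 * ∏ i, fibForm (a i) ^ n :=
      (h1.2.2.1.trans (map_dvd _ hs.dvd)).trans hn
    rcases f.2.1.prime.dvd_or_dvd hd with h3 | h3
    · exact f.2.1.associated_of_dvd f'.2.1 h3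
    · obtain ⟨i, hi⟩ := exists_fibForm_dvd f.2.1 h3
      exact absurd hi (h1.1 i)

/-- Transport along a ring automorphism of the bihomogeneous coordinate ring. -/
theorem transports_of_ringEquiv {r : ℕ} {P P' : Fin r → YVec} (φ : YRing ≃+* YRing)
    (π : Equiv.Perm (Fin 2)) (hφ : ∀ f d, IsMultiHom f d → IsMultiHom (φ f) (d ∘ π))
    (hord : ∀ f i, ordAt (φ f) (P' i) = ordAt f (P i)) :
    Transports P P' fun v => Sum.elim (fun j => v (Sum.inl (π j))) fun i => v (Sum.inr i) := by
  refine ⟨fun k => match k with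
    | Sum.inl i => Sum.inl i
    | Sum.inr f => Sum.inr ⟨φ f.1, (MulEquiv.irreducible_iff φ).2 f.2.1,
        f.2.2.imp' (· ∘ π) fun d hd => hφ _ d hd⟩, ?_, ?_⟩
  · rintro (i | f) c hc
    · obtain rfl := hc
      change _ = _
      funext s
      rcases s with j | j <;> simp
    · obtain ⟨d, hd, rfl⟩ := hc
      refine ⟨d ∘ π, hφ _ d hd, ?_⟩
      funext s
      rcases s with j | j <;> simp [hord]
  · rintro (i | f) (i' | f') hs
    · exact hs
    · exact hs
    · exact hs
    · have h1 : Associated (φ f.1) (φ f'.1) := hs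
      have h2 : Associated f.1 f'.1 := by
        simpa using h1.map (φ.symm : YRing →* YRing)
      exact h2

/-- The exchange of the coordinates of the two factors. -/
def swapVar : (Σ _ : Fin 2, Fin 2) ≃ (Σ _ : Fin 2, Fin 2) where
  toFun s := ⟨Equiv.swap 0 1 s.1, s.2⟩
  invFun s := ⟨Equiv.swap 0 1 s.1, s.2⟩
  left_inv s := by simp
  right_inv s := by simp

theorem ordAt_rename_equiv {σ : Type} (ε : σ ≃ σ) (f : MvPolynomial σ ℂ) (Q : σ → ℂ) :
    ordAt (rename ε f) Q = ordAt f (Q ∘ ε) := by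
  by_cases hf : f = 0
  · subst hf
    simp [ordAt]
  have hr : ∀ (ε : σ ≃ σ) (f : MvPolynomial σ ℂ), rename ε f = aeval (fun s => X (ε s)) f :=
    fun ε f => DFunLike.congr_fun (MvPolynomial.algHom_ext fun s => by simp) f
  have key : ∀ (ε : σ ≃ σ) (f : MvPolynomial σ ℂ) (Q : σ → ℂ), f ≠ 0 →
      ordAt f (Q ∘ ε) ≤ ordAt (rename ε f) Q := by
    intro ε f Q hf
    have h0 : rename ε f ≠ 0 := (map_ne_zero_iff _ (rename_injective _ ε.injective)).2 hf
    rw [hr] at h0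
    have := ordAt_le_ordAt_aeval _ h0 Q
    rw [← hr] at this
    simpa [Function.comp_def] using this
  refine le_antisymm ?_ (key ε f Q hf)
  have h0 : rename ε f ≠ 0 := (map_ne_zero_iff _ (rename_injective _ ε.injective)).2 hf
  have := key ε.symm (rename ε f) (Q ∘ ε) h0
  rw [rename_rename] at this
  simpa [Function.comp_assoc] using this

theorem isMultiHom_rename_swapVar {f : YRing} {d : Fin 2 → ℕ} (hf : IsMultiHom f d) :
    IsMultiHom (rename swapVar f : YRing) (d ∘ Equiv.swap 0 1) := by
  have hr : (rename swapVar f : YRing) = aeval (fun s => (X (swapVar s) : YRing)) f :=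
    DFunLike.congr_fun (MvPolynomial.algHom_ext fun s => by simp) f
  rw [hr, aeval_def, eval₂_eq', algebraMap_eq]
  refine IsMultiHom.sum fun m hm => ?_
  have hm0 := hf.sum_exponents (mem_support_iff.1 hm)
  refine IsMultiHom.C_mul ?_ _
  have h0 : IsMultiHom (∏ s : (Σ _ : Fin 2, Fin 2), (X (swapVar s) : YRing) ^ m s)
      (∑ s : (Σ _ : Fin 2, Fin 2), m s • (Pi.single (swapVar s).1 1 : Fin 2 → ℕ)) :=
    IsMultiHom.prod fun s _ => (isMultiHom_X (n := fun _ : Fin 2 => 2) _).pow _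
  have h3 : ∑ s : (Σ _ : Fin 2, Fin 2), m s • (Pi.single (swapVar s).1 1 : Fin 2 → ℕ) =
      d ∘ Equiv.swap 0 1 := by
    rw [Fintype.sum_sigma, Fin.sum_univ_two]
    simp only [swapVar, Equiv.coe_fn_mk, Equiv.swap_apply_left, Equiv.swap_apply_right]
    rw [← Finset.sum_smul, ← Finset.sum_smul, hm0 0, hm0 1]
    ext i
    fin_cases i
    · simp
    · simp
  rw [h3] at h0
  exact h0

theorem transports_swap {r : ℕ} (a b : Fin r → ℂ) :
    Transports (fun i => affVec (a i) ![b i, 1]) (fun i => affVec (b i) ![a i, 1]) swapT := by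
  have h := transports_of_ringEquiv (P := fun i => affVec (a i) ![b i, 1])
    (P' := fun i => affVec (b i) ![a i, 1]) (renameEquiv ℂ swapVar).toRingEquiv
    (Equiv.swap 0 1) (fun f d hd => isMultiHom_rename_swapVar hd) ?_
  · convert h using 1
    funext v s
    rcases s with j | j
    · fin_cases j <;> simp [swapT]
    · simp [swapT]
  · intro f i
    refine (ordAt_rename_equiv _ _ _).trans ?_
    congr 1
    funext ⟨j, k⟩
    fin_cases j <;> simp [affVec, swapVar]

/-- Field automorphisms of `ℂ` transport curves. -/
theorem transports_aut {r : ℕ} (θ : ℂ ≃+* ℂ) (a b : Fin r → ℂ) :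
    Transports (fun i => affVec (a i) ![b i, 1])
      (fun i => affVec (θ (a i)) ![θ (b i), 1]) id := by
  have h := transports_of_ringEquiv (P := fun i => affVec (a i) ![b i, 1])
    (P' := fun i => affVec (θ (a i)) ![θ (b i), 1]) (mapEquiv _ θ) 1 ?_ ?_
  · convert h using 1
    funext v s
    rcases s with j | j <;> simp
  · intro f d hd m hm
    refine hd (d := m) fun h0 => hm ?_
    change coeff m (map (θ : ℂ →+* ℂ) f) = 0
    rw [coeff_map, h0, map_zero]
  · intro f i
    rw [← ordAt_map θ f]
    congr 1
    funext ⟨j, k⟩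
    fin_cases j <;> fin_cases k <;> simp [affVec]

/-- If a field automorphism carries the centres of the inverse elementary transformation back to
the original ones, up to exchanging the factors, then the elementary transformation yields a
correspondence of the curves of a single blowup with themselves. -/
theorem IsElemPair.transports_self {r e : ℕ} {a b b' : Fin r → ℂ}
    {M N : Fin 2 → Fin 2 → MvPolynomial (Fin 2) ℂ}
    (h : IsElemPair e a (fun i => ![b i, 1]) (fun i => ![b' i, 1]) M N)
    (ha : Function.Injective a) (θ : ℂ ≃+* ℂ) (hθ : ∀ i, θ (b' i) = a i)
    (hθ' : ∀ i, θ (a i) = b i) :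
    Transports (fun i => affVec (a i) ![b i, 1]) (fun i => affVec (a i) ![b i, 1])
        (swapT ∘ elemT e) ∧
      Transports (fun i => affVec (a i) ![b i, 1]) (fun i => affVec (a i) ![b i, 1])
        (elemT e ∘ swapT) := by
  constructor
  · have h1 := ((h.transports ha).trans (transports_swap a b')).trans (transports_aut θ b' a)
    simpa only [hθ, hθ', Function.id_comp] using h1
  · have h1 := ((transports_aut θ.symm a b).trans (transports_swap _ _)).trans
      (by
        have h2 := h.symm.transports ha
        have e1 : ∀ i, θ.symm (a i) = b' i := fun i => by rw [← hθ, RingEquiv.symm_apply_apply]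
        have e2 : ∀ i, θ.symm (b i) = a i := fun i => by rw [← hθ', RingEquiv.symm_apply_apply]
        simp only [e1, e2]
        exact h2)
    simpa only [Function.comp_id] using h1

end

/-! ### Automorphisms of `ℂ` acting on algebraically independent families -/

section Automorphisms

open Set

theorem isAlgebraic_of_intermediateField_adjoin_eq_top {κ : Type} {K F : Type} [Field K] [Field F]
    [Algebra K F] {z : κ → F} (h : IntermediateField.adjoin K (range z) = ⊤) :
    Algebra.IsAlgebraic (Algebra.adjoin K (range z)) F := by
  refine ⟨fun f => ?_⟩
  have hf : f ∈ IntermediateField.adjoin K (range z) := h ▸ IntermediateField.mem_top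
  obtain ⟨p, hp, q, hq, rfl⟩ := (IntermediateField.mem_adjoin_iff_div).1 hf
  rw [div_eq_mul_inv]
  exact (isAlgebraic_algebraMap (⟨p, hp⟩ : Algebra.adjoin K (range z))).mul
    (isAlgebraic_algebraMap (⟨q, hq⟩ : Algebra.adjoin K (range z))).inv

variable {K E : Type} [Field K] [Field E] [Algebra K E] [IsAlgClosed E]

/-- Transcendence bases with the same index set are matched by a field isomorphism. -/
theorem exists_ringEquiv_of_isTranscendenceBasis {κ : Type} {x y : κ → E}
    (hx : IsTranscendenceBasis K x) (hy : IsTranscendenceBasis K y) :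
    ∃ θ : E ≃+* E, ∀ i, θ (x i) = y i := by
  let _ := IsAlgClosed.isAlgClosure_of_transcendence_basis x hx
  let _ := IsAlgClosed.isAlgClosure_of_transcendence_basis y hy
  let ε : Algebra.adjoin K (range x) ≃+* Algebra.adjoin K (range y) :=
    (hx.1.aevalEquiv.symm.trans hy.1.aevalEquiv).toRingEquiv
  refine ⟨IsAlgClosure.equivOfEquiv E E ε, fun i => ?_⟩
  have h1 : ((hx.1.aevalEquiv (MvPolynomial.X i) : Algebra.adjoin K (range x)) : E) = x i := by
    simp
  have h2 : ((hy.1.aevalEquiv (MvPolynomial.X i) : Algebra.adjoin K (range y)) : E) = y i := by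
    simp
  have h3 := IsAlgClosure.equivOfEquiv_algebraMap E E ε (hx.1.aevalEquiv (MvPolynomial.X i))
  rw [show ε (hx.1.aevalEquiv (MvPolynomial.X i)) = hy.1.aevalEquiv (MvPolynomial.X i) by
    simp [ε]] at h3
  rw [← h1, ← h2]
  exact h3

/-- If `x` is algebraically independent and `y` generates the same field as `x`, then some field
automorphism maps `y` to `x`. -/
theorem exists_ringEquiv_of_adjoin_eq {κ : Type} [Finite κ] {x y : κ → E}
    (hx : AlgebraicIndependent K x)
    (hyx : ∀ i, y i ∈ IntermediateField.adjoin K (range x))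
    (hxy : ∀ i, x i ∈ IntermediateField.adjoin K (range y)) :
    ∃ θ : E ≃+* E, ∀ i, θ (y i) = x i := by
  set F := IntermediateField.adjoin K (range x) with hF
  have hxF : ∀ i, x i ∈ F := fun i => IntermediateField.subset_adjoin _ _ (mem_range_self i)
  let xF : κ → F := fun i => ⟨x i, hxF i⟩
  let yF : κ → F := fun i => ⟨y i, hyx i⟩
  have lift_eq : ∀ z : κ → F, (∀ i, x i ∈ IntermediateField.adjoin K (range fun i => (z i : E))) →
      IntermediateField.adjoin K (range z) = ⊤ := by
    intro z hz
    apply IntermediateField.map_injective F.val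
    rw [IntermediateField.adjoin_map, ← range_comp]
    apply le_antisymm
    · rw [← AlgHom.fieldRange_eq_map, IntermediateField.fieldRange_val,
        IntermediateField.adjoin_le_iff]
      rintro _ ⟨i, rfl⟩
      exact (z i).2
    · rw [← AlgHom.fieldRange_eq_map, IntermediateField.fieldRange_val]
      refine hF.le.trans (IntermediateField.adjoin_le_iff.2 ?_)
      rintro _ ⟨i, rfl⟩
      exact hz i
  have hxF_top : IntermediateField.adjoin K (range xF) = ⊤ := lift_eq xF hxF
  have hyF_top : IntermediateField.adjoin K (range yF) = ⊤ := lift_eq yF hxy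
  have hxi : AlgebraicIndependent K xF := AlgebraicIndependent.of_comp F.val hx
  have hxb : IsTranscendenceBasis K xF :=
    hxi.isTranscendenceBasis_iff_isAlgebraic.2
      (isAlgebraic_of_intermediateField_adjoin_eq_top hxF_top)
  have hyb : IsTranscendenceBasis K yF := by
    have := isAlgebraic_of_intermediateField_adjoin_eq_top hyF_top
    exact Algebra.IsAlgebraic.isTranscendenceBasis_of_le_trdeg_of_finite K yF
      hxb.cardinalMk_eq_trdeg.le
  obtain ⟨ι, s, hs⟩ := exists_isTranscendenceBasis' F E
  obtain ⟨θ, hθ⟩ := exists_ringEquiv_of_isTranscendenceBasis (hyb.sumElim_comp hs)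
    (hxb.sumElim_comp hs)
  exact ⟨θ, fun i => hθ (Sum.inr i)⟩

end Automorphisms

/-! ### The linear system defining the elementary transformation -/

section LinearSystem

open Polynomial

/-- The linear conditions `q₁(aᵢ) γᵢ₀ + q₂(aᵢ) γᵢ₁ = 0` on pairs of polynomials of degree less
than `e` have only the trivial solution. -/
def Unisolvent {F : Type} [Field F] {r : ℕ} (e : ℕ) (a : Fin r → F) (γ : Fin r → Fin 2 → F) :
    Prop :=
  ∀ q₁ q₂ : F[X], q₁.degree < e → q₂.degree < e →
    (∀ i, q₁.eval (a i) * γ i 0 + q₂.eval (a i) * γ i 1 = 0) → q₁ = 0 ∧ q₂ = 0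

/-- In the square case the inhomogeneous system has a solution. -/
theorem Unisolvent.exists_solution {F : Type} [Field F] {r e : ℕ} (hr : r = 2 * e)
    {a : Fin r → F} {γ : Fin r → Fin 2 → F} (h : Unisolvent e a γ) (ρ : Fin r → F) :
    ∃ q₁ q₂ : F[X], q₁.degree < e ∧ q₂.degree < e ∧
      ∀ i, q₁.eval (a i) * γ i 0 + q₂.eval (a i) * γ i 1 = ρ i := by
  let L : (degreeLT F e × degreeLT F e) →ₗ[F] (Fin r → F) :=
    { toFun := fun q i => q.1.1.eval (a i) * γ i 0 + q.2.1.eval (a i) * γ i 1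
      map_add' := by
        intro p q; funext i
        simp only [Prod.fst_add, Prod.snd_add, Submodule.coe_add, eval_add, Pi.add_apply]; ring
      map_smul' := by
        intro c q; funext i
        simp only [Prod.smul_fst, Prod.smul_snd, SetLike.val_smul, eval_smul, smul_eq_mul,
          RingHom.id_apply, Pi.smul_apply]; ring }
  have : Module.Finite F (degreeLT F e) := Module.Finite.equiv (degreeLTEquiv F e).symm
  have hfin : Module.finrank F (degreeLT F e × degreeLT F e) = Module.finrank F (Fin r → F) := by
    rw [Module.finrank_prod, (degreeLTEquiv F e).finrank_eq]
    simp; omega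
  have hinj : Function.Injective L := by
    rw [injective_iff_map_eq_zero]
    intro q hq
    obtain ⟨h1, h2⟩ := h q.1.1 q.2.1 (mem_degreeLT.1 q.1.2) (mem_degreeLT.1 q.2.2)
      fun i => congrFun hq i
    ext1 <;> ext1 <;> assumption
  obtain ⟨q, hq⟩ := (LinearMap.injective_iff_surjective_of_finrank_eq_finrank hfin).1 hinj ρ
  exact ⟨q.1.1, q.2.1, mem_degreeLT.1 q.1.2, mem_degreeLT.1 q.2.2, fun i => congrFun hq i⟩

/-- A system with coefficients in a subfield has a solution over this subfield. -/
theorem Unisolvent.exists_solution_mem {K E : Type} [Field K] [Field E] [Algebra K E]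
    (L : IntermediateField K E) {r e : ℕ} (hr : r = 2 * e)
    {a : Fin r → E} {γ : Fin r → Fin 2 → E} (h : Unisolvent e a γ) (ρ : Fin r → E)
    (ha : ∀ i, a i ∈ L) (hγ : ∀ i j, γ i j ∈ L) (hρ : ∀ i, ρ i ∈ L) :
    ∃ q₁ q₂ : E[X], q₁.degree < e ∧ q₂.degree < e ∧
      (∀ i, q₁.eval (a i) * γ i 0 + q₂.eval (a i) * γ i 1 = ρ i) ∧
      ∀ z ∈ L, q₁.eval z ∈ L ∧ q₂.eval z ∈ L := by
  have hev : ∀ (q : L[X]) (z : L), (q.map (algebraMap L E)).eval (z : E) = q.eval z := by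
    intro q z
    exact eval_map_apply (f := algebraMap L E) z
  have hL : Unisolvent e (fun i => (⟨a i, ha i⟩ : L)) (fun i j => ⟨γ i j, hγ i j⟩) := by
    intro q₁ q₂ h1 h2 h3
    obtain ⟨h4, h5⟩ := h (q₁.map (algebraMap L E)) (q₂.map (algebraMap L E))
      (by rwa [degree_map]) (by rwa [degree_map]) (by
        intro i
        have := congrArg (algebraMap L E) (h3 i)
        rw [hev q₁ ⟨a i, ha i⟩, hev q₂ ⟨a i, ha i⟩]
        simpa using this)
    exact ⟨(Polynomial.map_eq_zero _).1 h4, (Polynomial.map_eq_zero _).1 h5⟩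
  obtain ⟨q₁, q₂, h1, h2, h3⟩ := hL.exists_solution hr fun i => ⟨ρ i, hρ i⟩
  refine ⟨q₁.map (algebraMap L E), q₂.map (algebraMap L E), by rwa [degree_map],
    by rwa [degree_map], ?_, ?_⟩
  · intro i
    have := congrArg (algebraMap L E) (h3 i)
    rw [hev q₁ ⟨a i, ha i⟩, hev q₂ ⟨a i, ha i⟩]
    simpa using this
  · intro z hz
    rw [hev q₁ ⟨z, hz⟩, hev q₂ ⟨z, hz⟩]
    exact ⟨(q₁.eval _).2, (q₂.eval _).2⟩

/-- The matrix of the system for `γᵢ = (bᵢ, 1)`. -/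
def systemMatrix {R : Type} [CommRing R] {e : ℕ} (x : (Fin e ⊕ Fin e) × Fin 2 → R) :
    Matrix (Fin e ⊕ Fin e) (Fin e ⊕ Fin e) R :=
  fun i k => Sum.elim (fun k : Fin e => x (i, 1) * x (i, 0) ^ (k : ℕ))
    (fun k : Fin e => x (i, 0) ^ (k : ℕ)) k

theorem systemMatrix_mulVec {F : Type} [Field F] {e : ℕ} (x : (Fin e ⊕ Fin e) × Fin 2 → F)
    (q₁ q₂ : F[X]) (h₁ : q₁.degree < e) (h₂ : q₂.degree < e) (i : Fin e ⊕ Fin e) :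
    (systemMatrix x).mulVec (Sum.elim (fun k => q₁.coeff k) (fun k => q₂.coeff k)) i =
      q₁.eval (x (i, 0)) * x (i, 1) + q₂.eval (x (i, 0)) := by
  have hev : ∀ q : F[X], q.degree < e → ∀ z, q.eval z = ∑ k : Fin e, q.coeff k * z ^ (k : ℕ) := by
    intro q hq z
    rw [Fin.sum_univ_eq_sum_range (fun k => q.coeff k * z ^ k)]
    by_cases h0 : q = 0
    · simp [h0]
    · exact eval_eq_sum_range' ((natDegree_lt_iff_degree_lt h0).2 hq) z
  rw [hev q₁ h₁, hev q₂ h₂, Matrix.mulVec, dotProduct, Fintype.sum_sum_type, Finset.sum_mul]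
  simp only [systemMatrix, Sum.elim_inl, Sum.elim_inr]
  congr 1 <;> exact Finset.sum_congr rfl fun k _ => by ring

/-- The determinant of the system is not identically zero: for `bᵢ = 0` in one half of the
conditions and `bᵢ = 1` in the other half, they say that `q₂` and then `q₁` have too many
zeros. -/
theorem det_systemMatrix_X_ne_zero (e : ℕ) :
    (systemMatrix (e := e) (R := MvPolynomial ((Fin e ⊕ Fin e) × Fin 2) ℚ) MvPolynomial.X).det
      ≠ 0 := by
  let x : (Fin e ⊕ Fin e) × Fin 2 → ℚ := fun s =>
    Sum.elim (fun k : Fin e => if s.2 = 0 then (k : ℚ) else 0)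
      (fun k : Fin e => if s.2 = 0 then (k : ℚ) else 1) s.1
  intro h0
  have h1 : (systemMatrix x).det = 0 := by
    have := congrArg (MvPolynomial.eval x) h0
    rw [map_zero, RingHom.map_det] at this
    rw [← this]
    congr 1
    ext i k
    rcases k with k | k <;> simp [systemMatrix]
  obtain ⟨v, hv0, hv⟩ := Matrix.exists_mulVec_eq_zero_iff.2 h1
  let q : (Fin e → ℚ) → ℚ[X] := fun w => ((degreeLTEquiv ℚ e).symm w).1
  have hq : ∀ w, (q w).degree < e := fun w => mem_degreeLT.1 ((degreeLTEquiv ℚ e).symm w).2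
  have hqc : ∀ w k, (q w).coeff (k : Fin e) = w k := by
    intro w k
    exact congrFun ((degreeLTEquiv ℚ e).apply_symm_apply w) k
  have hsys := systemMatrix_mulVec x (q fun k => v (Sum.inl k)) (q fun k => v (Sum.inr k))
    (hq _) (hq _)
  simp only [hqc] at hsys
  have hvv : (Sum.elim (fun k => v (Sum.inl k)) fun k => v (Sum.inr k)) = v := by
    funext k; rcases k with k | k <;> rfl
  rw [hvv, hv] at hsys
  have hz : ∀ p : ℚ[X], p.degree < e → (∀ k : Fin e, p.eval (k : ℚ) = 0) → p = 0 := by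
    intro p hp hpk
    have hinj : Set.InjOn (fun k : Fin e => (k : ℚ)) (Finset.univ : Finset (Fin e)) :=
      fun i _ j _ hij => Fin.ext (Nat.cast_injective (R := ℚ) hij)
    exact eq_zero_of_degree_lt_of_eval_index_eq_zero _ hinj (by simpa using hp) fun k _ => hpk k
  have h2 : q (fun k => v (Sum.inr k)) = 0 := hz _ (hq _) fun k => by
    simpa [x] using (hsys (Sum.inl k)).symm
  have h3 : q (fun k => v (Sum.inl k)) = 0 := hz _ (hq _) fun k => by
    simpa [x, h2] using (hsys (Sum.inr k)).symm
  apply hv0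
  funext k
  rcases k with k | k
  · rw [← hqc (fun k => v (Sum.inl k)) k, h3]; simp
  · rw [← hqc (fun k => v (Sum.inr k)) k, h2]; simp

/-- For algebraically independent points the system has only the trivial solution. -/
theorem unisolvent_of_algebraicIndependent {r e : ℕ} (hr : r = 2 * e) {x : Fin r × Fin 2 → ℂ}
    (hx : AlgebraicIndependent ℚ x) :
    Unisolvent e (fun i => x (i, 0)) (fun i => ![x (i, 1), 1]) := by
  intro q₁ q₂ h1 h2 h3
  let ε : Fin e ⊕ Fin e ≃ Fin r := finSumFinEquiv.trans (finCongr (by omega))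
  let y : (Fin e ⊕ Fin e) × Fin 2 → ℂ := fun s => x (ε s.1, s.2)
  have hy : AlgebraicIndependent ℚ y :=
    hx.comp (fun s : (Fin e ⊕ Fin e) × Fin 2 => (ε s.1, s.2)) (by
      rintro ⟨i, j⟩ ⟨i', j'⟩ h
      simpa using h)
  have hdet : (systemMatrix y).det ≠ 0 := by
    have h4 := (map_ne_zero_iff _ hy).2 (det_systemMatrix_X_ne_zero e)
    rw [AlgHom.map_det] at h4
    convert h4 using 2
    ext i k
    rcases k with k | k <;> simp [systemMatrix]
  have hv := Matrix.eq_zero_of_mulVec_eq_zero hdet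
    (v := Sum.elim (fun k => q₁.coeff k) (fun k => q₂.coeff k)) (by
      funext i
      rw [systemMatrix_mulVec y q₁ q₂ h1 h2]
      simpa [y] using h3 (ε i))
  have hzero : ∀ q : ℂ[X], q.degree < e → (∀ k : Fin e, q.coeff k = 0) → q = 0 := by
    intro q hq hk
    ext n
    by_cases hn : n < e
    · exact hk ⟨n, hn⟩
    · rw [coeff_zero]
      exact coeff_eq_zero_of_degree_lt (hq.trans_le (by exact_mod_cast not_lt.1 hn))
  exact ⟨hzero q₁ h1 fun k => congrFun hv (Sum.inl k),
    hzero q₂ h2 fun k => congrFun hv (Sum.inr k)⟩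

end LinearSystem

section ElementaryPair

open Polynomial

theorem eq_zero_of_degree_lt_of_forall_eval_eq_zero {F : Type} [Field F] {r : ℕ} {a : Fin r → F}
    (ha : Function.Injective a) {p : F[X]} (hp : p.degree < r) (h : ∀ i, p.eval (a i) = 0) :
    p = 0 :=
  eq_zero_of_degree_lt_of_eval_index_eq_zero Finset.univ ha.injOn (by simpa using hp)
    fun i _ => h i

theorem eval_homogenize_one {p : ℂ[X]} {n : ℕ} (hn : p.natDegree ≤ n) (z : ℂ) :
    MvPolynomial.eval ![z, 1] (p.homogenize n) = p.eval z := by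
  rw [eval_homogenize hn _ (by simp)]
  simp

/-- The univariate form of an elementary transformation: a matrix
`(X ^ e + p, q; s, X ^ e + t)`, with `p, q, s, t` of degree less than `e`, whose value at `aᵢ` annihilates
`(bᵢ, 1)`. -/
structure IsMonicPair {r : ℕ} (e : ℕ) (a b : Fin r → ℂ) (p q s t : ℂ[X]) : Prop where
  hp : p.degree < e
  hq : q.degree < e
  hs : s.degree < e
  ht : t.degree < e
  row₁ : ∀ i, (X ^ e + p).eval (a i) * b i + q.eval (a i) = 0
  row₂ : ∀ i, s.eval (a i) * b i + (X ^ e + t).eval (a i) = 0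

variable {r e : ℕ} {a b : Fin r → ℂ} {p q s t : ℂ[X]}

theorem degree_mul_lt_of_lt_of_le {F : Type} [Field F] {m n : ℕ} {p q : F[X]}
    (hp : p.degree < m) (hq : q.degree ≤ n) : (p * q).degree < (m + n : ℕ) := by
  by_cases h0 : p * q = 0
  · rw [h0, degree_zero]; exact WithBot.bot_lt_coe _
  · have hp0 := left_ne_zero_of_mul h0
    have hq0 := right_ne_zero_of_mul h0
    rw [← natDegree_lt_iff_degree_lt h0, natDegree_mul hp0 hq0]
    have := (natDegree_lt_iff_degree_lt hp0).2 hp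
    have := natDegree_le_of_degree_le hq
    omega

theorem degree_X_pow_add_eq {p : ℂ[X]} (hp : p.degree < e) :
    (X ^ e + p).degree = (e : WithBot ℕ) := by
  rw [degree_add_eq_left_of_degree_lt (by rwa [degree_X_pow]), degree_X_pow]

/-- The determinant is `∏ (X - aᵢ)`. -/
theorem IsMonicPair.det_eq (h : IsMonicPair e a b p q s t) (hr : r = 2 * e)
    (ha : Function.Injective a) :
    (X ^ e + p) * (X ^ e + t) - q * s = ∏ i, (X - C (a i)) := by
  have h1 : ((X ^ e + p) * (X ^ e + t)).degree = ((r : ℕ) : WithBot ℕ) := by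
    rw [degree_mul, degree_X_pow_add_eq h.hp, degree_X_pow_add_eq h.ht, hr, two_mul]
    rfl
  have h2 : (q * s).degree < (r : ℕ) := by
    rw [hr, two_mul]
    exact degree_mul_lt_of_lt_of_le h.hq h.hs.le
  have hm : ((X ^ e + p) * (X ^ e + t) - q * s).Monic :=
    ((monic_X_pow_add h.hp).mul (monic_X_pow_add h.ht)).sub_of_left (by rw [h1]; exact h2)
  have hd : ((X ^ e + p) * (X ^ e + t) - q * s).degree = ((r : ℕ) : WithBot ℕ) := by
    rw [degree_sub_eq_left_of_degree_lt (by rw [h1]; exact h2), h1]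
  have hm' : (∏ i, (X - C (a i))).Monic := monic_prod_X_sub_C _ _
  have hd' : (∏ i, (X - C (a i))).degree = ((r : ℕ) : WithBot ℕ) := by
    rw [degree_prod]; simp
  rw [← sub_eq_zero]
  refine eq_zero_of_degree_lt_of_forall_eval_eq_zero ha ?_ fun i => ?_
  · rw [← hd]
    exact degree_sub_lt_left (hd.trans hd'.symm) hm.ne_zero
      (by rw [hm.leadingCoeff, hm'.leadingCoeff])
  · have e1 := h.row₁ i
    have e2 := h.row₂ i
    rw [eval_sub, eval_sub, eval_mul, eval_mul, eval_prod,
      Finset.prod_eq_zero (Finset.mem_univ i) (by simp)]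
    linear_combination (X ^ e + p).eval (a i) * e2 - s.eval (a i) * e1

/-- The value of the matrix at `aᵢ` does not vanish, because its determinant has a simple zero
there. -/
theorem IsMonicPair.column_ne_zero (h : IsMonicPair e a b p q s t) (hr : r = 2 * e)
    (ha : Function.Injective a) (i : Fin r) :
    (X ^ e + p).eval (a i) ≠ 0 ∨ s.eval (a i) ≠ 0 := by
  by_contra! hc
  obtain ⟨h1, h2⟩ := hc
  have h3 : q.eval (a i) = 0 := by have := h.row₁ i; rwa [h1, zero_mul, zero_add] at this
  have h4 : (X ^ e + t).eval (a i) = 0 := by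
    have := h.row₂ i; rwa [h2, zero_mul, zero_add] at this
  have hd : (X - C (a i)) * (X - C (a i)) ∣ (X - C (a i)) *
      ∏ j ∈ Finset.univ.erase i, (X - C (a j)) := by
    rw [Finset.mul_prod_erase _ (fun j => X - C (a j)) (Finset.mem_univ i), ← h.det_eq hr ha]
    exact dvd_sub (mul_dvd_mul (dvd_iff_isRoot.2 h1) (dvd_iff_isRoot.2 h4))
      (mul_dvd_mul (dvd_iff_isRoot.2 h3) (dvd_iff_isRoot.2 h2))
  rw [mul_dvd_mul_iff_left (X_sub_C_ne_zero _), dvd_iff_isRoot, IsRoot.def, eval_prod,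
    Finset.prod_eq_zero_iff] at hd
  obtain ⟨j, hj, hij⟩ := hd
  simp only [eval_sub, eval_X, eval_C, sub_eq_zero] at hij
  exact Finset.ne_of_mem_erase hj (ha hij).symm

theorem IsMonicPair.isElemPair (h : IsMonicPair e a b p q s t) (hr : r = 2 * e)
    (ha : Function.Injective a) (hs : ∀ i, s.eval (a i) ≠ 0) :
    IsElemPair e a (fun i => ![b i, 1])
      (fun i => ![(X ^ e + p).eval (a i) / s.eval (a i), 1])
      (fun j k => ((!![X ^ e + p, q; s, X ^ e + t] : Matrix _ _ ℂ[X]) j k).homogenize e)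
      (fun j k => ((!![X ^ e + t, -q; -s, X ^ e + p] : Matrix _ _ ℂ[X]) j k).homogenize e) := by
  have dP : (X ^ e + p).natDegree ≤ e := natDegree_le_of_degree_le (degree_X_pow_add_eq h.hp).le
  have dT : (X ^ e + t).natDegree ≤ e := natDegree_le_of_degree_le (degree_X_pow_add_eq h.ht).le
  have dq : q.natDegree ≤ e := natDegree_le_of_degree_le h.hq.le
  have ds : s.natDegree ≤ e := natDegree_le_of_degree_le h.hs.le
  have dq' : (-q).natDegree ≤ e := by rwa [natDegree_neg]
  have ds' : (-s).natDegree ≤ e := by rwa [natDegree_neg]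
  have hdet : ((X ^ e + p) * (X ^ e + t) - q * s).homogenize (e + e) =
      ∏ i, (MvPolynomial.X 0 - MvPolynomial.C (a i) * MvPolynomial.X 1) := by
    rw [h.det_eq hr ha]
    have h1 := homogenize_finsetProd (s := Finset.univ) (p := fun i => X - C (a i))
      (n := fun _ => 1) (fun i _ => (natDegree_X_sub_C (a i)).le)
    have h2 : ∑ _i : Fin r, 1 = e + e := by simp; omega
    rw [h2] at h1
    rw [h1]
    refine Finset.prod_congr rfl fun i _ => ?_
    rw [homogenize_sub, homogenize_X one_ne_zero, homogenize_C]
    simp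
  have hrow₁ : ∀ i, q.eval (a i) = -((X ^ e + p).eval (a i) * b i) := fun i => by
    linear_combination h.row₁ i
  have hrow₂ : ∀ i, (X ^ e + t).eval (a i) = -(s.eval (a i) * b i) := fun i => by
    linear_combination h.row₂ i
  refine ⟨fun j k => isHomogeneous_homogenize _, fun j k => isHomogeneous_homogenize _,
    ?_, ?_, ?_, ?_, ?_, ?_⟩
  · intro j l
    fin_cases j <;> fin_cases l <;>
      simp only [Fin.sum_univ_two, Fin.zero_eta, Fin.mk_one, Matrix.of_apply, Matrix.cons_val_zero,
        Matrix.cons_val_one, Matrix.cons_val_fin_one, if_true, one_ne_zero, zero_ne_one, if_false]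
    · rw [← homogenize_mul _ _ dP dT, ← homogenize_mul _ _ dq ds', ← homogenize_add, ← hdet]
      congr 1; ring
    · rw [← homogenize_mul _ _ dP dq', ← homogenize_mul _ _ dq dP, ← homogenize_add,
        ← homogenize_zero (e + e)]
      congr 1; ring
    · rw [← homogenize_mul _ _ ds dT, ← homogenize_mul _ _ dT ds', ← homogenize_add,
        ← homogenize_zero (e + e)]
      congr 1; ring
    · rw [← homogenize_mul _ _ ds dq', ← homogenize_mul _ _ dT dP, ← homogenize_add, ← hdet]
      congr 1; ring
  · intro j l
    fin_cases j <;> fin_cases l <;>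
      simp only [Fin.sum_univ_two, Fin.zero_eta, Fin.mk_one, Matrix.of_apply, Matrix.cons_val_zero,
        Matrix.cons_val_one, Matrix.cons_val_fin_one, if_true, one_ne_zero, zero_ne_one, if_false]
    · rw [← homogenize_mul _ _ dT dP, ← homogenize_mul _ _ dq' ds, ← homogenize_add, ← hdet]
      congr 1; ring
    · rw [← homogenize_mul _ _ dT dq, ← homogenize_mul _ _ dq' dT, ← homogenize_add,
        ← homogenize_zero (e + e)]
      congr 1; ring
    · rw [← homogenize_mul _ _ ds' dP, ← homogenize_mul _ _ dP ds, ← homogenize_add,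
        ← homogenize_zero (e + e)]
      congr 1; ring
    · rw [← homogenize_mul _ _ ds' dq, ← homogenize_mul _ _ dP dT, ← homogenize_add, ← hdet]
      congr 1; ring
  · intro i j
    fin_cases j <;>
      simp only [Fin.sum_univ_two, Fin.zero_eta, Fin.mk_one, Matrix.of_apply, Matrix.cons_val_zero,
        Matrix.cons_val_one, Matrix.cons_val_fin_one, eval_homogenize_one, dP, dq, ds, dT, hrow₁,
        hrow₂] <;> ring
  · intro i j
    have := hs i
    fin_cases j <;>
      simp only [Fin.sum_univ_two, Fin.zero_eta, Fin.mk_one, Matrix.of_apply, Matrix.cons_val_zero,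
        Matrix.cons_val_one, Matrix.cons_val_fin_one, eval_homogenize_one, dP, dq', ds', dT,
        hrow₁, hrow₂, eval_neg] <;> field_simp <;> ring
  · intro i
    have := hs i
    refine ⟨![s.eval (a i), -(s.eval (a i) * b i)], fun h0 => hs i (congrFun h0 0), ?_⟩
    intro j k
    fin_cases j <;> fin_cases k <;>
      simp only [Fin.zero_eta, Fin.mk_one, Matrix.of_apply, Matrix.cons_val_zero,
        Matrix.cons_val_one, Matrix.cons_val_fin_one, eval_homogenize_one, dP, dq, ds, dT,
        hrow₁, hrow₂] <;> field_simp
  · intro i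
    refine ⟨![-s.eval (a i), (X ^ e + p).eval (a i)],
      fun h0 => hs i (neg_eq_zero.1 (congrFun h0 0)), ?_⟩
    intro j k
    fin_cases j <;> fin_cases k <;>
      simp only [Fin.zero_eta, Fin.mk_one, Matrix.of_apply, Matrix.cons_val_zero,
        Matrix.cons_val_one, Matrix.cons_val_fin_one, eval_homogenize_one, dP, dq', ds', dT,
        hrow₁, hrow₂, eval_neg] <;> ring

/-- The linear system for the inverse transformation is unisolvent as well: a solution, multiplied
by the matrix, has more zeros than its degree allows. -/
theorem IsMonicPair.unisolvent (h : IsMonicPair e a b p q s t) (hr : r = 2 * e)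
    (ha : Function.Injective a) {γ : Fin r → Fin 2 → ℂ} {c : Fin r → ℂ}
    (hγ₀ : ∀ i, (X ^ e + p).eval (a i) = c i * γ i 0) (hγ₁ : ∀ i, s.eval (a i) = c i * γ i 1) :
    Unisolvent e a γ := by
  intro q₁ q₂ h1 h2 h3
  have hu₁ : q₁ * (X ^ e + p) + q₂ * s = 0 := by
    refine eq_zero_of_degree_lt_of_forall_eval_eq_zero ha ?_ fun i => ?_
    · rw [hr, two_mul]
      exact (degree_add_le _ _).trans_lt (max_lt
        (degree_mul_lt_of_lt_of_le h1 (degree_X_pow_add_eq h.hp).le)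
        (degree_mul_lt_of_lt_of_le h2 h.hs.le))
    · rw [eval_add, eval_mul, eval_mul, hγ₀, hγ₁]
      linear_combination c i * h3 i
  have hu₂ : q₁ * q + q₂ * (X ^ e + t) = 0 := by
    refine eq_zero_of_degree_lt_of_forall_eval_eq_zero ha ?_ fun i => ?_
    · rw [hr, two_mul]
      exact (degree_add_le _ _).trans_lt (max_lt
        (degree_mul_lt_of_lt_of_le h1 h.hq.le)
        (degree_mul_lt_of_lt_of_le h2 (degree_X_pow_add_eq h.ht).le))
    · have e1 := h.row₁ i
      have e2 := h.row₂ i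
      rw [hγ₀] at e1
      rw [hγ₁] at e2
      rw [eval_add, eval_mul, eval_mul]
      linear_combination q₁.eval (a i) * e1 + q₂.eval (a i) * e2 - c i * b i * h3 i
  have hdet : (X ^ e + p) * (X ^ e + t) - q * s ≠ 0 := by
    rw [h.det_eq hr ha]
    exact (monic_prod_X_sub_C _ _).ne_zero
  constructor
  · refine (mul_eq_zero.1 ?_).resolve_left hdet
    linear_combination (X ^ e + t) * hu₁ - s * hu₂
  · refine (mul_eq_zero.1 ?_).resolve_left hdet
    linear_combination (X ^ e + p) * hu₂ - q * hu₁

/-- Algebraically independent centres admit an elementary transformation, and the centres of the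
inverse transformation are again algebraically independent: they are carried back to the original
ones, with the factors exchanged, by a field automorphism. -/
theorem exists_isElemPair_of_algebraicIndependent (hr : r = 2 * e) {x : Fin r × Fin 2 → ℂ}
    (hx : AlgebraicIndependent ℚ x) :
    ∃ (b' : Fin r → ℂ) (M N : Fin 2 → Fin 2 → MvPolynomial (Fin 2) ℂ) (θ : ℂ ≃+* ℂ),
      IsElemPair e (fun i => x (i, 0)) (fun i => ![x (i, 1), 1]) (fun i => ![b' i, 1]) M N ∧
        (∀ i, θ (b' i) = x (i, 0)) ∧ ∀ i, θ (x (i, 0)) = x (i, 1) := by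
  set a : Fin r → ℂ := fun i => x (i, 0) with ha_def
  set b : Fin r → ℂ := fun i => x (i, 1) with hb_def
  have ha : Function.Injective a := fun i j hij => by
    simpa using hx.injective hij
  set L := IntermediateField.adjoin ℚ (Set.range x)
  have hxL : ∀ k, x k ∈ L := fun k => IntermediateField.subset_adjoin _ _ (Set.mem_range_self k)
  have huni := unisolvent_of_algebraicIndependent hr hx
  have hγL : ∀ i (j : Fin 2), (![x (i, 1), 1] : Fin 2 → ℂ) j ∈ L := by
    intro i j
    fin_cases j
    · exact hxL _
    · exact L.one_mem
  obtain ⟨p, q, hp, hq, hpq, hpqL⟩ := huni.exists_solution_mem L hr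
    (fun i => -(a i ^ e * b i)) (fun i => hxL (i, 0)) hγL
    (fun i => L.neg_mem (L.mul_mem (L.pow_mem (hxL (i, 0)) e) (hxL (i, 1))))
  obtain ⟨s, t, hs, ht, hst, hstL⟩ := huni.exists_solution_mem L hr
    (fun i => -(a i ^ e)) (fun i => hxL (i, 0)) hγL
    (fun i => L.neg_mem (L.pow_mem (hxL (i, 0)) e))
  have hmp : IsMonicPair e a b p q s t := by
    refine ⟨hp, hq, hs, ht, fun i => ?_, fun i => ?_⟩
    · have := hpq i
      simp only [Matrix.cons_val_zero, Matrix.cons_val_one, Matrix.cons_val_fin_one] at this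
      simp only [eval_add, eval_pow, eval_X]
      linear_combination this
    · have := hst i
      simp only [Matrix.cons_val_zero, Matrix.cons_val_one, Matrix.cons_val_fin_one] at this
      simp only [eval_add, eval_pow, eval_X]
      linear_combination this
  -- if the denominator vanishes, then this is `0`, which the automorphism below will exclude
  let b' : Fin r → ℂ := fun i => (X ^ e + p).eval (a i) / s.eval (a i)
  let y : Fin r × Fin 2 → ℂ := fun k => ![b' k.1, a k.1] k.2
  have hyL : ∀ k, y k ∈ L := by
    rintro ⟨i, j⟩
    fin_cases j
    · refine L.div_mem ?_ (hstL _ (hxL (i, 0))).1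
      rw [eval_add, eval_pow, eval_X]
      exact L.add_mem (L.pow_mem (hxL (i, 0)) e) (hpqL _ (hxL (i, 0))).1
    · exact hxL _
  set L' := IntermediateField.adjoin ℚ (Set.range y)
  have hyL' : ∀ k, y k ∈ L' := fun k => IntermediateField.subset_adjoin _ _ (Set.mem_range_self k)
  have haL' : ∀ i, a i ∈ L' := fun i => hyL' (i, 1)
  have hbL' : ∀ i, b' i ∈ L' := fun i => hyL' (i, 0)
  let γ : Fin r → Fin 2 → ℂ := fun i => if s.eval (a i) = 0 then ![1, 0] else ![b' i, 1]
  let c : Fin r → ℂ := fun i => if s.eval (a i) = 0 then (X ^ e + p).eval (a i) else s.eval (a i)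
  have hγ₀ : ∀ i, (X ^ e + p).eval (a i) = c i * γ i 0 := by
    intro i
    by_cases h0 : s.eval (a i) = 0
    · simp only [c, γ, if_pos h0]; simp
    · simp only [c, γ, if_neg h0, b']
      rw [Matrix.cons_val_zero]; field_simp
  have hγ₁ : ∀ i, s.eval (a i) = c i * γ i 1 := by
    intro i
    by_cases h0 : s.eval (a i) = 0
    · simp [c, γ, h0]
    · simp [c, γ, h0]
  have hc0 : ∀ i, c i ≠ 0 := by
    intro i
    by_cases h0 : s.eval (a i) = 0
    · simp only [c, if_pos h0]
      exact (hmp.column_ne_zero hr ha i).resolve_right (not_not.2 h0)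
    · simpa only [c, if_neg h0] using h0
  have hγL' : ∀ i j, γ i j ∈ L' := by
    intro i j
    by_cases h0 : s.eval (a i) = 0
    · simp only [γ, if_pos h0]
      fin_cases j
      · exact L'.one_mem
      · exact L'.zero_mem
    · simp only [γ, if_neg h0]
      fin_cases j
      · exact hbL' i
      · exact L'.one_mem
  have huni' := hmp.unisolvent hr ha hγ₀ hγ₁
  -- the inverse matrix solves the system of the new centres, hence is defined over their field
  have hmem : ∀ q₁ q₂ : ℂ[X], q₁.degree < e → q₂.degree < e →
      (∀ i, q₁.eval (a i) * γ i 0 + q₂.eval (a i) * γ i 1 ∈ L') →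
      ∀ z ∈ L', q₁.eval z ∈ L' ∧ q₂.eval z ∈ L' := by
    intro q₁ q₂ h1 h2 h3 z hz
    obtain ⟨q₁', q₂', h1', h2', h3', h4'⟩ := huni'.exists_solution_mem L' hr _ haL' hγL' h3
    obtain ⟨e1, e2⟩ := huni' (q₁ - q₁') (q₂ - q₂')
      ((degree_sub_le _ _).trans_lt (max_lt h1 h1')) ((degree_sub_le _ _).trans_lt (max_lt h2 h2'))
      fun i => by
        rw [eval_sub, eval_sub]
        linear_combination -h3' i
    rw [sub_eq_zero.1 e1, sub_eq_zero.1 e2]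
    exact h4' z hz
  have hker₁ : ∀ i, (X ^ e + t).eval (a i) * γ i 0 + (-q).eval (a i) * γ i 1 = 0 := by
    intro i
    refine (mul_eq_zero.1 ?_).resolve_left (hc0 i)
    have e1 := hmp.row₁ i
    have e2 := hmp.row₂ i
    rw [eval_neg]
    linear_combination -(X ^ e + t).eval (a i) * hγ₀ i + q.eval (a i) * hγ₁ i +
      (X ^ e + p).eval (a i) * e2 - s.eval (a i) * e1
  have hker₂ : ∀ i, (-s).eval (a i) * γ i 0 + (X ^ e + p).eval (a i) * γ i 1 = 0 := by
    intro i
    rw [eval_neg, hγ₀, hγ₁]; ring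
  have hpow : ∀ i, a i ^ e ∈ L' := fun i => L'.pow_mem (haL' i) e
  have hT := hmem t (-q) ht (by rwa [degree_neg]) fun i => by
    have : t.eval (a i) * γ i 0 + (-q).eval (a i) * γ i 1 = -(a i ^ e * γ i 0) := by
      have := hker₁ i
      rw [eval_add, eval_pow, eval_X] at this
      linear_combination this
    rw [this]
    exact L'.neg_mem (L'.mul_mem (hpow i) (hγL' i 0))
  have hP := hmem (-s) p (by rwa [degree_neg]) hp fun i => by
    have : (-s).eval (a i) * γ i 0 + p.eval (a i) * γ i 1 = -(a i ^ e * γ i 1) := by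
      have := hker₂ i
      rw [eval_add, eval_pow, eval_X] at this
      linear_combination this
    rw [this]
    exact L'.neg_mem (L'.mul_mem (hpow i) (hγL' i 1))
  have hxL' : ∀ k, x k ∈ L' := by
    rintro ⟨i, j⟩
    fin_cases j
    · exact haL' i
    · change b i ∈ L'
      have m1 : q.eval (a i) ∈ L' := by
        have := L'.neg_mem (hT _ (haL' i)).2
        rwa [eval_neg, neg_neg] at this
      have m2 : (X ^ e + t).eval (a i) ∈ L' := by
        rw [eval_add, eval_pow, eval_X]
        exact L'.add_mem (hpow i) (hT _ (haL' i)).1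
      have m3 : s.eval (a i) ∈ L' := by
        have := L'.neg_mem (hP _ (haL' i)).1
        rwa [eval_neg, neg_neg] at this
      have m4 : (X ^ e + p).eval (a i) ∈ L' := by
        rw [eval_add, eval_pow, eval_X]
        exact L'.add_mem (hpow i) (hP _ (haL' i)).2
      rcases hmp.column_ne_zero hr ha i with h0 | h0
      · have : b i = -q.eval (a i) / (X ^ e + p).eval (a i) := by
          rw [eq_div_iff h0]; linear_combination hmp.row₁ i
        rw [this]
        exact L'.div_mem (L'.neg_mem m1) m4
      · have : b i = -(X ^ e + t).eval (a i) / s.eval (a i) := by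
          rw [eq_div_iff h0]; linear_combination hmp.row₂ i
        rw [this]
        exact L'.div_mem (L'.neg_mem m2) m3
  obtain ⟨θ, hθ⟩ := exists_ringEquiv_of_adjoin_eq hx hyL hxL'
  have hs0 : ∀ i, s.eval (a i) ≠ 0 := by
    intro i h0
    have h1 := hθ (i, 0)
    have h2 : y (i, 0) = 0 := by simp [y, b', h0]
    rw [h2, map_zero] at h1
    exact hx.ne_zero (i, 0) h1.symm
  exact ⟨b', _, _, θ, hmp.isElemPair hr ha hs0, fun i => hθ (i, 0), fun i => hθ (i, 1)⟩

end ElementaryPair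

section

open MvPolynomial

/-! ### Irreducible closed sets and curves in products of projective spaces -/

section Irreducible

variable {ι : Type} [DecidableEq ι] {n : ι → ℕ}

theorem IsMultiHom.aeval [Fintype ι] {κ : Type} [DecidableEq κ] {m : κ → ℕ} {F : CoordRing n}
    {d : ι → ℕ} (hF : IsMultiHom F d) {φ : (Σ i, Fin (n i)) → CoordRing m} {D : ι → κ → ℕ}
    (hφ : ∀ s, IsMultiHom (φ s) (D s.1)) :
    IsMultiHom (MvPolynomial.aeval φ F) (∑ i, d i • D i) := by
  rw [aeval_def, eval₂_eq', algebraMap_eq]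
  refine IsMultiHom.sum fun x hx => IsMultiHom.C_mul ?_ _
  have h := IsMultiHom.prod (s := Finset.univ) (fun s _ => (hφ s).pow (x s))
  have : ∑ s, x s • D s.1 = ∑ i, d i • D i := by
    rw [Fintype.sum_sigma]
    refine Finset.sum_congr rfl fun i _ => ?_
    rw [← hF.sum_exponents (mem_support_iff.1 hx) i, Finset.sum_smul]
  rwa [this] at h

theorem isIrreducible_of_forall_multiHom {S : Set (MultiProj n)} (hne : S.Nonempty)
    (h : ∀ (F G : CoordRing n) (d e : ι → ℕ), IsMultiHom F d → IsMultiHom G e →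
      S ⊆ zeroLocus (F * G) → S ⊆ zeroLocus F ∨ S ⊆ zeroLocus G) : IsIrreducible S := by
  refine ⟨hne, ?_⟩
  rintro U V hU hV ⟨x, hxS, hxU⟩ ⟨y, hyS, hyV⟩
  by_contra hcon
  obtain ⟨_, ⟨F, d, hF, rfl⟩, hxF, hFU⟩ :=
    isTopologicalBasis_multiProj.exists_subset_of_mem_open hxU hU
  obtain ⟨_, ⟨G, e, hG, rfl⟩, hyG, hGV⟩ :=
    isTopologicalBasis_multiProj.exists_subset_of_mem_open hyV hV
  have hFG : S ⊆ zeroLocus (F * G) := by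
    intro z hz
    rw [zeroLocus_mul]
    by_contra hz'
    rw [Set.mem_union, not_or] at hz'
    exact hcon ⟨z, hz, hFU hz'.1, hGV hz'.2⟩
  rcases h F G d e hF hG hFG with h1 | h1
  · exact hxF (h1 hxS)
  · exact hyG (h1 hyS)

theorem exists_multiHom_of_not_subset {S Z : Set (MultiProj n)} (hZ : IsClosed Z)
    (h : ¬ S ⊆ Z) : ∃ (F : CoordRing n) (d : ι → ℕ), IsMultiHom F d ∧ Z ⊆ zeroLocus F ∧
      ¬ S ⊆ zeroLocus F := by
  obtain ⟨x, hxS, hxZ⟩ := Set.not_subset.1 h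
  rw [← hZ.closure_eq, mem_closure_iff_forall_multiHom] at hxZ
  push Not at hxZ
  obtain ⟨F, d, hF, hZF, hxF⟩ := hxZ
  exact ⟨F, d, hF, hZF, fun hS => hxF (hS hxS)⟩

/-- The limit at `0` of a polynomial arc whose general points lie in `S` is in the closure
of `S`. -/
theorem mkPt_eval_zero_mem_closure [Fintype ι] {S : Set (MultiProj n)}
    (v : (Σ i, Fin (n i)) → Polynomial ℂ)
    (h0 : ∀ i, (fun j => (v ⟨i, j⟩).eval 0) ≠ 0) {g : Polynomial ℂ} (hg : g ≠ 0)
    (hS : ∀ ε, g.eval ε ≠ 0 →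
      ∃ h : ∀ i, (fun j => (v ⟨i, j⟩).eval ε) ≠ 0, mkPt (fun s => (v s).eval ε) h ∈ S) :
    mkPt (fun s => (v s).eval 0) h0 ∈ closure S := by
  rw [mem_closure_iff_forall_multiHom]
  intro F d hF hSF
  rw [mkPt_mem_zeroLocus hF]
  have hev : ∀ ε, (MvPolynomial.aeval v F).eval ε = eval (fun s => (v s).eval ε) F := by
    intro ε
    have : ((Polynomial.evalRingHom ε).comp (MvPolynomial.aeval v).toRingHom) =
        eval (fun s => (v s).eval ε) := by
      ext <;> simp
    exact DFunLike.congr_fun this F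
  have hz : MvPolynomial.aeval v F * g = 0 := by
    refine Polynomial.funext fun ε => ?_
    rw [Polynomial.eval_mul, Polynomial.eval_zero, hev]
    by_cases hgε : g.eval ε = 0
    · rw [hgε, mul_zero]
    · obtain ⟨h, hS'⟩ := hS ε hgε
      rw [(mkPt_mem_zeroLocus hF _ h).1 (hSF hS'), zero_mul]
  rw [← hev, (mul_eq_zero.1 hz).resolve_right hg, Polynomial.eval_zero]

end Irreducible

theorem topologicalKrullDim_eq_one_of_finite {α : Type*} [TopologicalSpace α] [T1Space α]
    {S : Set α} (hS : IsClosed S) (hirr : IsIrreducible S) (hinf : S.Infinite)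
    (h : ∀ Z, IsClosed Z → Z ⊆ S → Z ≠ S → Z.Finite) : topologicalKrullDim S = 1 := by
  have : Infinite S := hinf.to_subtype
  have : IrreducibleSpace S := isIrreducible_iff_irreducibleSpace.1 hirr
  have hsing : ∀ Z : TopologicalSpace.IrreducibleCloseds S, (Z : Set S) ≠ Set.univ →
      ∃ x, (Z : Set S) = {x} := by
    intro Z hZ
    have hfin : (Subtype.val '' (Z : Set S)).Finite := by
      refine h _ (hS.isClosedEmbedding_subtypeVal.isClosedMap _ Z.isClosed)
        (by rintro _ ⟨x, -, rfl⟩; exact x.2) fun he => hZ ?_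
      rw [← Set.preimage_image_eq (Z : Set S) Subtype.val_injective, he]
      exact Set.eq_univ_of_forall fun x => x.2
    have hfin' : (Z : Set S).Finite := hfin.of_finite_image Subtype.val_injective.injOn
    obtain ⟨x, hx⟩ := Z.isIrreducible.nonempty
    refine ⟨x, ?_⟩
    by_contra hne
    have hcl : IsClosed ((Z : Set S) \ {x}) := (hfin'.subset Set.sdiff_subset).isClosed
    have := (isPreirreducible_iff_isClosed_union_isClosed.1 Z.isIrreducible.isPreirreducible)
      {x} ((Z : Set S) \ {x}) isClosed_singleton hcl
      (by intro y hy; by_cases hyx : y = x <;> simp [hyx, hy])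
    rcases this with h1 | h1
    · exact hne (h1.antisymm (by simpa using hx))
    · exact (h1 hx).2 rfl
  refine le_antisymm ?_ ?_
  · refine Order.krullDim_le_one_iff.2 fun Z => ?_
    by_cases hZ : (Z : Set S) = Set.univ
    · right
      intro W _
      change (W : Set S) ⊆ Z
      rw [hZ]; exact Set.subset_univ _
    · left
      obtain ⟨x, hx⟩ := hsing Z hZ
      intro W hW
      change (Z : Set S) ⊆ W
      have hW' : (W : Set S) ⊆ Z := hW
      rw [hx] at hW' ⊢
      rcases Set.subset_singleton_iff_eq.1 hW' with h1 | h1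
      · exact absurd h1 W.isIrreducible.nonempty.ne_empty
      · exact h1.ge
  · refine Order.one_le_krullDim_iff.2 ?_
    obtain ⟨x⟩ : Nonempty S := inferInstance
    refine ⟨⟨{x}, isIrreducible_singleton, isClosed_singleton⟩,
      ⟨Set.univ, IrreducibleSpace.isIrreducible_univ S, isClosed_univ⟩, ?_⟩
    refine lt_of_le_of_ne (fun _ _ => trivial) fun he => ?_
    have he' : ({x} : Set S) = Set.univ := congrArg TopologicalSpace.IrreducibleCloseds.carrier he
    exact Set.infinite_univ (he' ▸ Set.finite_singleton x)

/-! ### The graph over the complement of the centres -/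

section Graph

variable {r : ℕ}

/-- The index of a homogeneous coordinate of `Y × (ℙ³)^r`. -/
abbrev AmbVar (r : ℕ) : Type :=
  Σ s : Fin 2 ⊕ Fin r, Fin (Sum.elim (fun _ : Fin 2 => 2) (fun _ : Fin r => 4) s)

/-- The coordinate ring of `Y × (ℙ³)^r`. -/
abbrev ARing (r : ℕ) : Type :=
  CoordRing (Sum.elim (fun _ : Fin 2 => 2) (fun _ : Fin r => 4))

/-- A system of values for the homogeneous coordinates of `Y × (ℙ³)^r`, in any ring. -/
def ambVec {A : Type} (v : (Σ _ : Fin 2, Fin 2) → A) (z : Fin r → Fin 4 → A) : AmbVar r → A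
  | ⟨Sum.inl j, k⟩ => v ⟨j, k⟩
  | ⟨Sum.inr i, k⟩ => z i k

/-- The four forms `centreForms`, with values in any `ℂ`-algebra. -/
def centreVec {A : Type} [CommRing A] [Algebra ℂ A] (P : YVec) (v : (Σ _ : Fin 2, Fin 2) → A) :
    Fin 4 → A :=
  ![(algebraMap ℂ A (P ⟨0, 0⟩) * v ⟨0, 1⟩ - algebraMap ℂ A (P ⟨0, 1⟩) * v ⟨0, 0⟩) * v ⟨1, 0⟩,
    (algebraMap ℂ A (P ⟨0, 0⟩) * v ⟨0, 1⟩ - algebraMap ℂ A (P ⟨0, 1⟩) * v ⟨0, 0⟩) * v ⟨1, 1⟩,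
    (algebraMap ℂ A (P ⟨1, 0⟩) * v ⟨1, 1⟩ - algebraMap ℂ A (P ⟨1, 1⟩) * v ⟨1, 0⟩) * v ⟨0, 0⟩,
    (algebraMap ℂ A (P ⟨1, 0⟩) * v ⟨1, 1⟩ - algebraMap ℂ A (P ⟨1, 1⟩) * v ⟨1, 0⟩) * v ⟨0, 1⟩]

/-- Homogeneous coordinates of the point of the graph over the point with coordinates `v`. -/
def graphVec {A : Type} [CommRing A] [Algebra ℂ A] (p : Fin r → Y)
    (v : (Σ _ : Fin 2, Fin 2) → A) : AmbVar r → A :=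
  ambVec v fun i => centreVec (coords (p i)) v

theorem map_centreVec {A B : Type} [CommRing A] [Algebra ℂ A] [CommRing B] [Algebra ℂ B]
    (φ : A →ₐ[ℂ] B) (P : YVec) (v : (Σ _ : Fin 2, Fin 2) → A) (k : Fin 4) :
    φ (centreVec P v k) = centreVec P (fun s => φ (v s)) k := by
  fin_cases k <;> simp [centreVec]

theorem map_graphVec {A B : Type} [CommRing A] [Algebra ℂ A] [CommRing B] [Algebra ℂ B]
    (φ : A →ₐ[ℂ] B) (p : Fin r → Y) (v : (Σ _ : Fin 2, Fin 2) → A) (s : AmbVar r) :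
    φ (graphVec p v s) = graphVec p (fun s => φ (v s)) s := by
  rcases s with ⟨j | i, k⟩
  · rfl
  · exact map_centreVec φ _ v k

theorem isMultiHom_centreVec {κ : Type} [DecidableEq κ] {m : κ → ℕ} (P : YVec)
    {x : (Σ _ : Fin 2, Fin 2) → CoordRing m} {D : Fin 2 → κ → ℕ}
    (h : ∀ s, IsMultiHom (x s) (D s.1)) (k : Fin 4) :
    IsMultiHom (centreVec P x k) (D 0 + D 1) := by
  have h0 : ∀ j k₁ k₂, IsMultiHom (algebraMap ℂ (CoordRing m) (P ⟨j, 0⟩) * x ⟨j, k₁⟩ -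
      algebraMap ℂ (CoordRing m) (P ⟨j, 1⟩) * x ⟨j, k₂⟩) (D j) := fun j k₁ k₂ =>
    ((h ⟨j, k₁⟩).C_mul _).sub ((h ⟨j, k₂⟩).C_mul _)
  have h1 : ∀ k', IsMultiHom ((algebraMap ℂ (CoordRing m) (P ⟨1, 0⟩) * x ⟨1, 1⟩ -
      algebraMap ℂ (CoordRing m) (P ⟨1, 1⟩) * x ⟨1, 0⟩) * x ⟨0, k'⟩) (D 0 + D 1) := fun k' => by
    rw [add_comm]; exact (h0 1 1 0).mul (h ⟨0, k'⟩)
  fin_cases k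
  · exact (h0 0 1 0).mul (h ⟨1, 0⟩)
  · exact (h0 0 1 0).mul (h ⟨1, 1⟩)
  · exact h1 0
  · exact h1 1

theorem centreForms_eq (P y : Y) : centreForms P y = centreVec (coords P) (coords y) := rfl

theorem centreVec_scale (P : YVec) (c : Fin 2 → ℂ) (v : YVec) :
    centreVec P (fun s => c s.1 * v s) = (c 0 * c 1) • centreVec P v := by
  funext k
  fin_cases k <;> simp [centreVec] <;> ring

theorem centreVec_eq_zero_iff (P : Y) {v : YVec} (hv : ∀ i, (fun j => v ⟨i, j⟩) ≠ 0) :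
    centreVec (coords P) v = 0 ↔ mkPt v hv = P := by
  have e : ∀ i, eval v (minor P i 0 1) = algebraMap ℂ ℂ (coords P ⟨i, 0⟩) * v ⟨i, 1⟩ -
      algebraMap ℂ ℂ (coords P ⟨i, 1⟩) * v ⟨i, 0⟩ := fun i => eval_minor P i v
  constructor
  · intro h
    have hm : ∀ i, eval v (minor P i 0 1) = 0 := by
      have key : ∀ (c : ℂ) (i : Fin 2), (∀ k, c * v ⟨i, k⟩ = 0) → c = 0 := by
        intro c i hc
        obtain ⟨k, hk⟩ := Function.ne_iff.1 (hv i)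
        exact (mul_eq_zero.1 (hc k)).resolve_right hk
      intro i
      rw [e]
      fin_cases i
      · refine key _ 1 fun k => ?_
        fin_cases k
        · exact congrFun h 0
        · exact congrFun h 1
      · refine key _ 0 fun k => ?_
        fin_cases k
        · exact congrFun h 2
        · exact congrFun h 3
    refine (eq_of_mem_zeroLocus_minor fun i j k => ?_).symm
    rw [mkPt_mem_zeroLocus (isMultiHom_minor P i j k)]
    have := hm i
    rw [eval_minor] at this
    fin_cases j <;> fin_cases k
    · simp [minor]
    · simpa [minor] using this
    · simp only [minor, map_sub, map_mul, eval_C, eval_X, Fin.zero_eta, Fin.mk_one]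
      linear_combination -this
    · simp [minor]
  · intro h
    have h0 := eval_minor_eq_zero_of_mkPt_eq h 0
    have h1 := eval_minor_eq_zero_of_mkPt_eq h 1
    rw [e] at h0 h1
    funext k
    fin_cases k <;> simp only [centreVec, h0, h1] <;> simp

theorem mk_eq_mk_of_minors {m : ℕ} {u v : Fin m → ℂ} (hu : u ≠ 0) (hv : v ≠ 0)
    (h : ∀ j k, u j * v k = u k * v j) :
    Projectivization.mk ℂ u hu = Projectivization.mk ℂ v hv := by
  obtain ⟨j, hj⟩ := Function.ne_iff.1 hv
  have hj' : v j ≠ 0 := hj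
  refine (Projectivization.mk_eq_mk_iff' ℂ _ _ _ _).2 ⟨u j / v j, ?_⟩
  funext k
  simp only [Pi.smul_apply, smul_eq_mul]
  field_simp
  linear_combination h j k

theorem mkPt_graphVec_mem_graph (p : Fin r → Y) {v : YVec}
    (h : ∀ i, (fun j => graphVec p v ⟨i, j⟩) ≠ 0) : mkPt (graphVec p v) h ∈ graph p := by
  intro i
  obtain ⟨c, hc, hcv⟩ := exists_coords_mkPt v fun i => h (Sum.inl i)
  have e : centreForms (p i) (toY (mkPt (graphVec p v) h)) =
      (c 0 * c 1) • centreVec (coords (p i)) v := by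
    rw [centreForms_eq, ← centreVec_scale, ← hcv]
    rfl
  have hne : centreForms (p i) (toY (mkPt (graphVec p v) h)) ≠ 0 := by
    rw [e]
    exact smul_ne_zero (mul_ne_zero (hc 0) (hc 1)) (h (Sum.inr i))
  refine ⟨hne, mk_eq_mk_of_minors (m := 4) _ _ fun j k => ?_⟩
  rw [e]
  change centreVec _ _ _ * _ = centreVec _ _ _ * _
  simp only [Pi.smul_apply, smul_eq_mul]
  ring

theorem eq_mkPt_of_mem_graph {p : Fin r → Y} {w : Ambient r} (hw : w ∈ graph p) :
    ∃ h, w = mkPt (graphVec p (coords (toY w))) h := by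
  refine ⟨?_, ?_⟩
  · rintro (j | i)
    · exact coords_ne_zero (toY w) j
    · exact (hw i).1
  · funext s
    rcases s with j | i
    · exact (w (Sum.inl j)).mk_rep.symm
    · exact (hw i).2

theorem toY_ne_of_mem_graph {p : Fin r → Y} {w : Ambient r} (hw : w ∈ graph p) (i : Fin r) :
    toY w ≠ p i := by
  obtain ⟨h, -⟩ := hw i
  rw [centreForms_eq, Ne, centreVec_eq_zero_iff _ (coords_ne_zero _), mkPt_coords] at h
  exact h

theorem exists_mem_graph {p : Fin r → Y} {y : Y} (hy : ∀ i, y ≠ p i) :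
    ∃ w ∈ graph p, toY w = y := by
  have h : ∀ s, (fun j => graphVec p (coords y) ⟨s, j⟩) ≠ 0 := by
    rintro (j | i)
    · exact coords_ne_zero y j
    · change centreVec (coords (p i)) (coords y) ≠ 0
      rw [Ne, centreVec_eq_zero_iff _ (coords_ne_zero _), mkPt_coords]
      exact hy i
  exact ⟨_, mkPt_graphVec_mem_graph p h, mkPt_coords y⟩

theorem eq_of_mem_graph {p : Fin r → Y} {w w' : Ambient r} (hw : w ∈ graph p)
    (hw' : w' ∈ graph p) (h : toY w = toY w') : w = w' := by
  funext s
  rcases s with j | i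
  · exact congrFun h j
  · obtain ⟨h1, h2⟩ := hw i
    obtain ⟨h3, h4⟩ := hw' i
    rw [h2, h4]
    congr 1
    rw [h]

/-- The pullback of forms along the rational map from `Y` to `Y × (ℙ³)^r`. -/
def graphPull (p : Fin r → Y) : ARing r →ₐ[ℂ] YRing := aeval (graphVec p X)

theorem eval_graphPull (p : Fin r → Y) (v : YVec) (F : ARing r) :
    eval v (graphPull p F) = eval (graphVec p v) F := by
  have h := comp_aeval (aeval (R := ℂ) v) (f := graphVec p (A := YRing) X)
  have h2 := DFunLike.congr_fun h F
  simp only [AlgHom.comp_apply, map_graphVec, aeval_X] at h2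
  rw [aeval_eq_eval, aeval_eq_eval] at h2
  exact h2

theorem isMultiHom_graphPull (p : Fin r → Y) {F : ARing r} {d : Fin 2 ⊕ Fin r → ℕ}
    (hF : IsMultiHom F d) : ∃ e, IsMultiHom (graphPull p F) e := by
  refine ⟨_, hF.aeval (D := Sum.elim (fun j => Pi.single j 1)
    fun _ => Pi.single 0 1 + Pi.single 1 1) ?_⟩
  rintro ⟨j | i, k⟩
  · exact isMultiHom_X (n := fun _ : Fin 2 => 2) ⟨j, k⟩
  · exact isMultiHom_centreVec _ (D := fun j => Pi.single j 1)
      (fun s => isMultiHom_X (n := fun _ : Fin 2 => 2) s) k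

theorem mem_zeroLocus_iff_of_mem_graph {p : Fin r → Y} {w : Ambient r} (hw : w ∈ graph p)
    {F : ARing r} {d : Fin 2 ⊕ Fin r → ℕ} (hF : IsMultiHom F d) :
    w ∈ zeroLocus F ↔ toY w ∈ zeroLocus (graphPull p F) := by
  obtain ⟨h, e⟩ := eq_mkPt_of_mem_graph hw
  have h1 := mkPt_mem_zeroLocus hF _ h
  rw [← e, ← eval_graphPull] at h1
  exact h1

theorem continuous_toY : Continuous (toY : Ambient r → Y) := by
  refine continuous_generateFrom_iff.2 ?_
  rintro _ ⟨f, d, hf, rfl⟩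
  rw [Set.preimage_compl, isOpen_compl_iff]
  have h : toY ⁻¹' zeroLocus f =
      zeroLocus (rename (fun s => ⟨Sum.inl s.1, s.2⟩ : _ → AmbVar r) f) := by
    ext w
    simp only [zeroLocus, Set.mem_preimage, Set.mem_ofPred_eq, eval_rename]
    rfl
  rw [h, rename_eq_aeval]
  refine (hf.aeval (D := fun j => Pi.single (Sum.inl j) 1) fun s => ?_).isClosed_zeroLocus
  exact isMultiHom_X (n := Sum.elim (fun _ : Fin 2 => 2) (fun _ : Fin r => 4)) ⟨Sum.inl s.1, s.2⟩

/-- A relation between forms that holds on the graph holds on the blowup. -/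
theorem eval_eq_zero_of_mem_blowup {p : Fin r → Y} {w : Ambient r} (hw : w ∈ Blowup p)
    {F : ARing r} {d : Fin 2 ⊕ Fin r → ℕ} (hF : IsMultiHom F d) (h : graphPull p F = 0) :
    eval (coords w) F = 0 := by
  refine mem_closure_iff_forall_multiHom.1 hw F d hF fun w' hw' => ?_
  rw [mem_zeroLocus_iff_of_mem_graph hw' hF, h]
  simp [zeroLocus]

/-- The coordinates of `Y`, as elements of the coordinate ring of `Y × (ℙ³)^r`. -/
def baseVar (r : ℕ) (s : Σ _ : Fin 2, Fin 2) : ARing r := X ⟨Sum.inl s.1, s.2⟩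

/-- The coordinates of the `i`-th factor `ℙ³`. -/
def excVar (i : Fin r) (k : Fin 4) : ARing r := X ⟨Sum.inr i, k⟩

theorem isMultiHom_baseVar (s : Σ _ : Fin 2, Fin 2) :
    IsMultiHom (baseVar r s) (Pi.single (Sum.inl s.1) 1) :=
  isMultiHom_X (n := Sum.elim (fun _ : Fin 2 => 2) (fun _ : Fin r => 4)) ⟨Sum.inl s.1, s.2⟩

theorem isMultiHom_excVar (i : Fin r) (k : Fin 4) :
    IsMultiHom (excVar i k) (Pi.single (Sum.inr i) 1) :=
  isMultiHom_X (n := Sum.elim (fun _ : Fin 2 => 2) (fun _ : Fin r => 4)) ⟨Sum.inr i, k⟩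

theorem graphPull_baseVar (p : Fin r → Y) (s : Σ _ : Fin 2, Fin 2) :
    graphPull p (baseVar r s) = X s := aeval_X _ _

theorem graphPull_excVar (p : Fin r → Y) (i : Fin r) (k : Fin 4) :
    graphPull p (excVar i k) = centreVec (coords (p i)) X k := aeval_X _ _

theorem inr_eq_of_mem_blowup {p : Fin r → Y} {w : Ambient r} (hw : w ∈ Blowup p) {i : Fin r}
    (hi : toY w ≠ p i) : ∃ h : centreForms (p i) (toY w) ≠ 0,
      w (Sum.inr i) = Projectivization.mk ℂ (centreForms (p i) (toY w)) h := by
  have h : centreForms (p i) (toY w) ≠ 0 := by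
    rwa [centreForms_eq, Ne, centreVec_eq_zero_iff _ (coords_ne_zero _), mkPt_coords]
  refine ⟨h, ?_⟩
  rw [← (w (Sum.inr i)).mk_rep]
  refine mk_eq_mk_of_minors (m := 4) _ _ fun j k => ?_
  have hm : ∀ k', IsMultiHom (centreVec (coords (p i)) (baseVar r) k')
      (Pi.single (Sum.inl 0) 1 + Pi.single (Sum.inl 1) 1) := fun k' =>
    isMultiHom_centreVec _ (D := fun j => Pi.single (Sum.inl j) 1) isMultiHom_baseVar k'
  have hg : ∀ k', graphPull p (centreVec (coords (p i)) (baseVar r) k') =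
      centreVec (coords (p i)) X k' := fun k' => by
    rw [map_centreVec]; simp only [graphPull_baseVar]
  have := eval_eq_zero_of_mem_blowup hw
    (F := excVar i j * centreVec (coords (p i)) (baseVar r) k -
      excVar i k * centreVec (coords (p i)) (baseVar r) j)
    (((isMultiHom_excVar i j).mul (hm k)).sub ((isMultiHom_excVar i k).mul (hm j))) (by
      rw [map_sub, map_mul, map_mul, hg, hg, graphPull_excVar, graphPull_excVar]; ring)
  have he : ∀ k', eval (coords w) (centreVec (coords (p i)) (baseVar r) k') =
      centreForms (p i) (toY w) k' := by
    intro k'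
    rw [← aeval_eq_eval, map_centreVec]
    simp only [baseVar, aeval_X]
    rfl
  rw [map_sub, map_mul, map_mul, he, he, sub_eq_zero] at this
  simp only [excVar, eval_X] at this
  exact this

theorem mem_graph_of_mem_blowup {p : Fin r → Y} {w : Ambient r} (hw : w ∈ Blowup p)
    (h : ∀ i, toY w ≠ p i) : w ∈ graph p := fun i => inr_eq_of_mem_blowup hw (h i)

end Graph

/-! ### The exceptional curves -/

section Exceptional

variable {r : ℕ}

/-- Homogeneous coordinates of the point with parameters `[s : t]` of the exceptional curve over
`p i`. -/
def excVec {A : Type} [CommRing A] [Algebra ℂ A] (p : Fin r → Y) (i : Fin r) (s t : A) :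
    AmbVar r → A :=
  ambVec (fun x => algebraMap ℂ A (coords (p i) x)) fun j =>
    if j = i then
      ![s * algebraMap ℂ A (coords (p i) ⟨1, 0⟩), s * algebraMap ℂ A (coords (p i) ⟨1, 1⟩),
        t * algebraMap ℂ A (coords (p i) ⟨0, 0⟩), t * algebraMap ℂ A (coords (p i) ⟨0, 1⟩)]
    else fun k => algebraMap ℂ A (centreVec (coords (p j)) (coords (p i)) k)

theorem map_excVec {A B : Type} [CommRing A] [Algebra ℂ A] [CommRing B] [Algebra ℂ B]
    (φ : A →ₐ[ℂ] B) (p : Fin r → Y) (i : Fin r) (s t : A) (x : AmbVar r) :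
    φ (excVec p i s t x) = excVec p i (φ s) (φ t) x := by
  rcases x with ⟨j | j, k⟩
  · exact φ.commutes _
  · change φ ((if j = i then _ else _ : Fin 4 → A) k) = (if j = i then _ else _ : Fin 4 → B) k
    split_ifs
    · change Fin 4 at k
      fin_cases k <;> simp
    · exact φ.commutes _

theorem excVec_inr_self {A : Type} [CommRing A] [Algebra ℂ A] (p : Fin r → Y) (i : Fin r)
    (s t : A) (k : Fin 4) : excVec p i s t ⟨Sum.inr i, k⟩ =
      ![s * algebraMap ℂ A (coords (p i) ⟨1, 0⟩), s * algebraMap ℂ A (coords (p i) ⟨1, 1⟩),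
        t * algebraMap ℂ A (coords (p i) ⟨0, 0⟩), t * algebraMap ℂ A (coords (p i) ⟨0, 1⟩)] k := by
  change (if i = i then _ else _ : Fin 4 → A) k = _
  rw [if_pos rfl]

theorem excVec_inr_of_ne {A : Type} [CommRing A] [Algebra ℂ A] (p : Fin r → Y) {i j : Fin r}
    (hj : j ≠ i) (s t : A) (k : Fin 4) : excVec p i s t ⟨Sum.inr j, k⟩ =
      algebraMap ℂ A (centreVec (coords (p j)) (coords (p i)) k) := by
  change (if j = i then _ else _ : Fin 4 → A) k = _
  rw [if_neg hj]

theorem excVec_ne_zero {p : Fin r → Y} (hp : Function.Injective p) (i : Fin r) {s t : ℂ}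
    (h : s ≠ 0 ∨ t ≠ 0) (x : Fin 2 ⊕ Fin r) : (fun k => excVec p i s t ⟨x, k⟩) ≠ 0 := by
  rcases x with j | j
  · exact coords_ne_zero (p i) j
  · by_cases hj : j = i
    · subst hj
      intro h0
      have h1 : ∀ k : Fin 4, excVec p j s t ⟨Sum.inr j, k⟩ = 0 := fun k => congrFun h0 k
      simp only [excVec_inr_self] at h1
      rcases h with hs | ht
      · refine coords_ne_zero (p j) 1 (funext fun k => ?_)
        fin_cases k
        · simpa [hs] using h1 0
        · simpa [hs] using h1 1
      · refine coords_ne_zero (p j) 0 (funext fun k => ?_)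
        fin_cases k
        · simpa [ht] using h1 2
        · simpa [ht] using h1 3
    · intro h0
      have h1 : ∀ k : Fin 4, excVec p i s t ⟨Sum.inr j, k⟩ = 0 := fun k => congrFun h0 k
      simp only [excVec_inr_of_ne p hj] at h1
      have h2 : centreVec (coords (p j)) (coords (p i)) = 0 := funext h1
      rw [centreVec_eq_zero_iff _ (coords_ne_zero _), mkPt_coords] at h2
      exact hj (hp h2).symm

/-- The point with parameters `[s : t]` of the exceptional curve over `p i`. -/
def excPt {p : Fin r → Y} (hp : Function.Injective p) (i : Fin r) (s t : ℂ)
    (h : s ≠ 0 ∨ t ≠ 0) : Ambient r := mkPt (excVec p i s t) (excVec_ne_zero hp i h)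

theorem toY_excPt {p : Fin r → Y} (hp : Function.Injective p) (i : Fin r) {s t : ℂ}
    (h : s ≠ 0 ∨ t ≠ 0) : toY (excPt hp i s t h) = p i := mkPt_coords (p i)

theorem exists_smul_of_det_eq_zero {u v : Fin 2 → ℂ} (hv : v ≠ 0)
    (h : u 0 * v 1 = u 1 * v 0) : ∃ s, ∀ k, u k = s * v k := by
  by_cases h0 : v 0 = 0
  · have h1 : v 1 ≠ 0 := fun h1 => hv (funext fun k => by fin_cases k <;> assumption)
    have hu : u 0 = 0 := by simpa [h0, h1] using h
    refine ⟨u 1 / v 1, fun k => ?_⟩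
    fin_cases k
    · simp [h0, hu]
    · simp [h1]
  · refine ⟨u 0 / v 0, fun k => ?_⟩
    fin_cases k
    · simp [h0]
    · change u 1 = _ * v 1
      field_simp
      linear_combination -h

theorem exists_det_eq_one {u : Fin 2 → ℂ} (hu : u ≠ 0) :
    ∃ v : Fin 2 → ℂ, u 0 * v 1 - u 1 * v 0 = 1 := by
  by_cases h0 : u 0 = 0
  · have h1 : u 1 ≠ 0 := fun h1 => hu (funext fun k => by fin_cases k <;> assumption)
    exact ⟨![-(u 1)⁻¹, 0], by simp [h1]⟩
  · exact ⟨![0, (u 0)⁻¹], by simp [h0]⟩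

theorem exists_eq_excPt {p : Fin r → Y} (hp : Function.Injective p) {i : Fin r} {w : Ambient r}
    (hw : w ∈ exceptional p i) : ∃ s t h, w = excPt hp i s t h := by
  obtain ⟨hwB, hwY⟩ := hw
  have r1 := eval_eq_zero_of_mem_blowup hwB
    (F := excVar i 0 * baseVar r ⟨1, 1⟩ - excVar i 1 * baseVar r ⟨1, 0⟩)
    (((isMultiHom_excVar i 0).mul (isMultiHom_baseVar ⟨1, 1⟩)).sub
      ((isMultiHom_excVar i 1).mul (isMultiHom_baseVar ⟨1, 0⟩))) (by
      simp only [map_sub, map_mul, graphPull_excVar, graphPull_baseVar, centreVec]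
      simp; ring)
  have r2 := eval_eq_zero_of_mem_blowup hwB
    (F := excVar i 2 * baseVar r ⟨0, 1⟩ - excVar i 3 * baseVar r ⟨0, 0⟩)
    (((isMultiHom_excVar i 2).mul (isMultiHom_baseVar ⟨0, 1⟩)).sub
      ((isMultiHom_excVar i 3).mul (isMultiHom_baseVar ⟨0, 0⟩))) (by
      simp only [map_sub, map_mul, graphPull_excVar, graphPull_baseVar, centreVec]
      simp; ring)
  simp only [map_sub, map_mul, excVar, baseVar, eval_X, sub_eq_zero] at r1 r2
  obtain ⟨s, hs⟩ := exists_smul_of_det_eq_zero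
    (u := ![coords w ⟨Sum.inr i, (0 : Fin 4)⟩, coords w ⟨Sum.inr i, (1 : Fin 4)⟩])
    (coords_ne_zero (p i) 1) (by rw [← hwY]; exact r1)
  obtain ⟨t, ht⟩ := exists_smul_of_det_eq_zero
    (u := ![coords w ⟨Sum.inr i, (2 : Fin 4)⟩, coords w ⟨Sum.inr i, (3 : Fin 4)⟩])
    (coords_ne_zero (p i) 0) (by rw [← hwY]; exact r2)
  have hrep : ∀ k : Fin 4, coords w ⟨Sum.inr i, k⟩ = excVec p i s t ⟨Sum.inr i, k⟩ := by
    intro k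
    rw [excVec_inr_self]
    fin_cases k
    · exact hs 0
    · exact hs 1
    · exact ht 0
    · exact ht 1
  have hst : s ≠ 0 ∨ t ≠ 0 := by
    by_contra! hc
    refine coords_ne_zero w (Sum.inr i) (funext fun k =>
      (hrep k).trans ((excVec_inr_self p i s t k).trans ?_))
    rw [hc.1, hc.2]
    change Fin 4 at k
    fin_cases k <;> simp <;> rfl
  refine ⟨s, t, hst, ?_⟩
  funext x
  rcases x with j | j
  · have := congrFun (toY_excPt hp i hst) j
    exact (congrFun hwY j).trans this.symm
  · rw [← (w (Sum.inr j)).mk_rep]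
    refine mk_eq_mk_of_minors (m := 4) _ _ fun k l => ?_
    by_cases hj : j = i
    · subst hj
      have h1 := hrep k
      have h2 := hrep l
      change coords w ⟨Sum.inr j, k⟩ * excVec p j s t ⟨Sum.inr j, l⟩ =
        coords w ⟨Sum.inr j, l⟩ * excVec p j s t ⟨Sum.inr j, k⟩
      rw [h1, h2]; ring
    · obtain ⟨h0, h1⟩ := inr_eq_of_mem_blowup hwB (i := j)
        (by rw [hwY]; exact fun h => hj (hp h).symm)
      obtain ⟨c, hc⟩ := Projectivization.exists_smul_eq_mk_rep ℂ _ h0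
      rw [← h1] at hc
      have h2 : ∀ k : Fin 4, (w (Sum.inr j)).rep k = c * excVec p i s t ⟨Sum.inr j, k⟩ := by
        intro k
        rw [excVec_inr_of_ne p hj]
        refine (congrFun hc k).symm.trans ?_
        rw [hwY]
        rfl
      change (w (Sum.inr j)).rep k * excVec p i s t ⟨Sum.inr j, l⟩ =
        (w (Sum.inr j)).rep l * excVec p i s t ⟨Sum.inr j, k⟩
      rw [h2, h2]; ring

/-- Every direction at the centre `p i` is the limit of an arc on `Y`. -/
theorem excPt_mem {p : Fin r → Y} (hp : Function.Injective p) (i : Fin r) {s t : ℂ}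
    (h : s ≠ 0 ∨ t ≠ 0) : excPt hp i s t h ∈ exceptional p i := by
  refine ⟨?_, toY_excPt hp i h⟩
  have hdual : ∀ j, ∃ u : Fin 2 → ℂ, coords (p i) ⟨j, 0⟩ * u 1 - coords (p i) ⟨j, 1⟩ * u 0 = 1 :=
    fun j => exists_det_eq_one (coords_ne_zero (p i) j)
  choose u hu using hdual
  let a : (Σ _ : Fin 2, Fin 2) → Polynomial ℂ := fun x =>
    Polynomial.C (coords (p i) x) +
      Polynomial.X * Polynomial.C ((![s, t] : Fin 2 → ℂ) x.1 * u x.1 x.2)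
  let z : Fin r → Fin 4 → Polynomial ℂ := fun j =>
    if j = i then ![Polynomial.C s * a ⟨1, 0⟩, Polynomial.C s * a ⟨1, 1⟩,
      Polynomial.C t * a ⟨0, 0⟩, Polynomial.C t * a ⟨0, 1⟩] else centreVec (coords (p j)) a
  have ha : ∀ ε x, (a x).eval ε = coords (p i) x + ε * ((![s, t] : Fin 2 → ℂ) x.1 * u x.1 x.2) := by
    intro ε x; simp [a]
  have hz : ∀ ε j, j ≠ i → ∀ k, (z j k).eval ε =
      centreVec (coords (p j)) (fun x => (a x).eval ε) k := by
    intro ε j hj k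
    simp only [z, if_neg hj]
    exact map_centreVec (Polynomial.aeval (R := ℂ) ε) _ _ _
  have hz' : ∀ ε (k : Fin 4), (z i k).eval ε = (![s * (a ⟨1, 0⟩).eval ε, s * (a ⟨1, 1⟩).eval ε,
      t * (a ⟨0, 0⟩).eval ε, t * (a ⟨0, 1⟩).eval ε] : Fin 4 → ℂ) k := by
    intro ε k
    simp only [z, if_pos rfl]
    fin_cases k <;> simp
  have e0 : (fun x => (ambVec a z x).eval 0) = excVec p i s t := by
    funext x
    rcases x with ⟨j | j, k⟩
    · change (a ⟨j, k⟩).eval 0 = coords (p i) ⟨j, k⟩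
      rw [ha]; ring
    · have ha0 : (fun x => (a x).eval 0) = coords (p i) := by
        funext x; rw [ha]; ring
      suffices h : ∀ k : Fin 4, (z j k).eval 0 = excVec p i s t ⟨Sum.inr j, k⟩ from h k
      intro k
      by_cases hj : j = i
      · subst hj
        rw [hz', excVec_inr_self]
        simp only [ha, zero_mul, add_zero]
        rfl
      · rw [hz _ _ hj, ha0, excVec_inr_of_ne p hj]
        rfl
  have hex : ∀ j, ∃ k : Fin 4, j ≠ i → (z j k).eval 0 ≠ 0 := by
    intro j
    by_cases hj : j = i
    · exact ⟨0, fun h => absurd hj h⟩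
    · obtain ⟨k, hk⟩ := Function.ne_iff.1 (excVec_ne_zero hp i h (Sum.inr j))
      refine ⟨k, fun _ => ?_⟩
      rw [← e0] at hk
      exact hk
  choose κ hκ using hex
  have hg : Polynomial.X * ∏ j ∈ Finset.univ.erase i, z j (κ j) ≠ 0 := by
    refine mul_ne_zero Polynomial.X_ne_zero (Finset.prod_ne_zero_iff.2 fun j hj h0 => ?_)
    refine hκ j (Finset.ne_of_mem_erase hj) ?_
    rw [h0, Polynomial.eval_zero]
  have key := mkPt_eval_zero_mem_closure (S := graph p) (ambVec a z)
    (fun x => by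
      have := excVec_ne_zero hp i h x
      rw [← e0] at this
      exact this) hg (fun ε hε => by
    rw [Polynomial.eval_mul, Polynomial.eval_X, Polynomial.eval_prod] at hε
    have hε0 : ε ≠ 0 := left_ne_zero_of_mul hε
    have hεj := Finset.prod_ne_zero_iff.1 (right_ne_zero_of_mul hε)
    set v : YVec := fun x => (a x).eval ε with hv
    have hv' : ∀ x, v x = coords (p i) x + ε * ((![s, t] : Fin 2 → ℂ) x.1 * u x.1 x.2) := ha ε
    have hvne : ∀ j, (fun k => v ⟨j, k⟩) ≠ 0 := by
      intro j h0
      have h1 := congrFun h0 0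
      have h2 := congrFun h0 1
      simp only [hv', Pi.zero_apply] at h1 h2
      have := hu j
      refine one_ne_zero (α := ℂ) ?_
      rw [← hu j]
      linear_combination h1 * u j 1 - h2 * u j 0
    -- the values of the forms of the centre `p i` are divisible by the parameter
    have hci : ∀ k : Fin 4, centreVec (coords (p i)) v k = ε * (z i k).eval ε := by
      intro k
      have l0 : coords (p i) ⟨0, 0⟩ * v ⟨0, 1⟩ - coords (p i) ⟨0, 1⟩ * v ⟨0, 0⟩ = ε * s := by
        rw [hv', hv']
        simp only [Matrix.cons_val_zero]
        linear_combination ε * s * hu 0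
      have l1 : coords (p i) ⟨1, 0⟩ * v ⟨1, 1⟩ - coords (p i) ⟨1, 1⟩ * v ⟨1, 0⟩ = ε * t := by
        rw [hv', hv']
        simp only [Matrix.cons_val_one, Matrix.cons_val_fin_one]
        linear_combination ε * t * hu 1
      rw [hz']
      simp only [centreVec, Algebra.algebraMap_self, RingHom.id_apply, l0, l1]
      fin_cases k
      · exact mul_assoc ε s _
      · exact mul_assoc ε s _
      · exact mul_assoc ε t _
      · exact mul_assoc ε t _
    have hzi : ∃ k : Fin 4, (z i k).eval ε ≠ 0 := by
      by_contra! hc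
      simp only [hz'] at hc
      rcases h with hs | ht
      · refine hvne 1 (funext fun k => ?_)
        fin_cases k
        · simpa [hs] using hc 0
        · simpa [hs] using hc 1
      · refine hvne 0 (funext fun k => ?_)
        fin_cases k
        · simpa [ht] using hc 2
        · simpa [ht] using hc 3
    have hgr : ∀ x, (fun k => graphVec p v ⟨x, k⟩) ≠ 0 := by
      rintro (j | j)
      · exact hvne j
      · change centreVec (coords (p j)) v ≠ 0
        by_cases hj : j = i
        · subst hj
          obtain ⟨k, hk⟩ := hzi
          exact Function.ne_iff.2 ⟨k, by rw [hci]; exact mul_ne_zero hε0 hk⟩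
        · refine Function.ne_iff.2 ⟨κ j, ?_⟩
          rw [← hz ε j hj]
          exact hεj j (Finset.mem_erase.2 ⟨hj, Finset.mem_univ j⟩)
    have hne : ∀ x, (fun k => (ambVec a z ⟨x, k⟩).eval ε) ≠ 0 := by
      rintro (j | j)
      · exact hvne j
      · by_cases hj : j = i
        · subst hj
          exact Function.ne_iff.2 hzi
        · refine Function.ne_iff.2 ⟨κ j, ?_⟩
          exact hεj j (Finset.mem_erase.2 ⟨hj, Finset.mem_univ j⟩)
    refine ⟨hne, ?_⟩
    have e1 : mkPt (fun x => (ambVec a z x).eval ε) hne = mkPt (graphVec p v) hgr := by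
      funext x
      rcases x with j | j
      · rfl
      · refine mk_eq_mk_of_minors (m := 4) _ _ fun k l => ?_
        change (z j k).eval ε * centreVec (coords (p j)) v l =
          (z j l).eval ε * centreVec (coords (p j)) v k
        by_cases hj : j = i
        · subst hj
          rw [hci, hci]; ring
        · rw [hz ε j hj, hz ε j hj]; ring
    rw [e1]
    exact mkPt_graphVec_mem_graph p hgr)
  have e2 : excPt hp i s t h = mkPt (fun x => (ambVec a z x).eval 0) (fun x => by
      have := excVec_ne_zero hp i h x
      rw [← e0] at this
      exact this) := by
    unfold excPt
    congr 1
    exact e0.symm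
  rw [e2]
  exact key

/-- The restriction of forms to the exceptional curve over `p i`. -/
def excPull (p : Fin r → Y) (i : Fin r) : ARing r →ₐ[ℂ] MvPolynomial (Fin 2) ℂ :=
  aeval (excVec p i (X 0) (X 1))

theorem eval_excPull (p : Fin r → Y) (i : Fin r) (v : Fin 2 → ℂ) (F : ARing r) :
    eval v (excPull p i F) = eval (excVec p i (v 0) (v 1)) F := by
  have h := comp_aeval (aeval (R := ℂ) v) (f := excVec p i (X 0 : MvPolynomial (Fin 2) ℂ) (X 1))
  have h2 := DFunLike.congr_fun h F
  simp only [AlgHom.comp_apply, map_excVec, aeval_X] at h2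
  rw [aeval_eq_eval, aeval_eq_eval] at h2
  exact h2

theorem excPt_mem_zeroLocus_iff {p : Fin r → Y} (hp : Function.Injective p) (i : Fin r) {s t : ℂ}
    (h : s ≠ 0 ∨ t ≠ 0) {F : ARing r} {d : Fin 2 ⊕ Fin r → ℕ} (hF : IsMultiHom F d) :
    excPt hp i s t h ∈ zeroLocus F ↔ eval ![s, t] (excPull p i F) = 0 := by
  rw [eval_excPull]
  exact mkPt_mem_zeroLocus hF _ _

theorem exceptional_subset_zeroLocus_iff {p : Fin r → Y} (hp : Function.Injective p) (i : Fin r)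
    {F : ARing r} {d : Fin 2 ⊕ Fin r → ℕ} (hF : IsMultiHom F d) :
    exceptional p i ⊆ zeroLocus F ↔ excPull p i F = 0 := by
  constructor
  · intro h
    have h1 : X 0 * excPull p i F = 0 := by
      refine MvPolynomial.funext fun v => ?_
      rw [map_mul, eval_X, map_zero]
      by_cases h0 : v 0 = 0
      · rw [h0, zero_mul]
      · have h2 := (excPt_mem_zeroLocus_iff hp i (t := v 1) (Or.inl h0) hF).1 (h (excPt_mem hp i _))
        have h3 : ![v 0, v 1] = v := by ext k; fin_cases k <;> rfl
        rw [← h3, h2, mul_zero]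
    exact (mul_eq_zero.1 h1).resolve_left (X_ne_zero 0)
  · intro h w hw
    obtain ⟨s, t, hst, rfl⟩ := exists_eq_excPt hp hw
    rw [excPt_mem_zeroLocus_iff hp i hst hF, h, map_zero]

theorem isClosed_exceptional (p : Fin r → Y) (i : Fin r) : IsClosed (exceptional p i) :=
  isClosed_closure.inter ((isClosed_singleton (x := p i)).preimage continuous_toY)

theorem excPt_scale {p : Fin r → Y} (hp : Function.Injective p) (i : Fin r) {s t : ℂ}
    (h : s ≠ 0 ∨ t ≠ 0) {c : ℂ} (h' : c * s ≠ 0 ∨ c * t ≠ 0) :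
    excPt hp i (c * s) (c * t) h' = excPt hp i s t h := by
  refine mkPt_eq_of_scale _ _ (fun x => if x = Sum.inr i then c else 1) ?_
  rintro ⟨j | j, k⟩
  · simp [excVec, ambVec]
  · change Fin 4 at k
    by_cases hj : j = i
    · subst hj
      rw [if_pos rfl]
      refine (excVec_inr_self p j _ _ k).trans ((?_ : _ = _).trans
        (congrArg (c * ·) (excVec_inr_self p j s t k)).symm)
      fin_cases k <;> simp [mul_assoc]
    · rw [if_neg (by simpa using hj), one_mul]
      exact (excVec_inr_of_ne p hj _ _ k).trans (excVec_inr_of_ne p hj _ _ k).symm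

theorem finite_of_subset_exceptional {p : Fin r → Y} (hp : Function.Injective p) (i : Fin r)
    {Z : Set (Ambient r)} (hZ : IsClosed Z) (hZE : Z ⊆ exceptional p i)
    (h : ¬ exceptional p i ⊆ Z) : Z.Finite := by
  obtain ⟨F, d, hF, hZF, hEF⟩ := exists_multiHom_of_not_subset hZ h
  rw [exceptional_subset_zeroLocus_iff hp i hF] at hEF
  let q : Polynomial ℂ := aeval ![1, Polynomial.X] (excPull p i F)
  have hq : ∀ t, q.eval t = eval ![1, t] (excPull p i F) := by
    intro t
    have : ((Polynomial.evalRingHom t).comp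
        (aeval (![1, Polynomial.X] : Fin 2 → Polynomial ℂ)).toRingHom) = eval ![1, t] := by
      ext k
      · simp
      · fin_cases k <;> simp
    exact DFunLike.congr_fun this _
  have hex : ∀ (s t : ℂ) (hs : s ≠ 0), excPt hp i s t (Or.inl hs) =
      excPt hp i 1 (t / s) (Or.inl one_ne_zero) := by
    intro s t hs
    rw [← excPt_scale hp i (s := 1) (t := t / s) (c := s) (Or.inl one_ne_zero)
      (Or.inl (by simpa using hs))]
    congr 1
    · ring
    · field_simp
  have hq0 : q ≠ 0 := by
    intro h0
    refine hEF ?_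
    have h1 : X 0 * excPull p i F = 0 := by
      refine MvPolynomial.funext fun v => ?_
      rw [map_mul, eval_X, map_zero]
      by_cases hv : v 0 = 0
      · rw [hv, zero_mul]
      · have h2 := hq (v 1 / v 0)
        rw [h0, Polynomial.eval_zero, eq_comm,
          ← excPt_mem_zeroLocus_iff hp i (Or.inl one_ne_zero) hF, ← hex _ _ hv,
          excPt_mem_zeroLocus_iff hp i _ hF] at h2
        have h3 : ![v 0, v 1] = v := by ext k; fin_cases k <;> rfl
        rw [← h3, h2, mul_zero]
    exact (mul_eq_zero.1 h1).resolve_left (X_ne_zero 0)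
  refine Set.Finite.subset ((((q.roots.toFinset.finite_toSet).image fun t =>
    excPt hp i 1 t (Or.inl one_ne_zero))).insert (excPt hp i 0 1 (Or.inr one_ne_zero))) ?_
  intro w hw
  obtain ⟨s, t, hst, rfl⟩ := exists_eq_excPt hp (hZE hw)
  by_cases hs : s = 0
  · left
    subst hs
    have ht : t ≠ 0 := by simpa using hst
    rw [← excPt_scale hp i (s := 0) (t := 1) (c := t) (Or.inr one_ne_zero)
      (Or.inr (by simpa using ht))]
    congr 1 <;> ring
  · right
    have := hZF hw
    rw [hex s t hs] at this ⊢
    rw [excPt_mem_zeroLocus_iff hp i _ hF, ← hq] at this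
    exact ⟨t / s, by simpa using ⟨hq0, this⟩, rfl⟩

theorem excPt_injective {p : Fin r → Y} (hp : Function.Injective p) (i : Fin r) :
    Function.Injective fun t => excPt hp i 1 t (Or.inl one_ne_zero) := by
  intro t t' h
  have h1 := congrFun h (Sum.inr i)
  obtain ⟨c, hc⟩ := (Projectivization.mk_eq_mk_iff' ℂ _ _ _ _).1 h1
  have h2 : ∀ k : Fin 4, c * excVec p i 1 t' ⟨Sum.inr i, k⟩ = excVec p i 1 t ⟨Sum.inr i, k⟩ :=
    fun k => congrFun hc k
  simp only [excVec_inr_self] at h2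
  obtain ⟨k, hk⟩ := Function.ne_iff.1 (coords_ne_zero (p i) 1)
  obtain ⟨l, hl⟩ := Function.ne_iff.1 (coords_ne_zero (p i) 0)
  have hc1 : c = 1 := by
    have hk' : coords (p i) ⟨1, k⟩ ≠ 0 := hk
    have : c * coords (p i) ⟨1, k⟩ = coords (p i) ⟨1, k⟩ := by
      clear hk hk'
      fin_cases k
      · simpa using h2 0
      · simpa using h2 1
    exact (mul_eq_right₀ hk').1 this
  have hl' : coords (p i) ⟨0, l⟩ ≠ 0 := hl
  have : t' * coords (p i) ⟨0, l⟩ = t * coords (p i) ⟨0, l⟩ := by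
    rw [hc1] at h2
    clear hl hl'
    fin_cases l
    · simpa using h2 2
    · simpa using h2 3
  exact (mul_right_cancel₀ hl' this).symm

theorem isIrreducibleCurve_exceptional {p : Fin r → Y} (hp : Function.Injective p) (i : Fin r) :
    IsIrreducibleCurve p (exceptional p i) := by
  have hirr : IsIrreducible (exceptional p i) := by
    refine isIrreducible_of_forall_multiHom ⟨_, excPt_mem hp i (s := 1) (t := 0) (by simp)⟩ ?_
    intro F G d e hF hG h
    rw [exceptional_subset_zeroLocus_iff hp i (hF.mul hG), map_mul, mul_eq_zero] at h
    rwa [exceptional_subset_zeroLocus_iff hp i hF, exceptional_subset_zeroLocus_iff hp i hG]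
  have hinf : (exceptional p i).Infinite :=
    (Set.infinite_range_of_injective (excPt_injective hp i)).mono (by
      rintro _ ⟨t, rfl⟩; exact excPt_mem hp i _)
  exact ⟨fun _ hw => hw.1, isClosed_exceptional p i, hirr,
    topologicalKrullDim_eq_one_of_finite (isClosed_exceptional p i) hirr hinf
      fun Z hZ hZE hne => finite_of_subset_exceptional hp i hZ hZE
        fun h => hne (hZE.antisymm h)⟩

end Exceptional

/-! ### Proper transforms -/

section Strict

variable {r : ℕ}

/-- The determinant of a fixed vector `c` and the vector `(x, y)`. -/
def detForm {A : Type} [CommRing A] [Algebra ℂ A] (c : Fin 2 → ℂ) (x y : A) : A :=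
  algebraMap ℂ A (c 0) * y - algebraMap ℂ A (c 1) * x

theorem map_detForm {A B : Type} [CommRing A] [Algebra ℂ A] [CommRing B] [Algebra ℂ B]
    (φ : A →ₐ[ℂ] B) (c : Fin 2 → ℂ) (x y : A) :
    φ (detForm c x y) = detForm c (φ x) (φ y) := by
  simp [detForm]

/-- A lift of the monomial `x` in linear forms `l₀, l₁` on the first and `m₀, m₁` on the second
factor, where `l₁` and `m₁` vanish at the centre: `k` of the factors `l₁` and `m₁` are replaced by
the sections `U` and `W` of `𝒪(1)` on the exceptional factor, `l₁` being replaced first. Since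
`U = l₁ m₀` and `W = l₀ m₁` on the graph, `m₀` or `l₀` is supplied for each factor left in excess,
so that the lift is `(l₀ m₀) ^ k` times the monomial there. -/
def liftTerm {A : Type} [CommRing A] (k : ℕ) (l m : Fin 2 → A) (U W : A)
    (x : (Σ _ : Fin 2, Fin 2) →₀ ℕ) : A :=
  U ^ min (x ⟨0, 1⟩) k * W ^ (k - min (x ⟨0, 1⟩) k) *
    (l 0 ^ (x ⟨0, 0⟩ + min (x ⟨0, 1⟩) k) * l 1 ^ (x ⟨0, 1⟩ - min (x ⟨0, 1⟩) k)) *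
    (m 0 ^ (x ⟨1, 0⟩ + (k - min (x ⟨0, 1⟩) k)) * m 1 ^ (x ⟨1, 1⟩ - (k - min (x ⟨0, 1⟩) k)))

theorem map_liftTerm {A B : Type} [CommRing A] [Algebra ℂ A] [CommRing B] [Algebra ℂ B]
    (φ : A →ₐ[ℂ] B) (k : ℕ) (l m : Fin 2 → A) (U W : A) (x : (Σ _ : Fin 2, Fin 2) →₀ ℕ) :
    φ (liftTerm k l m U W x) =
      liftTerm k (fun j => φ (l j)) (fun j => φ (m j)) (φ U) (φ W) x := by
  simp [liftTerm]

theorem liftTerm_graph {A : Type} [CommRing A] {k : ℕ} (l m : Fin 2 → A)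
    {x : (Σ _ : Fin 2, Fin 2) →₀ ℕ} (hx : k ≤ x ⟨0, 1⟩ + x ⟨1, 1⟩) :
    liftTerm k l m (l 1 * m 0) (m 1 * l 0) x = (l 0 * m 0) ^ k *
      ((l 0 ^ x ⟨0, 0⟩ * l 1 ^ x ⟨0, 1⟩) * (m 0 ^ x ⟨1, 0⟩ * m 1 ^ x ⟨1, 1⟩)) := by
  unfold liftTerm
  have h1 : min (x ⟨0, 1⟩) k ≤ x ⟨0, 1⟩ := min_le_left _ _
  have h2 : min (x ⟨0, 1⟩) k ≤ k := min_le_right _ _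
  have h3 : k - min (x ⟨0, 1⟩) k ≤ x ⟨1, 1⟩ := by omega
  generalize min (x ⟨0, 1⟩) k = a at *
  obtain ⟨b, rfl⟩ := Nat.exists_eq_add_of_le h2
  obtain ⟨c, hc⟩ := Nat.exists_eq_add_of_le h1
  rw [Nat.add_sub_cancel_left] at *
  obtain ⟨d, hd⟩ := Nat.exists_eq_add_of_le h3
  rw [hc, hd, Nat.add_sub_cancel_left, Nat.add_sub_cancel_left]
  ring

theorem liftTerm_exc {A : Type} [CommRing A] {k : ℕ} (s t : A)
    {x : (Σ _ : Fin 2, Fin 2) →₀ ℕ} (hx : k ≤ x ⟨0, 1⟩ + x ⟨1, 1⟩) :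
    liftTerm k ![1, 0] ![1, 0] s t x =
      if x ⟨0, 1⟩ + x ⟨1, 1⟩ = k then s ^ x ⟨0, 1⟩ * t ^ x ⟨1, 1⟩ else 0 := by
  unfold liftTerm
  split_ifs with h
  · have h1 : min (x ⟨0, 1⟩) k = x ⟨0, 1⟩ := by omega
    have h2 : k - x ⟨0, 1⟩ = x ⟨1, 1⟩ := by omega
    rw [h1, h2]
    simp
  · by_cases h1 : x ⟨0, 1⟩ - min (x ⟨0, 1⟩) k = 0
    · have h2 : x ⟨1, 1⟩ - (k - min (x ⟨0, 1⟩) k) ≠ 0 := by omega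
      simp [h2]
    · simp [h1]

/-- The linear forms dual to the bases of the two copies of `ℂ²` given by the point `P` and the
vectors `u`: those with second index `1` vanish at `P`. -/
def dualForm {A : Type} [CommRing A] [Algebra ℂ A] (P : YVec) (u : Fin 2 → Fin 2 → ℂ)
    (v : (Σ _ : Fin 2, Fin 2) → A) (x : Σ _ : Fin 2, Fin 2) : A :=
  if x.2 = 0 then -detForm (u x.1) (v ⟨x.1, 0⟩) (v ⟨x.1, 1⟩)
  else detForm (fun k => P ⟨x.1, k⟩) (v ⟨x.1, 0⟩) (v ⟨x.1, 1⟩)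

theorem map_dualForm {A B : Type} [CommRing A] [Algebra ℂ A] [CommRing B] [Algebra ℂ B]
    (φ : A →ₐ[ℂ] B) (P : YVec) (u : Fin 2 → Fin 2 → ℂ) (v : (Σ _ : Fin 2, Fin 2) → A)
    (x : Σ _ : Fin 2, Fin 2) :
    φ (dualForm P u v x) = dualForm P u (fun x => φ (v x)) x := by
  unfold dualForm
  split_ifs
  · rw [map_neg, map_detForm]
  · rw [map_detForm]

/-- The form `f` expressed in the coordinates `dualForm P u`: when `P` and `u` have
determinant `1` in both factors, substituting the linear forms `dualForm P u` gives back `f`. The order of vanishing of `f`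
at `P` is the lowest degree in the two variables with second index `1`. -/
def adaptedForm (P : YVec) (u : Fin 2 → Fin 2 → ℂ) : YRing →ₐ[ℂ] YRing :=
  aeval fun x => C (P x) * X ⟨x.1, 0⟩ + C (u x.1 x.2) * X ⟨x.1, 1⟩

theorem isMultiHom_adaptedForm (P : YVec) (u : Fin 2 → Fin 2 → ℂ) {f : YRing} {d : Fin 2 → ℕ}
    (hf : IsMultiHom f d) : IsMultiHom (adaptedForm P u f) d := by
  have hX : ∀ (j k : Fin 2) (c : ℂ), IsMultiHom (C c * X ⟨j, k⟩ : YRing) (Pi.single j 1) :=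
    fun j k c => (isMultiHom_X (n := fun _ : Fin 2 => 2) ⟨j, k⟩).C_mul c
  have hφ : ∀ x : (Σ _ : Fin 2, Fin 2),
      IsMultiHom (C (P x) * X ⟨x.1, 0⟩ + C (u x.1 x.2) * X ⟨x.1, 1⟩ : YRing) (Pi.single x.1 1) :=
    fun x => (hX _ _ _).add (hX _ _ _)
  have := hf.aeval (D := fun j => Pi.single j 1) hφ
  have hd : ∑ j, d j • (Pi.single j 1 : Fin 2 → ℕ) = d := by
    funext j; simp [Finset.sum_apply, Pi.single_apply]
  rwa [hd] at this

variable {P : YVec} {u : Fin 2 → Fin 2 → ℂ}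

theorem C_det_eq_one {σ : Type} (hu : ∀ j, P ⟨j, 0⟩ * u j 1 - P ⟨j, 1⟩ * u j 0 = 1) (j : Fin 2) :
    (C (P ⟨j, 0⟩) * C (u j 1) - C (P ⟨j, 1⟩) * C (u j 0) : MvPolynomial σ ℂ) = 1 := by
  rw [← C_mul, ← C_mul, ← C_sub, hu, C_1]

theorem aeval_dualForm_adaptedForm (hu : ∀ j, P ⟨j, 0⟩ * u j 1 - P ⟨j, 1⟩ * u j 0 = 1)
    (f : YRing) : aeval (dualForm P u (X : _ → YRing)) (adaptedForm P u f) = f := by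
  have h1 : (aeval (dualForm P u (X : _ → YRing))).comp (adaptedForm P u) = AlgHom.id ℂ _ := by
    refine MvPolynomial.algHom_ext fun x => ?_
    obtain ⟨j, k⟩ := x
    have hC := C_det_eq_one (σ := Σ _ : Fin 2, Fin 2) hu j
    rw [AlgHom.comp_apply, adaptedForm, aeval_X, map_add, map_mul, map_mul, aeval_X, aeval_X,
      aeval_C, aeval_C, AlgHom.id_apply]
    simp only [dualForm, detForm, if_true, one_ne_zero, if_false, algebraMap_eq]
    fin_cases k <;> simp only [Fin.zero_eta, Fin.mk_one]
    · linear_combination (X ⟨j, 0⟩ : YRing) * hC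
    · linear_combination (X ⟨j, 1⟩ : YRing) * hC
  exact DFunLike.congr_fun h1 f

theorem isMultiHom_detForm {κ : Fin 2 ⊕ Fin r → ℕ} (c : Fin 2 → ℂ) {y z : ARing r}
    (hy : IsMultiHom y κ) (hz : IsMultiHom z κ) : IsMultiHom (detForm c y z) κ :=
  (hz.C_mul _).sub (hy.C_mul _)

theorem IsMultiHom.neg {ι : Type} [DecidableEq ι] {n : ι → ℕ} {f : CoordRing n} {d : ι → ℕ}
    (hf : IsMultiHom f d) : IsMultiHom (-f) d := by
  simpa using (isMultiHom_zero d).sub hf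

theorem isMultiHom_dualForm (P : YVec) (u : Fin 2 → Fin 2 → ℂ) (j k : Fin 2) :
    IsMultiHom (dualForm P u (baseVar r) ⟨j, k⟩) (Pi.single (Sum.inl j) 1) := by
  have hb : ∀ l : Fin 2, IsMultiHom (baseVar r ⟨j, l⟩) (Pi.single (Sum.inl j) 1) := fun l =>
    isMultiHom_baseVar ⟨j, l⟩
  have h1 := (isMultiHom_detForm (u j) (hb 0) (hb 1)).neg
  have h2 := isMultiHom_detForm (fun k => P ⟨j, k⟩) (hb 0) (hb 1)
  unfold dualForm
  split_ifs
  · exact h1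
  · exact h2

/-- The sections of `𝒪(1)` on the `i`-th factor `ℙ³` that restrict to coordinates on the
exceptional curve. -/
def excForm (i : Fin r) (u : Fin 2 → Fin 2 → ℂ) : Fin 2 → ARing r :=
  ![-detForm (u 1) (excVar i 0) (excVar i 1), -detForm (u 0) (excVar i 2) (excVar i 3)]

theorem isMultiHom_excForm (i : Fin r) (j : Fin 2) :
    IsMultiHom (excForm i u j) (Pi.single (Sum.inr i) 1) := by
  have h : ∀ (c : Fin 2 → ℂ) (k l : Fin 4),
      IsMultiHom (-detForm c (excVar i k) (excVar i l)) (Pi.single (Sum.inr i) 1) :=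
    fun c k l => (isMultiHom_detForm c (isMultiHom_excVar i k) (isMultiHom_excVar i l)).neg
  match j with
  | 0 => exact h (u 1) 0 1
  | 1 => exact h (u 0) 2 3

theorem graphPull_excForm_zero (p : Fin r → Y) (i : Fin r) :
    graphPull p (excForm i u 0) =
      dualForm (coords (p i)) u X ⟨0, 1⟩ * dualForm (coords (p i)) u X ⟨1, 0⟩ := by
  simp only [excForm, Matrix.cons_val_zero, map_neg, map_detForm, graphPull_excVar]
  simp only [dualForm, centreVec, detForm]
  simp; ring

theorem graphPull_excForm_one (p : Fin r → Y) (i : Fin r) :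
    graphPull p (excForm i u 1) =
      dualForm (coords (p i)) u X ⟨1, 1⟩ * dualForm (coords (p i)) u X ⟨0, 0⟩ := by
  simp only [excForm, Matrix.cons_val_one, Matrix.cons_val_fin_one, map_neg, map_detForm,
    graphPull_excVar]
  simp only [dualForm, centreVec, detForm]
  simp; ring

theorem excPull_excForm (p : Fin r → Y) (i : Fin r)
    (hu : ∀ j, coords (p i) ⟨j, 0⟩ * u j 1 - coords (p i) ⟨j, 1⟩ * u j 0 = 1) (j : Fin 2) :
    excPull p i (excForm i u j) = X j := by
  have h : ∀ k, excPull p i (excVar i k) = _ := fun k =>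
    (aeval_X _ _).trans (excVec_inr_self p i _ _ k)
  fin_cases j
  · simp only [excForm, Fin.zero_eta, Matrix.cons_val_zero, map_neg, map_detForm, h]
    simp only [detForm, algebraMap_eq, Matrix.cons_val]
    linear_combination X 0 * C_det_eq_one (σ := Fin 2) hu 1
  · simp only [excForm, Fin.mk_one, Matrix.cons_val_one, Matrix.cons_val_fin_one, map_neg,
      map_detForm, h]
    simp only [detForm, algebraMap_eq, Matrix.cons_val]
    linear_combination X 1 * C_det_eq_one (σ := Fin 2) hu 0

theorem excPull_dualForm (p : Fin r → Y) (i : Fin r)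
    (hu : ∀ j, coords (p i) ⟨j, 0⟩ * u j 1 - coords (p i) ⟨j, 1⟩ * u j 0 = 1) (j : Fin 2) :
    (fun k => excPull p i (dualForm (coords (p i)) u (baseVar r) ⟨j, k⟩)) = ![1, 0] := by
  have hC := C_det_eq_one (σ := Fin 2) hu j
  have hb : ∀ k, excPull p i (baseVar r ⟨j, k⟩) = C (coords (p i) ⟨j, k⟩) := fun k => aeval_X _ _
  funext k
  rw [map_dualForm]
  simp only [dualForm, hb, detForm, algebraMap_eq]
  fin_cases k
  · simp only [Fin.zero_eta, if_true, Matrix.cons_val_zero]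
    linear_combination hC
  · simp only [Fin.mk_one, one_ne_zero, if_false, Matrix.cons_val_one, Matrix.cons_val_fin_one]
    ring

/-- For `f` with order of vanishing `k` at the centre `p i` with coordinates `P`, this form
restricts to the leading form of `f` on the exceptional curve, and vanishes on the proper transform
of `f = 0`. -/
def liftForm (i : Fin r) (P : YVec) (u : Fin 2 → Fin 2 → ℂ) (k : ℕ) (f : YRing) : ARing r :=
  ∑ x ∈ (adaptedForm P u f).support, C (coeff x (adaptedForm P u f)) *
    liftTerm k (fun j => dualForm P u (baseVar r) ⟨0, j⟩) (fun j => dualForm P u (baseVar r) ⟨1, j⟩)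
      (excForm i u 0) (excForm i u 1) x

theorem isMultiHom_liftForm (i : Fin r) {f : YRing} {d : Fin 2 → ℕ} (hf : IsMultiHom f d) {k : ℕ}
    (hk : ∀ x ∈ (adaptedForm P u f).support, k ≤ x ⟨0, 1⟩ + x ⟨1, 1⟩) :
    IsMultiHom (liftForm i P u k f) (k • Pi.single (Sum.inr i) 1 + d 0 • Pi.single (Sum.inl 0) 1 +
      d 1 • Pi.single (Sum.inl 1) 1) := by
  refine IsMultiHom.sum fun x hx => IsMultiHom.C_mul ?_ _
  have h := (((((isMultiHom_excForm (u := u) i 0).pow (min (x ⟨0, 1⟩) k)).mul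
    ((isMultiHom_excForm (u := u) i 1).pow (k - min (x ⟨0, 1⟩) k))).mul
    (((isMultiHom_dualForm P u 0 0).pow (x ⟨0, 0⟩ + min (x ⟨0, 1⟩) k)).mul
      ((isMultiHom_dualForm P u 0 1).pow (x ⟨0, 1⟩ - min (x ⟨0, 1⟩) k)))).mul
    (((isMultiHom_dualForm P u 1 0).pow (x ⟨1, 0⟩ + (k - min (x ⟨0, 1⟩) k))).mul
      ((isMultiHom_dualForm P u 1 1).pow (x ⟨1, 1⟩ - (k - min (x ⟨0, 1⟩) k)))))
  have hm := hk x hx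
  have d0 := (isMultiHom_adaptedForm P u hf).sum_exponents (mem_support_iff.1 hx) 0
  have d1 := (isMultiHom_adaptedForm P u hf).sum_exponents (mem_support_iff.1 hx) 1
  rw [Fin.sum_univ_two] at d0 d1
  rw [← add_smul, ← add_smul, ← add_smul] at h
  rw [show min (x ⟨0, 1⟩) k + (k - min (x ⟨0, 1⟩) k) = k by omega,
    show x ⟨0, 0⟩ + min (x ⟨0, 1⟩) k + (x ⟨0, 1⟩ - min (x ⟨0, 1⟩) k) = d 0 by omega,
    show x ⟨1, 0⟩ + (k - min (x ⟨0, 1⟩) k) + (x ⟨1, 1⟩ - (k - min (x ⟨0, 1⟩) k)) = d 1 by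
      omega] at h
  exact h

theorem dvd_graphPull_liftForm (p : Fin r → Y) (i : Fin r) (f : YRing) {k : ℕ}
    (hu : ∀ j, coords (p i) ⟨j, 0⟩ * u j 1 - coords (p i) ⟨j, 1⟩ * u j 0 = 1)
    (hk : ∀ x ∈ (adaptedForm (coords (p i)) u f).support, k ≤ x ⟨0, 1⟩ + x ⟨1, 1⟩) :
    f ∣ graphPull p (liftForm i (coords (p i)) u k f) := by
  set L : (Σ _ : Fin 2, Fin 2) → YRing := dualForm (coords (p i)) u X with hL
  have hexp : f = ∑ x ∈ (adaptedForm (coords (p i)) u f).support,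
      C (coeff x (adaptedForm (coords (p i)) u f)) *
      ((L ⟨0, 0⟩ ^ x ⟨0, 0⟩ * L ⟨0, 1⟩ ^ x ⟨0, 1⟩) *
      (L ⟨1, 0⟩ ^ x ⟨1, 0⟩ * L ⟨1, 1⟩ ^ x ⟨1, 1⟩)) := by
    conv_lhs => rw [← aeval_dualForm_adaptedForm hu f]
    rw [aeval_def, eval₂_eq', algebraMap_eq]
    refine Finset.sum_congr rfl fun x _ => ?_
    rw [Fintype.prod_sigma, Fin.prod_univ_two, Fin.prod_univ_two, Fin.prod_univ_two]
  refine ⟨(L ⟨0, 0⟩ * L ⟨1, 0⟩) ^ k, ?_⟩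
  have hsum := congrArg (· * (L ⟨0, 0⟩ * L ⟨1, 0⟩) ^ k) hexp
  refine Eq.trans ?_ hsum.symm
  rw [liftForm, map_sum, Finset.sum_mul]
  refine Finset.sum_congr rfl fun x hx => ?_
  rw [map_mul, map_liftTerm, graphPull_excForm_zero, graphPull_excForm_one]
  simp only [map_dualForm, graphPull_baseVar]
  rw [← hL, liftTerm_graph (fun j => L ⟨0, j⟩) (fun j => L ⟨1, j⟩) (hk x hx)]
  have : graphPull p (C (coeff x (adaptedForm (coords (p i)) u f))) =
    C (coeff x (adaptedForm (coords (p i)) u f)) := (graphPull p).commutes _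
  rw [this]; ring

theorem excPull_liftForm_ne_zero (p : Fin r → Y) (i : Fin r) {f : YRing} {d : Fin 2 → ℕ}
    (hf : IsMultiHom f d) {k : ℕ}
    (hu : ∀ j, coords (p i) ⟨j, 0⟩ * u j 1 - coords (p i) ⟨j, 1⟩ * u j 0 = 1)
    (hk : ∀ x ∈ (adaptedForm (coords (p i)) u f).support, k ≤ x ⟨0, 1⟩ + x ⟨1, 1⟩)
    {x₀ : (Σ _ : Fin 2, Fin 2) →₀ ℕ} (hx₀ : x₀ ∈ (adaptedForm (coords (p i)) u f).support)
    (hx₀k : x₀ ⟨0, 1⟩ + x₀ ⟨1, 1⟩ = k) :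
    excPull p i (liftForm i (coords (p i)) u k f) ≠ 0 := by
  have hft := isMultiHom_adaptedForm (coords (p i)) u hf
  have hGe : excPull p i (liftForm i (coords (p i)) u k f) =
      ∑ x ∈ (adaptedForm (coords (p i)) u f).support,
        C (coeff x (adaptedForm (coords (p i)) u f)) *
        if x ⟨0, 1⟩ + x ⟨1, 1⟩ = k then X 0 ^ x ⟨0, 1⟩ * X 1 ^ x ⟨1, 1⟩ else 0 := by
    rw [liftForm, map_sum]
    refine Finset.sum_congr rfl fun x hx => ?_
    rw [map_mul, map_liftTerm, excPull_excForm p i hu, excPull_excForm p i hu,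
      excPull_dualForm p i hu, excPull_dualForm p i hu, liftTerm_exc _ _ (hk x hx)]
    congr 1
    exact (excPull p i).commutes _
  intro h0
  have hc := congrArg (coeff (Finsupp.single 0 (x₀ ⟨0, 1⟩) + Finsupp.single 1 (x₀ ⟨1, 1⟩))) h0
  rw [hGe, coeff_sum, coeff_zero, Finset.sum_eq_single x₀] at hc
  · rw [if_pos hx₀k, coeff_C_mul, X_pow_eq_monomial, X_pow_eq_monomial, monomial_mul,
      coeff_monomial, if_pos rfl] at hc
    exact mem_support_iff.1 hx₀ (by simpa using hc)
  · intro x hx hne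
    rw [coeff_C_mul]
    split_ifs with hxk
    · rw [X_pow_eq_monomial, X_pow_eq_monomial, monomial_mul, coeff_monomial, if_neg, mul_zero]
      intro he
      refine hne ?_
      have e0 : x ⟨0, 1⟩ = x₀ ⟨0, 1⟩ := by simpa using DFunLike.congr_fun he 0
      have e1 : x ⟨1, 1⟩ = x₀ ⟨1, 1⟩ := by simpa using DFunLike.congr_fun he 1
      have s0 := hft.sum_exponents (mem_support_iff.1 hx) 0
      have s1 := hft.sum_exponents (mem_support_iff.1 hx) 1
      have s0' := hft.sum_exponents (mem_support_iff.1 hx₀) 0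
      have s1' := hft.sum_exponents (mem_support_iff.1 hx₀) 1
      rw [Fin.sum_univ_two] at s0 s1 s0' s1'
      ext ⟨j, l⟩
      fin_cases j <;> fin_cases l <;> simp only [Fin.zero_eta, Fin.mk_one] <;> omega
    · rw [coeff_zero, mul_zero]
  · intro h; exact absurd hx₀ h

/-- Some form vanishes on the proper transform of `f = 0` but not on the whole exceptional curve over
`p i`. -/
theorem exists_form_of_properTransform (p : Fin r → Y) (i : Fin r) {f : YRing} (hf0 : f ≠ 0)
    {d : Fin 2 → ℕ} (hf : IsMultiHom f d) :
    ∃ (G : ARing r) (e : Fin 2 ⊕ Fin r → ℕ), IsMultiHom G e ∧ f ∣ graphPull p G ∧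
      excPull p i G ≠ 0 := by
  have hdual : ∀ j, ∃ u : Fin 2 → ℂ, coords (p i) ⟨j, 0⟩ * u 1 - coords (p i) ⟨j, 1⟩ * u 0 = 1 :=
    fun j => exists_det_eq_one (coords_ne_zero (p i) j)
  choose u hu using hdual
  have hft0 : adaptedForm (coords (p i)) u f ≠ 0 := by
    intro h
    have := aeval_dualForm_adaptedForm hu f
    rw [h, map_zero] at this
    exact hf0 this.symm
  obtain ⟨x₀, hx₀, hmin⟩ := (adaptedForm (coords (p i)) u f).support.exists_min_image
    (fun x => x ⟨0, 1⟩ + x ⟨1, 1⟩) (support_nonempty.2 hft0)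
  exact ⟨_, _, isMultiHom_liftForm i hf hmin, dvd_graphPull_liftForm p i f hu hmin,
    excPull_liftForm_ne_zero p i hf hu hmin hx₀ rfl⟩

/-- The proper transform of the curve `f = 0`. -/
def properTransform (p : Fin r → Y) (f : YRing) : Set (Ambient r) :=
  closure {w | w ∈ graph p ∧ toY w ∈ zeroLocus f}

theorem image_toY_graph_inter (p : Fin r → Y) (f : YRing) :
    toY '' {w | w ∈ graph p ∧ toY w ∈ zeroLocus f} = zeroLocus f \ Set.range p := by
  ext y
  constructor
  · rintro ⟨w, ⟨hw, hwf⟩, rfl⟩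
    exact ⟨hwf, fun ⟨i, hi⟩ => toY_ne_of_mem_graph hw i hi.symm⟩
  · rintro ⟨hy, hyp⟩
    obtain ⟨w, hw, rfl⟩ := exists_mem_graph (p := p) fun i hi => hyp ⟨i, hi.symm⟩
    exact ⟨w, ⟨hw, hy⟩, rfl⟩

theorem graph_inter_subset_zeroLocus_iff (p : Fin r → Y) {f : YRing} (hf : Irreducible f)
    {d : Fin 2 → ℕ} (hfd : IsMultiHom f d) {F : ARing r} {e : Fin 2 ⊕ Fin r → ℕ}
    (hF : IsMultiHom F e) :
    {w | w ∈ graph p ∧ toY w ∈ zeroLocus f} ⊆ zeroLocus F ↔ f ∣ graphPull p F := by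
  obtain ⟨e', he'⟩ := isMultiHom_graphPull p hF
  constructor
  · intro h
    refine dvd_of_diff_subset_zeroLocus hf hfd he' (Set.finite_range p) ?_
    rw [← image_toY_graph_inter]
    rintro _ ⟨w, hw, rfl⟩
    exact (mem_zeroLocus_iff_of_mem_graph hw.1 hF).1 (h hw)
  · rintro h w ⟨hw, hwf⟩
    exact (mem_zeroLocus_iff_of_mem_graph hw hF).2 (zeroLocus_subset_of_dvd h hwf)

theorem toY_image_properTransform_subset (p : Fin r → Y) {f : YRing} {d : Fin 2 → ℕ}
    (hfd : IsMultiHom f d) : toY '' properTransform p f ⊆ zeroLocus f := by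
  rw [Set.image_subset_iff]
  exact closure_minimal (fun w hw => hw.2) (hfd.isClosed_zeroLocus.preimage continuous_toY)

theorem closure_toY_image_properTransform (p : Fin r → Y) {f : YRing} (hf : Irreducible f)
    {d : Fin 2 → ℕ} (hfd : IsMultiHom f d) :
    closure (toY '' properTransform p f) = zeroLocus f := by
  refine (closure_minimal (toY_image_properTransform_subset p hfd)
    hfd.isClosed_zeroLocus).antisymm fun y hy => ?_
  rw [mem_closure_iff_forall_multiHom]
  intro F e hF h
  refine zeroLocus_subset_of_dvd
    (dvd_of_diff_subset_zeroLocus hf hfd hF (Set.finite_range p) ?_) hy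
  rw [← image_toY_graph_inter]
  exact (Set.image_mono subset_closure).trans h

theorem finite_of_subset_properTransform {p : Fin r → Y} (hp : Function.Injective p) {f : YRing}
    (hf : Irreducible f) {d : Fin 2 → ℕ} (hfd : IsMultiHom f d) {Z : Set (Ambient r)}
    (hZ : IsClosed Z) (hZD : Z ⊆ properTransform p f) (h : ¬ properTransform p f ⊆ Z) :
    Z.Finite := by
  have hDB : properTransform p f ⊆ Blowup p := closure_mono fun w hw => hw.1
  have hZ1 : (Z ∩ graph p).Finite := by
    have h' : ¬ {w | w ∈ graph p ∧ toY w ∈ zeroLocus f} ⊆ Z := fun h0 => h (closure_minimal h0 hZ)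
    obtain ⟨F, e, hF, hZF, hSF⟩ := exists_multiHom_of_not_subset hZ h'
    rw [graph_inter_subset_zeroLocus_iff p hf hfd hF] at hSF
    obtain ⟨e', he'⟩ := isMultiHom_graphPull p hF
    refine Set.Finite.of_finite_image (f := toY)
      ((finite_zeroLocus_inter hf hSF hfd he').subset ?_)
      fun w hw w' hw' hww' => eq_of_mem_graph hw.2 hw'.2 hww'
    rintro _ ⟨w, ⟨hwZ, hwg⟩, rfl⟩
    exact ⟨toY_image_properTransform_subset p hfd ⟨w, hZD hwZ, rfl⟩,
      (mem_zeroLocus_iff_of_mem_graph hwg hF).1 (hZF hwZ)⟩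
  have hZ2 : ∀ i, (properTransform p f ∩ exceptional p i).Finite := by
    intro i
    refine finite_of_subset_exceptional hp i (isClosed_closure.inter (isClosed_exceptional p i))
      Set.inter_subset_right fun hsub => ?_
    obtain ⟨G, e, hG, hfG, hGe⟩ := exists_form_of_properTransform p i hf.ne_zero hfd
    refine hGe ((exceptional_subset_zeroLocus_iff hp i hG).1 ?_)
    exact (hsub.trans Set.inter_subset_left).trans
      (closure_minimal ((graph_inter_subset_zeroLocus_iff p hf hfd hG).2 hfG) hG.isClosed_zeroLocus)
  refine (hZ1.union (Set.finite_iUnion hZ2)).subset fun w hw => ?_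
  by_cases hwp : ∃ i, toY w = p i
  · obtain ⟨i, hi⟩ := hwp
    exact Or.inr (Set.mem_iUnion.2 ⟨i, hZD hw, hDB (hZD hw), hi⟩)
  · push Not at hwp
    exact Or.inl ⟨hw, mem_graph_of_mem_blowup (hDB (hZD hw)) hwp⟩

theorem isIrreducibleCurve_properTransform {p : Fin r → Y} (hp : Function.Injective p) {f : YRing}
    (hf : Irreducible f) {d : Fin 2 → ℕ} (hfd : IsMultiHom f d) :
    IsIrreducibleCurve p (properTransform p f) := by
  have hinf' : (zeroLocus f \ Set.range p).Infinite :=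
    (infinite_zeroLocus hf hfd).sdiff (Set.finite_range p)
  rw [← image_toY_graph_inter] at hinf'
  have hinf := hinf'.of_image
  have hirr : IsIrreducible (properTransform p f) := by
    refine (isIrreducible_of_forall_multiHom hinf.nonempty ?_).closure
    intro F G d' e hF hG h
    rw [graph_inter_subset_zeroLocus_iff p hf hfd (hF.mul hG), map_mul] at h
    rw [graph_inter_subset_zeroLocus_iff p hf hfd hF, graph_inter_subset_zeroLocus_iff p hf hfd hG]
    exact hf.prime.dvd_or_dvd h
  exact ⟨closure_mono fun w hw => hw.1, isClosed_closure, hirr,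
    topologicalKrullDim_eq_one_of_finite isClosed_closure hirr (hinf.mono subset_closure)
      fun Z hZ hZD hne => finite_of_subset_properTransform hp hf hfd hZ hZD
        fun h => hne (hZD.antisymm h)⟩

theorem eq_properTransform {p : Fin r → Y} (hp : Function.Injective p) {f : YRing}
    (hf : Irreducible f) {d : Fin 2 → ℕ} (hfd : IsMultiHom f d) {D : Set (Ambient r)}
    (hD : IsIrreducibleCurve p D) (hDf : closure (toY '' D) = zeroLocus f) :
    D = properTransform p f := by
  obtain ⟨hDB, hDc, hDi, -⟩ := hD
  have hDim : toY '' D ⊆ zeroLocus f := hDf ▸ subset_closure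
  have himinf : (toY '' D).Infinite := by
    intro hfin
    rw [hfin.isClosed.closure_eq] at hDf
    exact infinite_zeroLocus hf hfd (hDf ▸ hfin)
  have hsub : D ⊆ properTransform p f := by
    have hcl : IsClosed (toY ⁻¹' Set.range p : Set (Ambient r)) :=
      (Set.finite_range p).isClosed.preimage continuous_toY
    rcases (isPreirreducible_iff_isClosed_union_isClosed.1 hDi.isPreirreducible) _ _ hcl
      (isClosed_closure (s := {w | w ∈ graph p ∧ toY w ∈ zeroLocus f})) (by
        intro w hw
        by_cases hwp : ∃ i, p i = toY w
        · exact Or.inl hwp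
        · push Not at hwp
          exact Or.inr (subset_closure ⟨mem_graph_of_mem_blowup (hDB hw)
            fun i hi => hwp i hi.symm, hDim ⟨w, hw, rfl⟩⟩)) with h1 | h1
    · exact absurd ((Set.finite_range p).subset (Set.image_subset_iff.2 h1)) himinf
    · exact h1
  refine hsub.antisymm ?_
  by_contra h
  exact himinf ((finite_of_subset_properTransform hp hf hfd hDc hsub h).image toY)

end Strict

/-! ### The irreducible curves on the blowup and their classes -/

section Curves

variable {r : ℕ}

/-- The curve with a given name. -/
def curveOf (p : Fin r → Y) : CurveName r → Set (Ambient r)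
  | Sum.inl i => exceptional p i
  | Sum.inr f => properTransform p f.1

theorem class_eq_sumElim (d : Fin 2 → ℕ) (m : Fin r → ℕ) :
    (d 0 : ℝ) • fibreClass r 0 + (d 1 : ℝ) • fibreClass r 1 - ∑ i, (m i : ℝ) • excClass i =
      Sum.elim (fun j => (d j : ℝ)) fun i => -(m i : ℝ) := by
  funext s
  rcases s with j | i
  · fin_cases j <;> simp [fibreClass, excClass, Finset.sum_apply]
  · simp [fibreClass, excClass, Finset.sum_apply, Pi.single_apply]

theorem excClass_eq_sumElim (i : Fin r) :
    excClass i = Sum.elim (fun _ => 0) (Pi.single i 1) := by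
  funext s
  rcases s with j | k
  · simp [excClass]
  · simp [excClass, Pi.single_apply]

variable {p : Fin r → Y} {P : Fin r → YVec}

theorem sumElim_vanishingOrder_eq (hP : ∀ i, ∃ h, p i = mkPt (P i) h) {f : YRing} (hf : f ≠ 0)
    {d : Fin 2 → ℕ} (hd : IsMultiHom f d) :
    (Sum.elim (fun j => (d j : ℝ)) fun i => -(vanishingOrder f (p i) : ℝ) : NS r) =
      Sum.elim (fun j => (d j : ℝ)) fun i => -(ordAt f (P i) : ℝ) := by
  have h : ∀ i, vanishingOrder f (p i) = ordAt f (P i) := fun i => by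
    obtain ⟨h, hi⟩ := hP i
    exact (congrArg (vanishingOrder f) hi).trans (hd.vanishingOrder_mkPt hf (P i) h)
  simp only [h]

theorem isCurveClass_curveOf (hp : Function.Injective p) (hP : ∀ i, ∃ h, p i = mkPt (P i) h)
    {k : CurveName r} {c : NS r} (hc : HasClass P k c) : IsCurveClass p (curveOf p k) c := by
  rcases k with i | ⟨f, hf, d', hd'⟩
  · refine ⟨isIrreducibleCurve_exceptional hp i, Or.inl ⟨i, rfl, ?_⟩⟩
    rw [excClass_eq_sumElim]
    exact hc
  · obtain ⟨d, hd, rfl⟩ := hc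
    refine ⟨isIrreducibleCurve_properTransform hp hf hd, Or.inr ⟨f, d, hf, hd,
      closure_toY_image_properTransform p hf hd, ?_⟩⟩
    rw [class_eq_sumElim]
    exact (sumElim_vanishingOrder_eq hP hf.ne_zero hd).symm

theorem exists_name_of_isCurveClass (hp : Function.Injective p)
    (hP : ∀ i, ∃ h, p i = mkPt (P i) h) {D : Set (Ambient r)} {c : NS r}
    (h : IsCurveClass p D c) : ∃ k, HasClass P k c ∧ D = curveOf p k := by
  obtain ⟨hD, ⟨i, rfl, rfl⟩ | ⟨f, d, hf, hd, hDf, rfl⟩⟩ := h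
  · exact ⟨Sum.inl i, excClass_eq_sumElim i, rfl⟩
  · refine ⟨Sum.inr ⟨f, hf, d, hd⟩, ⟨d, hd, ?_⟩, eq_properTransform hp hf hd hD hDf⟩
    rw [class_eq_sumElim]
    exact sumElim_vanishingOrder_eq hP hf.ne_zero hd

theorem curveOf_eq_of_sameCurve {k k' : CurveName r} (h : SameCurve k k') :
    curveOf p k = curveOf p k' := by
  rcases k with i | f <;> rcases k' with j | g
  · exact congrArg (exceptional p) h
  · exact h.elim
  · exact h.elim
  · simp only [curveOf, properTransform, zeroLocus_eq_of_associated h]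

theorem image_toY_exceptional (hp : Function.Injective p) (i : Fin r) :
    toY '' exceptional p i = {p i} := by
  refine Set.Subset.antisymm (by rintro _ ⟨w, hw, rfl⟩; exact hw.2) ?_
  rintro _ rfl
  exact ⟨_, excPt_mem hp i (s := 1) (t := 0) (by simp), toY_excPt hp i _⟩

theorem sameCurve_of_curveOf_eq (hp : Function.Injective p) {k k' : CurveName r}
    (h : curveOf p k = curveOf p k') : SameCurve k k' := by
  have key : ∀ (i : Fin r) (f : {f : YRing // Irreducible f ∧ ∃ d, IsMultiHom f d}),
      exceptional p i ≠ properTransform p f.1 := by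
    rintro i ⟨f, hf, d, hd⟩ h
    have h1 := closure_toY_image_properTransform p hf hd
    rw [← h, image_toY_exceptional hp, isClosed_singleton.closure_eq] at h1
    exact infinite_zeroLocus hf hd (h1 ▸ Set.finite_singleton _)
  rcases k with i | f <;> rcases k' with j | g
  · have h1 := congrArg (toY '' ·) h
    simp only [curveOf, image_toY_exceptional hp, Set.singleton_eq_singleton_iff] at h1
    exact hp h1
  · exact key i g h
  · exact key j f h.symm
  · obtain ⟨f, hf, d, hd⟩ := f
    obtain ⟨g, hg, e, he⟩ := g
    have h1 : properTransform p f = properTransform p g := h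
    refine associated_of_zeroLocus_eq hf hg hd he ?_
    rw [← closure_toY_image_properTransform p hf hd, h1, closure_toY_image_properTransform p hg he]

theorem HasClass.of_sameCurve {k k' : CurveName r} {c : NS r} (hc : HasClass P k c)
    (h : SameCurve k k') : HasClass P k' c := by
  rcases k with i | ⟨f, hf, _⟩ <;> rcases k' with j | ⟨g, hg, _⟩
  · obtain rfl : i = j := h
    exact hc
  · exact h.elim
  · exact h.elim
  · obtain ⟨d, hd, rfl⟩ := hc
    have h' : Associated f g := h
    refine ⟨d, ?_, ?_⟩
    · obtain ⟨u, rfl⟩ := h'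
      obtain ⟨a, -, ha⟩ := MvPolynomial.isUnit_iff_eq_C_of_isReduced.1 u.isUnit
      have := hd.mul (isMultiHom_C a)
      rwa [← ha, add_zero] at this
    · simp only [ordAt_eq_of_associated hf.ne_zero h']

/-- A transport between the curves on one blowup, as a map of sets. -/
theorem Transports.exists_map_curves {τ : NS r → NS r} (h : Transports P P τ)
    (hp : Function.Injective p) (hP : ∀ i, ∃ h, p i = mkPt (P i) h) :
    ∃ Θ : Set (Ambient r) → Set (Ambient r),
      (∀ D c, IsCurveClass p D c → IsCurveClass p (Θ D) (τ c)) ∧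
      ∀ D D' c c', IsCurveClass p D c → IsCurveClass p D' c' → Θ D = Θ D' → D = D' := by
  obtain ⟨Θ, h1, h2⟩ := h
  have hex : ∀ D c, IsCurveClass p D c → ∃ k, D = curveOf p k := fun D c hD => by
    obtain ⟨k, -, hk⟩ := exists_name_of_isCurveClass hp hP hD
    exact ⟨k, hk⟩
  classical
  let Θ' : Set (Ambient r) → Set (Ambient r) := fun D =>
    if hD : ∃ k, D = curveOf p k then curveOf p (Θ hD.choose) else D
  refine ⟨Θ', fun D c hD => ?_, fun D D' c c' hD hD' he => ?_⟩
  · obtain ⟨k, hkc, hk⟩ := exists_name_of_isCurveClass hp hP hD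
    have hD' : ∃ k, D = curveOf p k := ⟨k, hk⟩
    simp only [Θ', dif_pos hD']
    refine isCurveClass_curveOf hp hP (h1 _ _ (hkc.of_sameCurve ?_))
    exact sameCurve_of_curveOf_eq hp (hk.symm.trans hD'.choose_spec)
  · have e := hex D c hD
    have e' := hex D' c' hD'
    simp only [Θ', dif_pos e, dif_pos e'] at he
    rw [e.choose_spec, e'.choose_spec]
    exact curveOf_eq_of_sameCurve (h2 _ _ (sameCurve_of_curveOf_eq hp he))

end Curves

/-! ### The isometry of `H²` induced by the correspondence of curves -/

section Isometry

variable {r : ℕ}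

theorem inter_swapT_elemT {e : ℕ} (hr : r = 2 * e) (v w : NS r) :
    inter (swapT (elemT e v)) (swapT (elemT e w)) = inter v w := by
  have h : (r : ℝ) = 2 * e := by exact_mod_cast hr
  have hs : ∑ i, (-v (Sum.inl 1) - v (Sum.inr i)) * (-w (Sum.inl 1) - w (Sum.inr i)) =
      r * (v (Sum.inl 1) * w (Sum.inl 1)) + v (Sum.inl 1) * ∑ i, w (Sum.inr i) +
        w (Sum.inl 1) * ∑ i, v (Sum.inr i) + ∑ i, v (Sum.inr i) * w (Sum.inr i) := by
    rw [Finset.mul_sum, Finset.mul_sum]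
    have : (r : ℝ) * (v (Sum.inl 1) * w (Sum.inl 1)) =
        ∑ _i : Fin r, v (Sum.inl 1) * w (Sum.inl 1) := by simp
    rw [this, ← Finset.sum_add_distrib, ← Finset.sum_add_distrib, ← Finset.sum_add_distrib]
    exact Finset.sum_congr rfl fun i _ => by ring
  simp only [inter, swapT, elemT, Sum.elim_inl, Sum.elim_inr, Matrix.cons_val_zero,
    Matrix.cons_val_one, Matrix.cons_val_fin_one]
  rw [hs, h]
  ring

theorem elemT_elemT {e : ℕ} (hr : r = 2 * e) (v : NS r) : elemT e (elemT e v) = v := by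
  have h : (r : ℝ) = 2 * e := by exact_mod_cast hr
  funext s
  rcases s with j | i
  · fin_cases j
    · simp [elemT, h]; ring
    · simp [elemT]
  · simp [elemT]

theorem swapT_swapT (v : NS r) : swapT (swapT v) = v := by
  funext s
  rcases s with j | i
  · fin_cases j <;> simp [swapT]
  · simp [swapT]

/-- The composition of the elementary transformation and the exchange of the factors, as an
automorphism of `H²`. -/
def symmetryT {e : ℕ} (hr : r = 2 * e) : NS r ≃ₗ[ℝ] NS r where
  toFun v := swapT (elemT e v)
  invFun v := elemT e (swapT v)
  map_add' v w := by
    funext s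
    rcases s with j | i
    · fin_cases j <;> (simp [swapT, elemT, Finset.sum_add_distrib]; try ring)
    · simp [swapT, elemT]; ring
  map_smul' a v := by
    funext s
    rcases s with j | i
    · fin_cases j <;> simp [swapT, elemT, ← Finset.mul_sum] <;> ring
    · simp [swapT, elemT]; ring
  left_inv v := by beta_reduce; rw [swapT_swapT, elemT_elemT hr]
  right_inv v := by beta_reduce; rw [elemT_elemT hr, swapT_swapT]

theorem inter_symmetryT {e : ℕ} (hr : r = 2 * e) (v w : NS r) :
    inter (symmetryT hr v) (symmetryT hr w) = inter v w := inter_swapT_elemT hr v w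

variable {p : Fin r → Y} {P : Fin r → YVec}

theorem Transports.representsCurve {τ : NS r →ₗ[ℝ] NS r} (h : Transports P P τ)
    (hp : Function.Injective p) (hP : ∀ i, ∃ h, p i = mkPt (P i) h) {ξ : NS r} {s : ℕ}
    {n : Fin s → ℕ} (hξ : RepresentsCurve p ξ s n) : RepresentsCurve p (τ ξ) s n := by
  obtain ⟨Θ, h1, h2⟩ := h.exists_map_curves hp hP
  obtain ⟨hn, D, c, hD, hDc, rfl⟩ := hξ
  refine ⟨hn, fun j => Θ (D j), fun j => τ (c j), fun j j' hj => hD ?_, fun j => h1 _ _ (hDc j), ?_⟩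
  · exact h2 _ _ _ _ (hDc j) (hDc j') hj
  · rw [map_sum]
    exact Finset.sum_congr rfl fun j _ => map_smul _ _ _

theorem Transports.effective {τ : NS r →ₗ[ℝ] NS r} (h : Transports P P τ)
    (hp : Function.Injective p) (hP : ∀ i, ∃ h, p i = mkPt (P i) h) {ξ : NS r}
    (hξ : ξ ∈ effectiveCone p) : τ ξ ∈ effectiveCone p := by
  obtain ⟨Θ, h1, -⟩ := h.exists_map_curves hp hP
  induction hξ using Submodule.span_induction with
  | mem c hc =>
    obtain ⟨D, hD⟩ := hc
    exact Submodule.subset_span ⟨_, h1 _ _ hD⟩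
  | zero => rw [map_zero]; exact zero_mem _
  | add x y _ _ hx hy => rw [map_add]; exact add_mem hx hy
  | smul a x _ hx =>
    have : τ (a • x) = a • τ x := map_smul τ (a : ℝ) x
    rw [this]
    exact Submodule.smul_mem _ a hx

/-- Nef classes are preserved by an isometry whose inverse maps classes of curves to such
classes. -/
theorem Transports.nef {τ : NS r ≃ₗ[ℝ] NS r} (h : Transports P P τ.symm)
    (hτ : ∀ v w, inter (τ v) (τ w) = inter v w)
    (hp : Function.Injective p) (hP : ∀ i, ∃ h, p i = mkPt (P i) h) {ξ : NS r}
    (hξ : ξ ∈ nefCone p) : τ ξ ∈ nefCone p := by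
  obtain ⟨Θ, h1, -⟩ := h.exists_map_curves hp hP
  intro D c hD
  have := hξ _ _ (h1 D c hD)
  rwa [← hτ, LinearEquiv.apply_symm_apply] at this

theorem fibreClass_mem_nefCone (p : Fin r → Y) : fibreClass r 0 ∈ nefCone p := by
  rintro D c ⟨-, ⟨i, -, rfl⟩ | ⟨f, d, -, -, -, rfl⟩⟩
  · simp [inter, fibreClass, excClass]
  · rw [class_eq_sumElim]
    simp [inter, fibreClass]

/-- A general fibre of the first projection passes through none of the centres. -/
theorem fibreClass_mem_effectiveCone (hp : Function.Injective p)
    (hP : ∀ i, ∃ h, p i = mkPt (P i) h) : fibreClass r 0 ∈ effectiveCone p := by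
  obtain ⟨a, ha⟩ : ∃ a : ℂ, ∀ i, P i ⟨0, 0⟩ ≠ a * P i ⟨0, 1⟩ := by
    have hfin : (⋃ i : Fin r, {a : ℂ | P i ⟨0, 0⟩ = a * P i ⟨0, 1⟩}).Finite := by
      refine Set.finite_iUnion fun i => Set.Subsingleton.finite ?_
      obtain ⟨h, -⟩ := hP i
      intro a ha b hb
      have ha' : P i ⟨0, 0⟩ = a * P i ⟨0, 1⟩ := ha
      have hb' : P i ⟨0, 0⟩ = b * P i ⟨0, 1⟩ := hb
      have h1 : P i ⟨0, 1⟩ ≠ 0 := by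
        intro h0
        refine h 0 (funext fun j => ?_)
        fin_cases j
        · exact ha'.trans (by rw [h0, mul_zero]; rfl)
        · exact h0
      exact mul_right_cancel₀ h1 (ha'.symm.trans hb')
    obtain ⟨a, ha⟩ := hfin.infinite_compl.nonempty
    exact ⟨a, fun i hi => ha (Set.mem_iUnion.2 ⟨i, hi⟩)⟩
  let k : CurveName r :=
    Sum.inr ⟨fibForm a, fibForm_irreducible a, _, isMultiHom_fibForm a⟩
  refine Submodule.subset_span
    ⟨curveOf p k, isCurveClass_curveOf hp hP ⟨_, isMultiHom_fibForm a, ?_⟩⟩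
  funext s
  rcases s with j | i
  · fin_cases j <;> simp [fibreClass]
  · simp [fibreClass, ordAt_fibForm_of_ne a _ (ha i)]

/-- For `r ≥ 8` no power of the isometry fixes the class of a fibre of the first projection: the
intersection number with `K_X` is invariant, and this makes the intersection number of the iterates
with the fibres of the first projection grow. -/
theorem symmetryT_iterate_fibreClass_ne {e : ℕ} (hr : r = 2 * e) (he : 4 ≤ e) (n : ℕ) :
    (symmetryT hr)^[n + 1] (fibreClass r 0) ≠ fibreClass r 0 := by
  have he' : (4 : ℝ) ≤ e := by exact_mod_cast he
  have h : (r : ℝ) = 2 * e := by exact_mod_cast hr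
  have key : ∀ n, 1 ≤ (symmetryT hr)^[n + 1] (fibreClass r 0) (Sum.inl 1) ∧
      1 ≤ (symmetryT hr)^[n + 1] (fibreClass r 0) (Sum.inl 1) -
        (symmetryT hr)^[n + 1] (fibreClass r 0) (Sum.inl 0) ∧
      2 * (symmetryT hr)^[n + 1] (fibreClass r 0) (Sum.inl 0) +
        2 * (symmetryT hr)^[n + 1] (fibreClass r 0) (Sum.inl 1) +
        ∑ i, (symmetryT hr)^[n + 1] (fibreClass r 0) (Sum.inr i) = 2 := by
    intro n
    induction n with
    | zero =>
      simp [symmetryT, swapT, elemT, fibreClass]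
    | succ n ih =>
      rw [Function.iterate_succ_apply']
      set v := (symmetryT hr)^[n + 1] (fibreClass r 0)
      obtain ⟨h1, h2, h3⟩ := ih
      have e0 : symmetryT hr v (Sum.inl 0) = v (Sum.inl 1) := rfl
      have e1 : symmetryT hr v (Sum.inl 1) =
        v (Sum.inl 0) + e * v (Sum.inl 1) + ∑ i, v (Sum.inr i) := rfl
      have e2 : ∑ i, symmetryT hr v (Sum.inr i) = -(r * v (Sum.inl 1)) - ∑ i, v (Sum.inr i) := by
        have : ∀ i, symmetryT hr v (Sum.inr i) = -v (Sum.inl 1) - v (Sum.inr i) := fun i => rfl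
        simp [this]
      rw [e0, e1, e2, h]
      refine ⟨?_, ?_, ?_⟩
      · nlinarith
      · nlinarith
      · linarith
  intro hn
  have := (key n).1
  rw [hn] at this
  norm_num [fibreClass] at this

end Isometry

/-! ### Very general configurations -/

section VeryGeneral

/-- The multihomogenization of a rational polynomial in the affine coordinates `x₀ / x₁` of a
product of projective lines, times the product of the coordinates `x₁`. -/
def multiHomogenize {ι : Type} [Fintype ι] (q : MvPolynomial ι ℚ) : CoordRing (fun _ : ι => 2) :=
  (∏ i, X ⟨i, 1⟩) * ∑ m ∈ q.support, C (algebraMap ℚ ℂ (coeff m q)) *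
    ∏ i, (X ⟨i, 0⟩ ^ m i * X ⟨i, 1⟩ ^ (q.totalDegree - m i))

theorem le_totalDegree_apply {ι : Type} {q : MvPolynomial ι ℚ} {m : ι →₀ ℕ}
    (hm : m ∈ q.support) (i : ι) :
    m i ≤ q.totalDegree := by
  refine le_trans ?_ (le_totalDegree hm)
  by_cases hi : i ∈ m.support
  · exact Finset.single_le_sum (f := fun i => m i) (fun _ _ => Nat.zero_le _) hi
  · rw [Finsupp.notMem_support_iff.1 hi]; exact Nat.zero_le _

variable {ι : Type} [Fintype ι]

theorem exists_isMultiHom_multiHomogenize [DecidableEq ι] (q : MvPolynomial ι ℚ) :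
    ∃ d, IsMultiHom (multiHomogenize q) d := by
  have h0 : ∀ (i : ι) (j : Fin 2),
      IsMultiHom (X ⟨i, j⟩ : CoordRing (fun _ : ι => 2)) (Pi.single i 1) := fun i j =>
    isMultiHom_X (n := fun _ : ι => 2) ⟨i, j⟩
  refine ⟨_, (IsMultiHom.prod fun i _ => h0 i 1).mul
    (IsMultiHom.sum (d := ∑ i, q.totalDegree • Pi.single i 1) fun m hm =>
      IsMultiHom.C_mul (IsMultiHom.prod fun i _ => ?_) _)⟩
  have h1 := ((h0 i 0).pow (m i)).mul ((h0 i 1).pow (q.totalDegree - m i))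
  rwa [← add_smul, Nat.add_sub_cancel' (le_totalDegree_apply hm i)] at h1

theorem eval_multiHomogenize (q : MvPolynomial ι ℚ) (v : (Σ _ : ι, Fin 2) → ℂ)
    (hv : ∀ i, v ⟨i, 1⟩ ≠ 0) : eval v (multiHomogenize q) =
      (∏ i, v ⟨i, 1⟩) * ((∏ i, v ⟨i, 1⟩ ^ q.totalDegree) *
        aeval (fun i => v ⟨i, 0⟩ / v ⟨i, 1⟩) q) := by
  rw [multiHomogenize, map_mul, map_prod, map_sum]
  simp only [eval_X]
  congr 1
  rw [aeval_def, eval₂_eq', Finset.mul_sum]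
  refine Finset.sum_congr rfl fun m hm => ?_
  rw [map_mul, eval_C, map_prod, mul_left_comm, ← Finset.prod_mul_distrib]
  congr 1
  refine Finset.prod_congr rfl fun i _ => ?_
  simp only [map_mul, map_pow, eval_X]
  obtain ⟨k, hk⟩ := Nat.exists_eq_add_of_le (le_totalDegree_apply hm i)
  rw [hk, Nat.add_sub_cancel_left, pow_add, div_pow]
  have := pow_ne_zero (m i) (hv i)
  field_simp

theorem zeroLocus_multiHomogenize_ne_univ [DecidableEq ι] {q : MvPolynomial ι ℚ} (hq : q ≠ 0) :
    zeroLocus (multiHomogenize q) ≠ Set.univ := by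
  have hq' : MvPolynomial.map (algebraMap ℚ ℂ) q ≠ 0 :=
    (map_ne_zero_iff _ (map_injective _ (algebraMap ℚ ℂ).injective)).2 hq
  obtain ⟨x, hx⟩ : ∃ x, eval x (MvPolynomial.map (algebraMap ℚ ℂ) q) ≠ 0 := by
    by_contra! h
    exact hq' (MvPolynomial.funext fun x => by rw [h x, map_zero])
  obtain ⟨d, hd⟩ := exists_isMultiHom_multiHomogenize q
  intro hu
  let v : (Σ _ : ι, Fin 2) → ℂ := fun s => ![x s.1, 1] s.2
  have hv : ∀ i, (fun j => v ⟨i, j⟩) ≠ 0 := fun i h0 => one_ne_zero (α := ℂ) (congrFun h0 1)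
  have h1 : mkPt v hv ∈ zeroLocus (multiHomogenize q) := hu ▸ Set.mem_univ _
  rw [mkPt_mem_zeroLocus hd, eval_multiHomogenize q v (fun i => one_ne_zero)] at h1
  refine hx ?_
  rw [eval_map, ← aeval_def]
  simpa [v] using h1

/-- A property that holds for all configurations with algebraically independent affine coordinates
holds for very general configurations. -/
theorem forVeryGeneral_of_algebraicIndependent {r : ℕ} {Q : (Fin r → Y) → Prop}
    (h : ∀ (p : Fin r → Y) (x : Fin r × Fin 2 → ℂ), AlgebraicIndependent ℚ x →
      (∀ i, ∃ h, p i = mkPt (affVec (x (i, 0)) ![x (i, 1), 1]) h) → Q p) : ForVeryGeneral r Q := by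
  have : Nonempty {q : MvPolynomial (Fin r × Fin 2) ℚ // q ≠ 0} := ⟨⟨1, one_ne_zero⟩⟩
  have : Countable (MvPolynomial (Fin r × Fin 2) ℚ) := by
    rw [← Cardinal.mk_le_aleph0_iff]
    refine cardinalMk_le_max.trans (max_le (max_le ?_ ?_) le_rfl) <;>
      exact Cardinal.mk_le_aleph0_iff.2 inferInstance
  obtain ⟨q, hq⟩ := exists_surjective_nat {q : MvPolynomial (Fin r × Fin 2) ℚ // q ≠ 0}
  refine ⟨fun k => zeroLocus (multiHomogenize (q k).1), fun k => ⟨?_, ?_⟩, fun p hp => ?_⟩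
  · obtain ⟨d, hd⟩ := exists_isMultiHom_multiHomogenize (q k).1
    exact hd.isClosed_zeroLocus
  · exact zeroLocus_multiHomogenize_ne_univ (q k).2
  · have hp' : ∀ q : MvPolynomial (Fin r × Fin 2) ℚ, q ≠ 0 →
        eval (coords (configuration p)) (multiHomogenize q) ≠ 0 := by
      intro q' hq'
      obtain ⟨k, hk⟩ := hq ⟨q', hq'⟩
      have : configuration p ∉ zeroLocus (multiHomogenize (q k).1) := hp k
      rw [hk] at this
      exact this
    set v := coords (configuration p)
    have hv : ∀ i, v ⟨i, 1⟩ ≠ 0 := by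
      intro i h0
      refine hp' 1 one_ne_zero ?_
      rw [multiHomogenize, map_mul, map_prod,
        Finset.prod_eq_zero (Finset.mem_univ i) (by simpa using h0), zero_mul]
    refine h p (fun i => v ⟨i, 0⟩ / v ⟨i, 1⟩) ?_ fun i => ?_
    · rw [algebraicIndependent_iff]
      intro q' h0
      by_contra hne
      refine hp' q' hne ?_
      rw [eval_multiHomogenize q' v hv, h0, mul_zero, mul_zero]
    · have hne : ∀ j : Fin 2, (fun k : Fin 2 => affVec (v ⟨(i, 0), 0⟩ / v ⟨(i, 0), 1⟩)
          ![v ⟨(i, 1), 0⟩ / v ⟨(i, 1), 1⟩, 1] ⟨j, k⟩) ≠ 0 := by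
        intro j h0
        have := congrFun h0 1
        fin_cases j <;> simp [affVec] at this
      refine ⟨hne, ?_⟩
      funext j
      rw [← (p i j).mk_rep]
      refine mk_eq_mk_of_minors (m := 2) _ _ fun k l => ?_
      have e : ∀ k : Fin 2, (p i j).rep k = v ⟨(i, j), 1⟩ *
          affVec (v ⟨(i, 0), 0⟩ / v ⟨(i, 0), 1⟩) ![v ⟨(i, 1), 0⟩ / v ⟨(i, 1), 1⟩, 1] ⟨j, k⟩ := by
        intro k
        change v ⟨(i, j), k⟩ = _
        have h0 := hv (i, 0)
        have h1 := hv (i, 1)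
        fin_cases j <;> fin_cases k <;> simp [affVec] <;> field_simp
      rw [e, e]
      ring

end VeryGeneral

end

/-! ### The restriction to symmetric classes -/

section Symmetric

variable {r : ℕ} [NeZero r]

theorem coe_basisV (j : Fin 3) : (basisV r j : NS r) = symClass r j :=
  congrArg Subtype.val (Module.Basis.span_apply (linearIndependent_symClass r) j)

theorem T_basisV (j : Fin 3) : T r (basisV r j) = ∑ i, matT r i j • basisV r i :=
  Matrix.toLin_self _ _ _ _

theorem T_basisV_zero : T r (basisV r 0) = basisV r 1 := by
  rw [T_basisV, Fin.sum_univ_three]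
  simp [matT]

theorem T_basisV_one :
    T r (basisV r 1) = basisV r 0 + ((r : ℝ) / 2) • basisV r 1 - basisV r 2 := by
  rw [T_basisV, Fin.sum_univ_three]
  simp [matT]
  module

theorem T_basisV_two : T r (basisV r 2) = (r : ℝ) • basisV r 1 - basisV r 2 := by
  rw [T_basisV, Fin.sum_univ_three]
  simp [matT]
  module

theorem coe_T {e : ℕ} (hr : r = 2 * e) (ξ : V r) : (T r ξ : NS r) = symmetryT hr ξ := by
  have h : (r : ℝ) = 2 * e := by exact_mod_cast hr
  have key : (V r).subtype ∘ₗ T r = (symmetryT hr).toLinearMap ∘ₗ (V r).subtype := by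
    refine (basisV r).ext fun j => ?_
    simp only [LinearMap.comp_apply, Submodule.subtype_apply, LinearEquiv.coe_coe]
    fin_cases j
    · simp only [Fin.zero_eta, T_basisV_zero, coe_basisV]
      funext s
      rcases s with j | i
      · fin_cases j <;> simp [symClass, symmetryT, swapT, elemT, fibreClass]
      · simp [symClass, symmetryT, swapT, elemT, fibreClass]
    · simp only [Fin.mk_one, T_basisV_one, Submodule.coe_sub, Submodule.coe_add,
        Submodule.coe_smul, coe_basisV]
      funext s
      rcases s with j | i
      · fin_cases j <;>
          simp [symClass, symmetryT, swapT, elemT, fibreClass, excClass, Finset.sum_apply, h]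
      · simp [symClass, symmetryT, swapT, elemT, fibreClass, excClass, Finset.sum_apply,
          Pi.single_apply]
    · simp only [Fin.reduceFinMk, T_basisV_two, Submodule.coe_sub, Submodule.coe_smul, coe_basisV]
      funext s
      rcases s with j | i
      · fin_cases j <;>
          simp [symClass, symmetryT, swapT, elemT, fibreClass, excClass, Finset.sum_apply,
            Pi.single_apply]
      · simp [symClass, symmetryT, swapT, elemT, fibreClass, excClass, Finset.sum_apply,
          Pi.single_apply]
  exact DFunLike.congr_fun key ξ

theorem injective_T {e : ℕ} (hr : r = 2 * e) : Function.Injective (T r) := by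
  intro v w h
  have h1 := congrArg (fun v : V r => (v : NS r)) h
  simp only [coe_T hr] at h1
  exact Subtype.ext ((symmetryT hr).injective h1)

theorem bijective_T {e : ℕ} (hr : r = 2 * e) : Function.Bijective (T r) :=
  have : FiniteDimensional ℝ (V r) := Module.Basis.finiteDimensional_of_finite (basisV r)
  ⟨injective_T hr, LinearMap.injective_iff_surjective.1 (injective_T hr)⟩

end Symmetric

/-! ### Eigenvalues and eigenvectors -/

section Eigen

open Polynomial

variable (r : ℕ)

theorem alpha_add_beta : alpha r + beta r = ((r : ℂ) - 4) / 2 := by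
  unfold alpha beta; ring

theorem alpha_mul_beta : alpha r * beta r = 1 := by
  have h : (((r : ℂ) * ((r : ℂ) - 8)) ^ (1 / 2 : ℂ)) ^ 2 = (r : ℂ) * ((r : ℂ) - 8) := by
    rw [one_div]
    exact Complex.cpow_ofNat_inv_pow _ 2
  unfold alpha beta
  linear_combination -h / 16

theorem alpha_eq : alpha r ^ 2 + 1 = ((r : ℂ) / 2 - 2) * alpha r := by
  linear_combination alpha r * alpha_add_beta r - alpha_mul_beta r

variable [NeZero r]

theorem alpha_add_one_ne_zero : alpha r + 1 ≠ 0 := by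
  intro h
  have h1 : alpha r = -1 := by linear_combination h
  have h2 := alpha_mul_beta r
  have h3 := alpha_add_beta r
  rw [h1] at h2 h3
  have : (r : ℂ) = 0 := by linear_combination -2 * h3 - 2 * h2
  exact NeZero.ne (r : ℂ) this

theorem charpoly_T : (T r).charpoly = X ^ 3 - C ((r : ℝ) / 2 - 1) * X ^ 2 +
    C ((r : ℝ) / 2 - 1) * X - 1 := by
  rw [T, Matrix.charpoly_toLin, Matrix.charpoly, Matrix.det_fin_three]
  have h : (r : ℝ[X]) = 2 * C ((r : ℝ) / 2) := by
    rw [← C_eq_natCast, ← C_ofNat, ← C_mul]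
    congr 1
    ring
  simp [Matrix.charmatrix, matT]
  linear_combination X * h

theorem charpoly_TC_roots : (TC r).charpoly.roots = {alpha r, beta r, 1} := by
  have h : (TC r).charpoly = ((({alpha r, beta r, 1} : Multiset ℂ)).map fun a => X - C a).prod := by
    rw [TC, LinearMap.charpoly_baseChange, charpoly_T]
    have e1 : (C (alpha r) + C (beta r) : ℂ[X]) = C ((r : ℂ) / 2 - 2) := by
      rw [← C_add, alpha_add_beta]; congr 1; ring
    have e2 : (C (alpha r) * C (beta r) : ℂ[X]) = 1 := by
      rw [← C_mul, alpha_mul_beta, C_1]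
    have e3 : (C ((r : ℂ) / 2 - 1) : ℂ[X]) = C ((r : ℂ) / 2 - 2) + 1 := by
      rw [← C_1, ← C_add]; congr 1; ring
    simp only [Polynomial.map_sub, Polynomial.map_add, Polynomial.map_mul, Polynomial.map_pow,
      map_X, Polynomial.map_one, map_C]
    have e4 : (algebraMap ℝ ℂ) ((r : ℝ) / 2 - 1) = (r : ℂ) / 2 - 1 := by simp
    rw [e4, e3, ← e1]
    simp only [Multiset.insert_eq_cons, Multiset.map_cons, Multiset.map_singleton,
      Multiset.prod_cons, Multiset.prod_singleton, C_1]
    linear_combination (1 - X) * e2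
  rw [h, roots_multiset_prod_X_sub_C]

open scoped TensorProduct

variable {r}

theorem TC_vecC (a b c : ℂ) :
    TC r (vecC r a b c) = vecC r b (a + r / 2 * b + r * c) (-b - c) := by
  have hs : ∀ (t : ℝ) (x : ℂ) (v : V r), x ⊗ₜ[ℝ] (t • v) = ((t : ℂ) * x) ⊗ₜ[ℝ] v := by
    intro t x v
    rw [TensorProduct.tmul_smul, TensorProduct.smul_tmul', Complex.real_smul]
  simp only [TC, vecC, map_add, LinearMap.baseChange_tmul, T_basisV_zero, T_basisV_one,
    T_basisV_two, TensorProduct.tmul_add, TensorProduct.tmul_sub, hs, TensorProduct.add_tmul,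
    TensorProduct.sub_tmul, TensorProduct.neg_tmul]
  push_cast
  abel

theorem smul_vecC (t a b c : ℂ) : t • vecC r a b c = vecC r (t * a) (t * b) (t * c) := by
  simp only [vecC, smul_add, TensorProduct.smul_tmul', smul_eq_mul]

theorem vecC_ne_zero (a b : ℂ) {c : ℂ} (hc : c ≠ 0) : vecC r a b c ≠ 0 := by
  intro h
  have h1 : vecC r a b c = ∑ i, (![a, b, c] : Fin 3 → ℂ) i •
      Algebra.TensorProduct.basis ℂ (basisV r) i := by
    simp [vecC, Fin.sum_univ_three, TensorProduct.smul_tmul']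
  rw [h1] at h
  exact hc (Fintype.linearIndependent_iff.1
    (Algebra.TensorProduct.basis ℂ (basisV r)).linearIndependent _ h 2)

variable (r)

theorem hasEigenvector_alpha : Module.End.HasEigenvector (TC r) (alpha r) (vAlpha r) := by
  have hr : (r : ℂ) ≠ 0 := NeZero.ne _
  have h1 := alpha_add_one_ne_zero r
  have h2 := alpha_eq r
  refine ⟨Module.End.mem_eigenspace_iff.2 ?_, vecC_ne_zero _ _ (by simp [hr])⟩
  rw [vAlpha, TC_vecC, smul_vecC]
  congr 1
  · field_simp
  · field_simp
    linear_combination -2 * h2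
  · field_simp
    linear_combination 2 * h2

theorem hasEigenvector_beta : Module.End.HasEigenvector (TC r) (beta r) (vBeta r) := by
  have hr : (r : ℂ) ≠ 0 := NeZero.ne _
  have h1 := alpha_add_one_ne_zero r
  have h2 := alpha_eq r
  have h0 : alpha r ≠ 0 := left_ne_zero_of_mul_eq_one (alpha_mul_beta r)
  have hb : beta r = (alpha r)⁻¹ := eq_inv_of_mul_eq_one_right (alpha_mul_beta r)
  refine ⟨Module.End.mem_eigenspace_iff.2 ?_, vecC_ne_zero _ _ (by simp [hr])⟩
  rw [vBeta, TC_vecC, smul_vecC, hb]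
  congr 1
  · field_simp
  · field_simp
    linear_combination -2 * h2
  · field_simp
    linear_combination 2 * h2

theorem hasEigenvector_canonicalClass :
    Module.End.HasEigenvector (T r) 1 (canonicalClass r) := by
  refine ⟨Module.End.mem_eigenspace_iff.2 ?_, fun h => ?_⟩
  · simp only [canonicalClass, map_add, map_smul, T_basisV_zero, T_basisV_one, T_basisV_two]
    module
  · have h1 : canonicalClass r = ∑ i, (![-2, -2, 1] : Fin 3 → ℝ) i • basisV r i := by
      simp [canonicalClass, Fin.sum_univ_three]
    rw [h1] at h
    exact one_ne_zero (α := ℝ)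
      (Fintype.linearIndependent_iff.1 (basisV r).linearIndependent _ h 2)

end Eigen

/-! ### The automorphisms of the cones -/

section Cones

variable {r : ℕ} [NeZero r]

/-- The automorphism of a cone in `V_r` that is preserved and reflected by `T_r`. -/
def coneEquiv (C : PointedCone ℝ (V r)) (hb : Function.Bijective (T r))
    (hC : ∀ ξ, ξ ∈ C ↔ T r ξ ∈ C) : C ≃ₗ[{c : ℝ // 0 ≤ c}] C where
  toFun ξ := ⟨T r ξ, (hC _).1 ξ.2⟩
  invFun ξ := ⟨(LinearEquiv.ofBijective (T r) hb).symm ξ, by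
    rw [hC]
    have := (LinearEquiv.ofBijective (T r) hb).apply_symm_apply ξ
    rw [LinearEquiv.ofBijective_apply] at this
    rw [this]
    exact ξ.2⟩
  map_add' ξ η := Subtype.ext (map_add (T r) _ _)
  map_smul' a ξ := Subtype.ext (map_smul (T r) (a : ℝ) (ξ : V r))
  left_inv ξ := Subtype.ext ((LinearEquiv.ofBijective (T r) hb).symm_apply_apply _)
  right_inv ξ := Subtype.ext ((LinearEquiv.ofBijective (T r) hb).apply_symm_apply _)

theorem orderOf_coneEquiv {e : ℕ} (hr : r = 2 * e) (he : 4 ≤ e) (C : PointedCone ℝ (V r))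
    (hb : Function.Bijective (T r)) (hC : ∀ ξ, ξ ∈ C ↔ T r ξ ∈ C) (hF : basisV r 0 ∈ C) :
    orderOf (coneEquiv C hb hC) = 0 := by
  rw [orderOf_eq_zero_iff']
  intro n hn h1
  obtain ⟨n, rfl⟩ := Nat.exists_eq_succ_of_ne_zero hn.ne'
  have hpow : ∀ n : ℕ, ((((coneEquiv C hb hC) ^ n) ⟨basisV r 0, hF⟩ : C) : NS r) =
      (symmetryT hr)^[n] (fibreClass r 0) := by
    intro n
    induction n with
    | zero => exact coe_basisV 0
    | succ n ih =>
      rw [Function.iterate_succ_apply', ← ih, pow_succ', ← coe_T]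
      rfl
  refine symmetryT_iterate_fibreClass_ne hr he n ?_
  rw [← hpow, h1]
  exact coe_basisV 0

end Cones

end SymBlowup

end

open SymBlowup in
theorem mainTheorem4 (r : ℕ) [NeZero r] (hr : Even r) :
    -- (a) `T_r` is an automorphism of `V_r` that preserves the intersection form
    (Function.Bijective (T r) ∧
      ∀ v w : V r, inter (T r v : NS r) (T r w : NS r) = inter (v : NS r) (w : NS r)) ∧
    -- (b) eigenvalues (with multiplicity) and eigenvectors of `T_r`
    ((TC r).charpoly.roots = {alpha r, beta r, 1} ∧
      Module.End.HasEigenvector (TC r) (alpha r) (vAlpha r) ∧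
      Module.End.HasEigenvector (TC r) (beta r) (vBeta r) ∧
      Module.End.HasEigenvector (T r) 1 (canonicalClass r)) ∧
    ForVeryGeneral r (fun p =>
      -- (c) `T_r` preserves and reflects nef classes, effective classes and classes of curves
      -- with `s` irreducible components
      (∀ ξ : V r,
        ((ξ : NS r) ∈ nefCone p ↔ (T r ξ : NS r) ∈ nefCone p) ∧
        ((ξ : NS r) ∈ effectiveCone p ↔ (T r ξ : NS r) ∈ effectiveCone p) ∧
        ∀ (s : ℕ) (n : Fin s → ℕ),
          RepresentsCurve p (ξ : NS r) s n ↔ RepresentsCurve p (T r ξ : NS r) s n) ∧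
      -- `T_r` induces automorphisms of the nef and effective cones restricted to `V_r`, of
      -- infinite order if `r ≥ 8`
      (∃ φ : nefConeV p ≃ₗ[{c : ℝ // 0 ≤ c}] nefConeV p,
        (∀ ξ : nefConeV p, (φ ξ : V r) = T r (ξ : V r)) ∧ (8 ≤ r → orderOf φ = 0)) ∧
      (∃ ψ : effectiveConeV p ≃ₗ[{c : ℝ // 0 ≤ c}] effectiveConeV p,
        (∀ ξ : effectiveConeV p, (ψ ξ : V r) = T r (ξ : V r)) ∧ (8 ≤ r → orderOf ψ = 0))) := by
  obtain ⟨e, he⟩ := hr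
  rw [← two_mul] at he
  refine ⟨⟨bijective_T he, fun v w => ?_⟩, ⟨charpoly_TC_roots r, hasEigenvector_alpha r,
    hasEigenvector_beta r, hasEigenvector_canonicalClass r⟩,
    forVeryGeneral_of_algebraicIndependent fun p x hx hP => ?_⟩
  · rw [coe_T he, coe_T he, inter_symmetryT]
  have hinj : Function.Injective fun i => x (i, 0) := fun i j hij => by
    simpa using hx.injective hij
  have hp : Function.Injective p := by
    intro i j hij
    obtain ⟨h1, e1⟩ := hP i
    obtain ⟨h2, e2⟩ := hP j
    rw [e1, e2] at hij
    obtain ⟨c, hc⟩ := (Projectivization.mk_eq_mk_iff' ℂ _ _ _ _).1 (congrFun hij 0)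
    have c1 : c = 1 := by simpa [affVec] using congrFun hc 1
    have c0 : c * x (j, 0) = x (i, 0) := by simpa [affVec] using congrFun hc 0
    rw [c1, one_mul] at c0
    exact hinj c0.symm
  obtain ⟨b', M, N, θ, hMN, hθ, hθ'⟩ := exists_isElemPair_of_algebraicIndependent he hx
  obtain ⟨ht, ht'⟩ := hMN.transports_self hinj θ hθ hθ'
  set τ := symmetryT he with hτ
  have hnef : ∀ ξ : V r, (ξ : NS r) ∈ nefCone p ↔ (T r ξ : NS r) ∈ nefCone p := by
    intro ξ
    rw [coe_T he]
    constructor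
    · exact Transports.nef (τ := τ) ht' (inter_symmetryT he) hp hP
    · intro h
      have := Transports.nef (τ := τ.symm) ht (fun v w => by
        rw [← inter_symmetryT he, ← hτ, τ.apply_symm_apply, τ.apply_symm_apply]) hp hP h
      rwa [τ.symm_apply_apply] at this
  have heff : ∀ ξ : V r, (ξ : NS r) ∈ effectiveCone p ↔ (T r ξ : NS r) ∈ effectiveCone p := by
    intro ξ
    rw [coe_T he]
    constructor
    · exact Transports.effective (τ := τ.toLinearMap) ht hp hP
    · intro h
      have := Transports.effective (τ := τ.symm.toLinearMap) ht' hp hP h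
      rwa [LinearEquiv.coe_coe, τ.symm_apply_apply] at this
  refine ⟨fun ξ => ⟨hnef ξ, heff ξ, fun s n => ?_⟩,
    ⟨coneEquiv (nefConeV p) (bijective_T he) hnef, fun _ => rfl, fun h8 => ?_⟩,
    ⟨coneEquiv (effectiveConeV p) (bijective_T he) heff, fun _ => rfl, fun h8 => ?_⟩⟩
  · rw [coe_T he]
    constructor
    · exact Transports.representsCurve (τ := τ.toLinearMap) ht hp hP
    · intro h
      have := Transports.representsCurve (τ := τ.symm.toLinearMap) ht' hp hP h
      rwa [LinearEquiv.coe_coe, τ.symm_apply_apply] at this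
  · refine orderOf_coneEquiv he (by omega) _ _ _ ?_
    change (basisV r 0 : NS r) ∈ nefCone p
    rw [coe_basisV]
    exact fibreClass_mem_nefCone p
  · refine orderOf_coneEquiv he (by omega) _ _ _ ?_
    change (basisV r 0 : NS r) ∈ effectiveCone p
    rw [coe_basisV]
    exact fibreClass_mem_effectiveCone hp hP
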